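/- **Theorem (Deterministic Polynomial Time Construction).** There is an absolute constant $C$ and a deterministic polynomial-time algorithm that, given a finite simple undirected graph $G=(V,E)$ with $n=|V|$ and a (rational) parameter $\epsilon>0$, finds a subset $F\subseteq E$, non-empty if $E$ is non-empty, of size $|F|\le C\,n/\min\{1,\epsilon\}^2$ (so $|F|=O(n/\epsilon^2)$ for $0<\epsilon\le 1$), such that the following holds. For a graph $H$ on $V$ let $D_H$ be its diagonal degree matrix, $A_H$ its adjacency matrix and $L_H=D_H-A_H$ its Laplacian; let $\tilde G=(V,F)$, let $d=2|E|/|V|$ be the average degree of $G$, let $c=|E|/|F|$, and write $M\preceq N$ if $N-M$ is positive semidefinite. Then $$2cD_{\tilde G}-2D_G-\epsilon D_G-\epsilon d I\;\preceq\; cL_{\tilde G}-L_G\;\preceq\;\epsilon D_G+\epsilon d I .$$ (If $E=\emptyset$, all the matrices $D$ and $L$ are zero, $d$ and $c$ are taken to be $0$ where undefined, and the statement is trivial.) The running time is polynomial in the bit length of the input, that is, of the adjacency matrix of $G$ and of $n$ and $\epsilon$ written in binary. -/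

import Mathlib

namespace AdditiveSparsifier

/-! ### Random access machine with logarithmic cost

Deterministic structured programs over integer registers and integer arrays.  Every operation is
charged the total bit length of the addresses, operands and results that it touches, so that a
running time is, up to polynomial factors, the running time of a Turing machine. -/

/-- Cost of handling the integer `z`: one plus its bit length. -/
def bits (z : ℤ) : ℕ := 1 + Nat.size z.natAbs

/-- The memory: registers `reg x` and arrays `arr a` with cells `arr a i`. A program mentions only
finitely many registers and arrays, but it can address all the cells of an array. -/
@[ext]
structure Memory where
  reg : ℕ → ℤ
  arr : ℕ → ℕ → ℤ

/-- Store `z` in register `x`. -/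
def Memory.setReg (σ : Memory) (x : ℕ) (z : ℤ) : Memory :=
  { σ with reg := Function.update σ.reg x z }

/-- Store `z` in cell `i` of array `a`. -/
def Memory.setArr (σ : Memory) (a i : ℕ) (z : ℤ) : Memory :=
  { σ with arr := Function.update σ.arr a (Function.update (σ.arr a) i z) }

/-- Integer expressions. `read a e` is the content of the cell of array `a` whose index is the
value of `e`; `div` is integer division. -/
inductive Expr where
  | const (z : ℤ)
  | reg (x : ℕ)
  | read (a : ℕ) (e : Expr)
  | add (e f : Expr)
  | sub (e f : Expr)
  | mul (e f : Expr)
  | div (e f : Expr)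

namespace Expr

/-- Value of an expression. Negative indices are treated as index `0`. -/
def eval (σ : Memory) : Expr → ℤ
  | const z => z
  | reg x => σ.reg x
  | read a e => σ.arr a (e.eval σ).toNat
  | add e f => e.eval σ + f.eval σ
  | sub e f => e.eval σ - f.eval σ
  | mul e f => e.eval σ * f.eval σ
  | div e f => e.eval σ / f.eval σ

/-- Time needed to evaluate an expression: each node of the expression tree is charged the bit
length of its value, so each operation pays for its operands, its index and its result. -/
def cost (σ : Memory) : Expr → ℕ
  | const z => bits z
  | reg x => bits (σ.reg x)
  | read a e => e.cost σ + bits ((read a e).eval σ)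
  | add e f => e.cost σ + f.cost σ + bits ((add e f).eval σ)
  | sub e f => e.cost σ + f.cost σ + bits ((sub e f).eval σ)
  | mul e f => e.cost σ + f.cost σ + bits ((mul e f).eval σ)
  | div e f => e.cost σ + f.cost σ + bits ((div e f).eval σ)

end Expr

/-- Programs. `write a e f` stores the value of `f` in the cell of array `a` with index `e`;
the tests of `ite` and `loop` (a while loop) ask whether the value of `e` is positive. -/
inductive Prog where
  | skip
  | assign (x : ℕ) (e : Expr)
  | write (a : ℕ) (e f : Expr)
  | seq (p q : Prog)
  | ite (e : Expr) (p q : Prog)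
  | loop (e : Expr) (p : Prog)

/-- `Exec p σ t τ`: started in memory `σ`, the program `p` halts in memory `τ` after time `t`. -/
inductive Exec : Prog → Memory → ℕ → Memory → Prop where
  | skip (σ : Memory) : Exec .skip σ 1 σ
  | assign (σ : Memory) (x : ℕ) (e : Expr) :
      Exec (.assign x e) σ (1 + e.cost σ) (σ.setReg x (e.eval σ))
  | write (σ : Memory) (a : ℕ) (e f : Expr) :
      Exec (.write a e f) σ (1 + e.cost σ + f.cost σ)
        (σ.setArr a (e.eval σ).toNat (f.eval σ))
  | seq {p q : Prog} {σ τ ρ : Memory} {s t : ℕ} (hp : Exec p σ s τ) (hq : Exec q τ t ρ) :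
      Exec (.seq p q) σ (s + t) ρ
  | ite_true {e : Expr} {p q : Prog} {σ τ : Memory} {t : ℕ} (he : 0 < e.eval σ)
      (hp : Exec p σ t τ) : Exec (.ite e p q) σ (1 + e.cost σ + t) τ
  | ite_false {e : Expr} {p q : Prog} {σ τ : Memory} {t : ℕ} (he : ¬ 0 < e.eval σ)
      (hq : Exec q σ t τ) : Exec (.ite e p q) σ (1 + e.cost σ + t) τ
  | loop_true {e : Expr} {p : Prog} {σ τ ρ : Memory} {s t : ℕ} (he : 0 < e.eval σ)
      (hp : Exec p σ s τ) (hl : Exec (.loop e p) τ t ρ) :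
      Exec (.loop e p) σ (1 + e.cost σ + s + t) ρ
  | loop_false {e : Expr} {p : Prog} {σ : Memory} (he : ¬ 0 < e.eval σ) :
      Exec (.loop e p) σ (1 + e.cost σ) σ

/-- Execution is deterministic: the final memory and the running time are determined by the
program and the initial memory. -/
theorem Exec.deterministic {p : Prog} {σ τ₁ τ₂ : Memory} {t₁ t₂ : ℕ}
    (h₁ : Exec p σ t₁ τ₁) (h₂ : Exec p σ t₂ τ₂) : t₁ = t₂ ∧ τ₁ = τ₂ := by
  induction h₁ generalizing t₂ τ₂ with
  | skip σ => cases h₂; exact ⟨rfl, rfl⟩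
  | assign σ x e => cases h₂; exact ⟨rfl, rfl⟩
  | write σ a e f => cases h₂; exact ⟨rfl, rfl⟩
  | seq _ _ ihp ihq =>
    cases h₂ with
    | seq hp' hq' =>
      obtain ⟨rfl, rfl⟩ := ihp hp'
      obtain ⟨rfl, rfl⟩ := ihq hq'
      exact ⟨rfl, rfl⟩
  | ite_true he _ ih =>
    cases h₂ with
    | ite_true _ hp' => obtain ⟨rfl, rfl⟩ := ih hp'; exact ⟨rfl, rfl⟩
    | ite_false he' _ => exact absurd he he'
  | ite_false he _ ih =>
    cases h₂ with
    | ite_true he' _ => exact absurd he' he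
    | ite_false _ hq' => obtain ⟨rfl, rfl⟩ := ih hq'; exact ⟨rfl, rfl⟩
  | loop_true he _ _ ihp ihl =>
    cases h₂ with
    | loop_true _ hp' hl' =>
      obtain ⟨rfl, rfl⟩ := ihp hp'
      obtain ⟨rfl, rfl⟩ := ihl hl'
      exact ⟨rfl, rfl⟩
    | loop_false he' => exact absurd he he'
  | loop_false he =>
    cases h₂ with
    | loop_true he' _ _ => exact absurd he' he
    | loop_false _ => exact ⟨rfl, rfl⟩

/-! ### Inputs and outputs -/

open Classical in
/-- The initial memory on input `(G, ε)`: registers `0`, `1`, `2` hold the number `n` of vertices,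
the numerator and the denominator of `ε`, and array `0` holds the `n × n` adjacency matrix of `G`,
row by row. Everything else is zero. -/
noncomputable def inputMemory {n : ℕ} (G : SimpleGraph (Fin n)) (ε : ℚ) : Memory where
  reg x := if x = 0 then (n : ℤ) else if x = 1 then ε.num else if x = 2 then (ε.den : ℤ) else 0
  arr a k := if a = 0 ∧ ∃ i j : Fin n, k = i * n + j ∧ G.Adj i j then 1 else 0

/-- The bit length of the input `(G, ε)`: the adjacency matrix, and `n` and `ε` in binary. -/
def inputSize (n : ℕ) (ε : ℚ) : ℕ :=
  n ^ 2 + Nat.size n + Nat.size ε.num.natAbs + Nat.size ε.den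

/-- The output of a computation: array `1` holds the `n × n` matrix of the indicator of the set of
pairs `F`, row by row. -/
def IsOutput {n : ℕ} (τ : Memory) (F : Finset (Sym2 (Fin n))) : Prop :=
  ∀ i j : Fin n, τ.arr 1 (i * n + j) = if s(i, j) ∈ F then 1 else 0

/-- The map `(G, ε) ↦ alg n G ε`, on graphs with vertex set `{0, …, n - 1}` and rational `ε > 0`,
is computed in deterministic polynomial time: one program computes it on all inputs, in time
bounded by a polynomial in the bit length of the input. -/
def PolyTimeComputable
    (alg : ∀ n : ℕ, SimpleGraph (Fin n) → ℚ → Finset (Sym2 (Fin n))) : Prop :=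
  ∃ (P : Prog) (p : Polynomial ℕ), ∀ (n : ℕ) (G : SimpleGraph (Fin n)) (ε : ℚ), 0 < ε →
    ∃ (t : ℕ) (τ : Memory), Exec P (inputMemory G ε) t τ ∧
      t ≤ p.eval (inputSize n ε) ∧ IsOutput τ (alg n G ε)

/-! ### Matrices of a graph -/

section

variable {V : Type*} [Fintype V] [DecidableEq V]

open Classical in
/-- The diagonal degree matrix `D_G`. -/
noncomputable def degM (G : SimpleGraph V) : Matrix V V ℝ := G.degMatrix ℝ

open Classical in
/-- The Laplacian matrix `L_G = D_G - A_G`. -/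
noncomputable def lapM (G : SimpleGraph V) : Matrix V V ℝ := G.lapMatrix ℝ

/-- The average degree `2 |E| / |V|`. -/
noncomputable def avgDegree (G : SimpleGraph V) : ℝ :=
  2 * (G.edgeSet.ncard : ℝ) / (Fintype.card V : ℝ)

/-- The Loewner order: `B - A` is positive semidefinite. -/
def Loewner (A B : Matrix V V ℝ) : Prop := (B - A).PosSemidef

/-- For `F ⊆ E`, the graph `G̃ = (V, F)` satisfies, with `c = |E| / |F|` and `d` the average degree
of `G`,
`2 c D_G̃ - 2 D_G - ε D_G - ε d I ≼ c L_G̃ - L_G ≼ ε D_G + ε d I`. -/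
def SpectralBounds (G : SimpleGraph V) (ε : ℝ) (F : Finset (Sym2 V)) : Prop :=
  let H : SimpleGraph V := SimpleGraph.fromEdgeSet (F : Set (Sym2 V))
  let c : ℝ := (G.edgeSet.ncard : ℝ) / (F.card : ℝ)
  let d : ℝ := avgDegree G
  Loewner ((2 * c) • degM H - (2 : ℝ) • degM G - ε • degM G - (ε * d) • (1 : Matrix V V ℝ))
      (c • lapM H - lapM G) ∧
    Loewner (c • lapM H - lapM G) (ε • degM G + (ε * d) • (1 : Matrix V V ℝ))

end

end AdditiveSparsifier

set_option linter.unusedSectionVars false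


/-! Both inequalities are upper bounds for a form of the sparsifier. The right one compares `c`
times the Laplacian form, a sum of `(x i - x j)^2` over edges, with that of `G`. The left one,
rearranged, does the same for the signless Laplacian `2D - L`, a sum of `(x i + x j)^2`. Give an
edge `{i, j}` with `i < j` the vector `v = e_i + e_{n+j}` in dimension `W = 2n`. At the test vectors
`(x, -x)` and `(x, x)` the form `(v ⬝ᵥ z)^2` becomes these two squares. Hence a single one-sided
statement suffices: among `l` such vectors there are `k` whose sum of squares, scaled by `l / k`, is
at most the sum over all edges plus `N / h`, where `N` is diagonal with entries one plus the degree
and `1 / h ≤ ε`. The degree part of `N` gives the error `ε D`; the added one gives the error `ε d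
I`.

The `k` edges are chosen greedily without replacement, by a one-sided barrier argument. The barrier
matrix `B s T` is a combination of `N`, the selected squares (negative) and all squares (positive).
Its positive definiteness at `s = k` is the desired bound up to scaling (`EdgeSystem.Inv.quad_le`).
The potential is `Tr (N B⁻¹)`, and `(l - s)` times the potential never increases. Indeed, for a
uniformly random unselected edge, with `τ = l - s` edges left, the expected next matrix is `((τ - 1)
/ τ) B + (τ - 1) N`. Convexity of the inverse (`pot_convex`) then leaves some room in the potential,
and an average over the remaining edges shows that one of them fits in this room
(`exists_barrier_step`). An edge of least increase does at least as well (`EdgeSystem.Inv.step`). If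
`l ≤ 2k`, all edges are kept instead.

For the algorithm everything is scaled to integers. The increase caused by an edge is a quotient of
integers formed from the adjugate and the determinant of the barrier matrix, and increases are
compared by cross multiplication. Adjugate and determinant are built from those of the identity by
rank one updates with the Sherman-Morrison formula, in which the divisions are exact; all
intermediate matrices are positive definite (`EdgeSystem.Inv.posDef_part`), so no divisor vanishes.
Leibniz bounds for determinants keep the bit lengths polynomial, and a small program logic (`Runs`)
turns bounds on the stored numbers and on the loop lengths into a polynomial bound on time. -/

namespace AdditiveSparsifier

open Matrix

/-! ### One step of the barrier argument -/

section Barrier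

variable {ι : Type*} [Fintype ι] [DecidableEq ι]

/-- The potential `Tr (N A⁻¹)`, where `N` is the diagonal matrix with entries `d`. -/
noncomputable def pot (d : ι → ℝ) (A : Matrix ι ι ℝ) : ℝ := ∑ a, d a * A⁻¹ a a

theorem posDef_real_iff {A : Matrix ι ι ℝ} :
    A.PosDef ↔ Aᵀ = A ∧ ∀ x, x ≠ 0 → 0 < x ⬝ᵥ (A *ᵥ x) := by
  rw [posDef_iff_dotProduct_mulVec]
  simp [IsHermitian, conjTranspose_eq_transpose_of_trivial]

theorem posSemidef_real_iff {A : Matrix ι ι ℝ} :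
    A.PosSemidef ↔ Aᵀ = A ∧ ∀ x, 0 ≤ x ⬝ᵥ (A *ᵥ x) := by
  rw [posSemidef_iff_dotProduct_mulVec]
  simp [IsHermitian, conjTranspose_eq_transpose_of_trivial]

theorem dotProduct_vecMulVec_self (u x : ι → ℝ) :
    x ⬝ᵥ (vecMulVec u u *ᵥ x) = (u ⬝ᵥ x) ^ 2 := by
  rw [vecMulVec_mulVec]
  simp [dotProduct_smul, sq, dotProduct_comm]

theorem transpose_vecMulVec_self {R : Type*} [CommRing R] (u : ι → R) :
    (vecMulVec u u)ᵀ = vecMulVec u u := by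
  ext i j; simp [vecMulVec_apply, mul_comm]

theorem dotProduct_mulVec_symm {A : Matrix ι ι ℝ} (hA : Aᵀ = A) (x y : ι → ℝ) :
    x ⬝ᵥ (A *ᵥ y) = y ⬝ᵥ (A *ᵥ x) := by
  rw [dotProduct_mulVec, ← mulVec_transpose, hA, dotProduct_comm]

/-- Cauchy-Schwarz: subtracting a short rank one matrix keeps positive definiteness. -/
theorem PosDef.sub_rankOne {M : Matrix ι ι ℝ} (hM : M.PosDef) {g : ℝ} (hg : 0 < g) (u : ι → ℝ)
    (h : g * (u ⬝ᵥ (M⁻¹ *ᵥ u)) < 1) : (M - g • vecMulVec u u).PosDef := by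
  have hMu : M * M⁻¹ = 1 := mul_nonsing_inv _ ((isUnit_iff_isUnit_det _).1 hM.isUnit)
  obtain ⟨hs, hp⟩ := posDef_real_iff.1 hM
  refine posDef_real_iff.2 ⟨by simp [transpose_sub, hs], fun x hx => ?_⟩
  rw [sub_mulVec, smul_mulVec, dotProduct_sub, dotProduct_smul, dotProduct_vecMulVec_self,
    smul_eq_mul]
  set q := u ⬝ᵥ (M⁻¹ *ᵥ u)
  set s := u ⬝ᵥ x
  by_cases hs0 : s = 0
  · simpa [hs0] using hp x hx
  -- The square of `x - g s M⁻¹ u` in the form `M` gives `x ⬝ᵥ M x ≥ 2 g s² - g² s² q`, which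
  -- exceeds `g s²` since `g q < 1`.
  have key : 0 ≤ (x - (g * s) • (M⁻¹ *ᵥ u)) ⬝ᵥ (M *ᵥ (x - (g * s) • (M⁻¹ *ᵥ u))) :=
    (posSemidef_real_iff.1 hM.posSemidef).2 _
  have e1 : (M⁻¹ *ᵥ u) ⬝ᵥ (M *ᵥ x) = s := by
    rw [dotProduct_mulVec_symm hs, mulVec_mulVec, hMu, one_mulVec, dotProduct_comm]
  have e2 : M *ᵥ (M⁻¹ *ᵥ u) = u := by rw [mulVec_mulVec, hMu, one_mulVec]
  rw [mulVec_sub, mulVec_smul, e2, sub_dotProduct, dotProduct_sub, dotProduct_sub, smul_dotProduct,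
    smul_dotProduct, e1, dotProduct_smul, dotProduct_smul, dotProduct_comm x u,
    dotProduct_comm _ u] at key
  simp only [smul_eq_mul] at key
  change 0 ≤ _ - g * s * s - (g * s * s - g * s * (g * s * q)) at key
  have : 0 < s ^ 2 := by positivity
  have : 0 < g * s ^ 2 * (1 - g * q) := by
    have : 0 < 1 - g * q := by linarith
    positivity
  nlinarith

/-- The Sherman-Morrison formula, checked by multiplying out; the hypothesis keeps the denominator
away from zero. -/
theorem inv_sub_rankOne {M : Matrix ι ι ℝ} (hM : M.PosDef) {g : ℝ} (u : ι → ℝ)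
    (h : g * (u ⬝ᵥ (M⁻¹ *ᵥ u)) < 1) :
    (M - g • vecMulVec u u)⁻¹ = M⁻¹ +
      (g / (1 - g * (u ⬝ᵥ (M⁻¹ *ᵥ u)))) • vecMulVec (M⁻¹ *ᵥ u) (M⁻¹ *ᵥ u) := by
  have hMu : M * M⁻¹ = 1 := mul_nonsing_inv _ ((isUnit_iff_isUnit_det _).1 hM.isUnit)
  have hsi : (M⁻¹)ᵀ = M⁻¹ := (posDef_real_iff.1 hM.inv).1
  apply inv_eq_right_inv
  set q := u ⬝ᵥ (M⁻¹ *ᵥ u) with hq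
  have e2 : M *ᵥ (M⁻¹ *ᵥ u) = u := by rw [mulVec_mulVec, hMu, one_mulVec]
  have e3 : u ᵥ* M⁻¹ = M⁻¹ *ᵥ u := by rw [← mulVec_transpose, hsi]
  rw [sub_mul, mul_add, mul_add, hMu, Matrix.mul_smul, mul_vecMulVec, e2, Matrix.smul_mul, vecMulVec_mul, e3,
    Matrix.smul_mul, Matrix.mul_smul, vecMulVec_mul_vecMulVec, ← hq, vecMulVec_smul]
  have : 1 - g * q ≠ 0 := by linarith
  ext i j
  simp only [Matrix.sub_apply, Matrix.add_apply, Matrix.smul_apply, smul_eq_mul, vecMulVec_apply]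
  field_simp
  ring

theorem pot_sub_rankOne (d : ι → ℝ) {M : Matrix ι ι ℝ} (hM : M.PosDef) {g : ℝ} (u : ι → ℝ)
    (h : g * (u ⬝ᵥ (M⁻¹ *ᵥ u)) < 1) :
    pot d (M - g • vecMulVec u u) = pot d M +
      g * (∑ a, d a * ((M⁻¹ *ᵥ u) a) ^ 2) / (1 - g * (u ⬝ᵥ (M⁻¹ *ᵥ u))) := by
  rw [pot, inv_sub_rankOne hM u h, pot, mul_div_right_comm, Finset.mul_sum,
    ← Finset.sum_add_distrib]
  refine Finset.sum_congr rfl fun a _ => ?_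
  simp only [Matrix.add_apply, Matrix.smul_apply, smul_eq_mul, vecMulVec_apply]
  ring

theorem diag_mul_diagonal_mul {B : Matrix ι ι ℝ} (hB : Bᵀ = B) (d u : ι → ℝ) :
    u ⬝ᵥ ((B * diagonal d * B) *ᵥ u) = ∑ a, d a * ((B *ᵥ u) a) ^ 2 := by
  rw [Matrix.mul_assoc, ← mulVec_mulVec, dotProduct_mulVec, ← mulVec_transpose, hB,
    ← mulVec_mulVec, dotProduct]
  refine Finset.sum_congr rfl fun a _ => ?_
  rw [mulVec_diagonal]; ring

/-- Convexity of the trace of the inverse, for one step of the barrier argument. -/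
theorem pot_convex {E : Type*} {d : ι → ℝ} (hd : ∀ a, 0 < d a) {K M : Matrix ι ι ℝ}
    (hK : K.PosDef) (hM : M.PosDef) {g τ : ℝ} (hτ : 1 < τ) (R : Finset E)
    (u : E → ι → ℝ)
    (hMK : M = ((τ - 1) / τ) • K + (τ - 1) • diagonal d +
      (g / τ) • ∑ e ∈ R, vecMulVec (u e) (u e)) :
    (τ - 1) * (pot d M + ((τ - 1) * ∑ a, d a * (M⁻¹ * diagonal d * M⁻¹) a a +
      (g / τ) * ∑ e ∈ R, ∑ a, d a * ((M⁻¹ *ᵥ u e) a) ^ 2)) ≤ τ * pot d K := by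
  have hMu : M * M⁻¹ = 1 := mul_nonsing_inv _ ((isUnit_iff_isUnit_det _).1 hM.isUnit)
  have hMu' : M⁻¹ * M = 1 := nonsing_inv_mul _ ((isUnit_iff_isUnit_det _).1 hM.isUnit)
  have hKu : K * K⁻¹ = 1 := mul_nonsing_inv _ ((isUnit_iff_isUnit_det _).1 hK.isUnit)
  have hKu' : K⁻¹ * K = 1 := nonsing_inv_mul _ ((isUnit_iff_isUnit_det _).1 hK.isUnit)
  have hsM : (M⁻¹)ᵀ = M⁻¹ := (posDef_real_iff.1 hM.inv).1
  have hsK : (K⁻¹)ᵀ = K⁻¹ := (posDef_real_iff.1 hK.inv).1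
  have hτ0 : 0 < τ := by linarith
  have hτ1 : 0 < τ - 1 := by linarith
  -- Expanding this congruence of `K` gives the tangent inequality for the convex map `A ↦ A⁻¹`,
  -- between `K` and a multiple of `M`.
  have psd : ((τ • K⁻¹ - (τ - 1) • M⁻¹) * K * (τ • K⁻¹ - (τ - 1) • M⁻¹)).PosSemidef := by
    have := hK.posSemidef.mul_mul_conjTranspose_same (τ • K⁻¹ - (τ - 1) • M⁻¹)
    rwa [conjTranspose_eq_transpose_of_trivial, transpose_sub, transpose_smul, transpose_smul,
      hsM, hsK] at this
  have e1 : (τ • K⁻¹ - (τ - 1) • M⁻¹) * K * (τ • K⁻¹ - (τ - 1) • M⁻¹) =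
      (τ ^ 2) • K⁻¹ - (2 * τ * (τ - 1)) • M⁻¹ + ((τ - 1) ^ 2) • (M⁻¹ * K * M⁻¹) := by
    have a1 : M⁻¹ * K * K⁻¹ = M⁻¹ := by rw [Matrix.mul_assoc, hKu, Matrix.mul_one]
    simp only [sub_mul, mul_sub, Matrix.smul_mul, Matrix.mul_smul, hKu', Matrix.one_mul, a1, smul_smul]
    ext i j
    simp only [Matrix.sub_apply, Matrix.add_apply, Matrix.smul_apply, smul_eq_mul]
    ring
  have e2 : ((τ - 1) / τ) • K = M - (τ - 1) • diagonal d -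
      (g / τ) • ∑ e ∈ R, vecMulVec (u e) (u e) := by
    rw [hMK]; abel
  -- The relation between `M` and `K` eliminates `M⁻¹ K M⁻¹`. What appears is the first order effect
  -- of the drift `(τ - 1) N` and of the averaged rank one matrices.
  have e3 : ((τ - 1) / τ) • (M⁻¹ * K * M⁻¹) = M⁻¹ - (τ - 1) • (M⁻¹ * diagonal d * M⁻¹) -
      (g / τ) • ∑ e ∈ R, vecMulVec (M⁻¹ *ᵥ u e) (M⁻¹ *ᵥ u e) := by
    rw [← Matrix.smul_mul, ← Matrix.mul_smul, e2]
    simp only [mul_sub, sub_mul, hMu', Matrix.one_mul, Matrix.mul_smul, Matrix.smul_mul, Finset.mul_sum,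
      Finset.sum_mul, mul_vecMulVec, vecMulVec_mul, ← mulVec_transpose, hsM]
  -- Only diagonal entries matter, since the potential is a combination of them with positive
  -- weights `d a`.
  have key : ∀ a, (τ - 1) * (M⁻¹ a a + ((τ - 1) * (M⁻¹ * diagonal d * M⁻¹) a a +
      (g / τ) * ∑ e ∈ R, ((M⁻¹ *ᵥ u e) a) ^ 2)) ≤ τ * K⁻¹ a a := by
    intro a
    have h0 := psd.diag_nonneg (i := a)
    have h3 := congrFun (congrFun e3 a) a
    rw [e1] at h0
    simp only [Matrix.sub_apply, Matrix.add_apply, Matrix.smul_apply, smul_eq_mul, Matrix.sum_apply, vecMulVec_apply,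
      ← sq] at h0 h3
    have h4 : (τ - 1) ^ 2 * (M⁻¹ * K * M⁻¹) a a =
      (τ * (τ - 1)) * ((τ - 1) / τ * (M⁻¹ * K * M⁻¹) a a) := by field_simp
    rw [h4, h3] at h0
    have h5 : 0 ≤ τ * (τ * K⁻¹ a a - (τ - 1) * (M⁻¹ a a + ((τ - 1) * (M⁻¹ * diagonal d * M⁻¹) a a +
      (g / τ) * ∑ e ∈ R, ((M⁻¹ *ᵥ u e) a) ^ 2))) := by
      refine h0.trans_eq ?_
      ring
    have := nonneg_of_mul_nonneg_right h5 hτ0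
    linarith
  have : (τ - 1) * (pot d M + ((τ - 1) * ∑ a, d a * (M⁻¹ * diagonal d * M⁻¹) a a +
      (g / τ) * ∑ e ∈ R, ∑ a, d a * ((M⁻¹ *ᵥ u e) a) ^ 2)) =
      ∑ a, d a * ((τ - 1) * (M⁻¹ a a + ((τ - 1) * (M⁻¹ * diagonal d * M⁻¹) a a +
      (g / τ) * ∑ e ∈ R, ((M⁻¹ *ᵥ u e) a) ^ 2))) := by
    rw [Finset.sum_comm, pot]
    simp only [Finset.mul_sum, ← Finset.sum_add_distrib, mul_add]
    refine Finset.sum_congr rfl fun a _ => ?_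
    congr 1
    · ring
    congr 1
    · ring
    exact Finset.sum_congr rfl fun e _ => by ring
  rw [this, pot, Finset.mul_sum]
  refine Finset.sum_le_sum fun a _ => ?_
  have := mul_le_mul_of_nonneg_left (key a) (hd a).le
  linarith

/-- One step of the barrier argument: some rank one matrix can be subtracted without increasing
the potential. -/
theorem exists_barrier_step {E : Type*} {d : ι → ℝ} (hd : ∀ a, 0 < d a) {K M : Matrix ι ι ℝ}
    (hK : K.PosDef) (hM : M.PosDef) {g τ φ : ℝ} (hg : 0 < g) (hτ : 1 < τ) (R : Finset E)
    (hR : (R.card : ℝ) = τ) (u : E → ι → ℝ) (hu : ∀ e ∈ R, u e ≠ 0)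
    (hMK : M = ((τ - 1) / τ) • K + (τ - 1) • diagonal d +
      (g / τ) • ∑ e ∈ R, vecMulVec (u e) (u e))
    (hS : ∀ B : Matrix ι ι ℝ, B.PosSemidef →
      ∑ e ∈ R, u e ⬝ᵥ (B *ᵥ u e) ≤ 2 * ∑ a, d a * B a a)
    (hφ : τ * pot d K ≤ φ) (h1 : 4 * g * φ ≤ τ * (τ - 1))
    (h2 : 8 * g ^ 2 * φ ≤ (τ * (τ - 1)) ^ 2) :
    ∃ e ∈ R, g * (u e ⬝ᵥ (M⁻¹ *ᵥ u e)) < 1 ∧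
      (τ - 1) * pot d (M - g • vecMulVec (u e) (u e)) ≤ τ * pot d K := by
  have hsM : (M⁻¹)ᵀ = M⁻¹ := (posDef_real_iff.1 hM.inv).1
  have hτ0 : 0 < τ := by linarith
  have hτ1 : 0 < τ - 1 := by linarith
  have hRne : R.Nonempty := by
    rw [← Finset.card_pos]; exact_mod_cast hR ▸ hτ0
  have conv := pot_convex hd hK hM hτ R u hMK
  set Q : E → ℝ := fun e => ∑ a, d a * ((M⁻¹ *ᵥ u e) a) ^ 2 with hQ
  set q : E → ℝ := fun e => u e ⬝ᵥ (M⁻¹ *ᵥ u e) with hq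
  set QN := ∑ a, d a * (M⁻¹ * diagonal d * M⁻¹) a a with hQN
  have psdQ : (M⁻¹ * diagonal d * M⁻¹).PosSemidef := by
    have := (PosSemidef.diagonal (d := d) fun a => (hd a).le).mul_mul_conjTranspose_same M⁻¹
    rwa [conjTranspose_eq_transpose_of_trivial, hsM] at this
  have hQpos : ∀ e ∈ R, 0 < Q e := by
    intro e he
    have hne : M⁻¹ *ᵥ u e ≠ 0 := by
      intro h0
      have := (posDef_real_iff.1 hM.inv).2 _ (hu e he)
      rw [h0] at this; simp at this
    obtain ⟨a, ha⟩ := Function.ne_iff.1 hne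
    refine Finset.sum_pos' (fun a _ => by have := hd a; positivity) ⟨a, Finset.mem_univ _, ?_⟩
    have := hd a
    have : (M⁻¹ *ᵥ u e) a ≠ 0 := ha
    positivity
  have sQ : ∑ e ∈ R, Q e ≤ 2 * QN := by
    have := hS _ psdQ
    simpa only [diag_mul_diagonal_mul hsM] using this
  have sq' : ∑ e ∈ R, q e ≤ 2 * pot d M := hS _ hM.inv.posSemidef
  set ρ := (g / τ) * ∑ e ∈ R, Q e with hρ
  have hsumQ : 0 < ∑ e ∈ R, Q e := Finset.sum_pos hQpos hRne
  have hρ0 : 0 < ρ := by positivity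
  have hQN0 : 0 < QN := by linarith
  -- `Y` is the room left by `pot_convex`: the step succeeds as soon as the potential of `M` grows
  -- by at most `Y`.
  set Y := (τ - 1) * QN + ρ with hY
  have hY0 : 0 < Y := by positivity
  have hpot0 : 0 ≤ ∑ e ∈ R, q e :=
    Finset.sum_nonneg fun e _ => (posSemidef_real_iff.1 hM.inv.posSemidef).2 _
  have hpotM : (τ - 1) * pot d M ≤ φ := by nlinarith
  -- `κ` is the average of `g * q e`
  set κ := (g / τ) * ∑ e ∈ R, q e with hκ
  have hκ0 : 0 ≤ κ := by positivity
  have hκτ : κ * (τ * (τ - 1)) ≤ 2 * g * φ := by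
    have : κ * (τ * (τ - 1)) = g * (τ - 1) * ∑ e ∈ R, q e := by rw [hκ]; field_simp
    rw [this]
    nlinarith [mul_le_mul_of_nonneg_left sq' (mul_pos hg hτ1).le]
  have hττ : 0 < τ * (τ - 1) := by positivity
  -- `h1` makes the average of `g * q e` at most one half; `h2` gives the bound after it, which
  -- compares `κ ρ` with the drift term of `Y`.
  have hκ1 : κ ≤ 1 / 2 := by
    by_contra hcon
    push Not at hcon
    nlinarith
  have hκ2 : 4 * g * κ ≤ τ * (τ - 1) := by
    by_contra hcon
    push Not at hcon
    have : (τ * (τ - 1)) ^ 2 < 4 * g * κ * (τ * (τ - 1)) := by nlinarith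
    nlinarith
  have hρτ : ρ * τ ≤ 2 * g * QN := by
    have : ρ * τ = g * ∑ e ∈ R, Q e := by rw [hρ]; field_simp
    rw [this]; nlinarith
  have havg : ρ + Y * κ ≤ Y := by
    have h3 : κ * ρ ≤ (1 - κ) * ((τ - 1) * QN) := by
      have : κ * ρ * τ ≤ (1 - κ) * ((τ - 1) * QN) * τ := by
        calc κ * ρ * τ = κ * (ρ * τ) := by ring
          _ ≤ κ * (2 * g * QN) := mul_le_mul_of_nonneg_left hρτ hκ0
          _ = (4 * g * κ) * QN / 2 := by ring
          _ ≤ (τ * (τ - 1)) * QN / 2 := by gcongr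
          _ = (1 / 2) * (((τ - 1) * QN) * τ) := by ring
          _ ≤ (1 - κ) * (((τ - 1) * QN) * τ) := by
            refine mul_le_mul_of_nonneg_right (by linarith) (by positivity)
          _ = _ := by ring
      exact le_of_mul_le_mul_right this hτ0
    rw [hY]; nlinarith
  -- By `pot_sub_rankOne` the increase is `g Q / (1 - g q)`. The condition that it be at most `Y` is
  -- linear in `Q` and `q` once the denominator is cleared, so it holds for some edge because it
  -- holds on average. It also forces `g q < 1`, as `g Q` and `Y` are positive.
  obtain ⟨e, he, hle⟩ : ∃ e ∈ R, g * Q e + Y * (g * q e) ≤ Y := by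
    refine Finset.exists_le_of_sum_le hRne ?_
    rw [Finset.sum_const, nsmul_eq_mul, hR, Finset.sum_add_distrib, ← Finset.mul_sum,
      ← Finset.mul_sum, ← Finset.mul_sum]
    have : τ * (ρ + Y * κ) = g * ∑ e ∈ R, Q e + Y * (g * ∑ e ∈ R, q e) := by
      rw [hρ, hκ]; field_simp
    rw [← this]
    exact mul_le_mul_of_nonneg_left havg hτ0.le
  have hlt : g * q e < 1 := by
    have := hQpos e he
    have : Y * (g * q e) < Y * 1 := by
      have : 0 < g * Q e := by positivity
      linarith
    exact lt_of_mul_lt_mul_left this hY0.le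
  refine ⟨e, he, hlt, ?_⟩
  rw [pot_sub_rankOne d hM _ hlt]
  refine le_trans ?_ conv
  refine mul_le_mul_of_nonneg_left ?_ hτ1.le
  gcongr
  rw [div_le_iff₀ (by linarith)]
  change g * Q e ≤ Y * (1 - g * q e)
  linarith

end Barrier

end AdditiveSparsifier

/-! ### Greedy selection of edges and its invariant -/

namespace AdditiveSparsifier

open Matrix

/-- A multigraph with edges `0, …, l - 1` on `W` vertices, with the parameters of the greedy
selection of `k` of its edges. -/
structure EdgeSystem where
  W : ℕ
  l : ℕ
  k : ℕ
  h : ℕ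
  X : ℕ → ℕ
  Y : ℕ → ℕ
  X_lt : ∀ e, e < l → X e < W
  Y_lt : ∀ e, e < l → Y e < W
  h_pos : 0 < h
  k_lt : 2 * k < l
  le_k : 512 * W * h ^ 2 ≤ k

/-- The vector `e_x + e_y`. -/
def pairVec (W x y : ℕ) : Fin W → ℤ :=
  fun a => (if x = (a : ℕ) then 1 else 0) + (if y = (a : ℕ) then 1 else 0)

theorem pairVec_nonneg (W x y : ℕ) (a : Fin W) : 0 ≤ pairVec W x y a := by
  unfold pairVec; positivity

theorem pairVec_dotProduct {R : Type*} [CommRing R] {W x y : ℕ} (hx : x < W) (hy : y < W)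
    (v : Fin W → R) :
    (fun a => ((pairVec W x y a : ℤ) : R)) ⬝ᵥ v = v ⟨x, hx⟩ + v ⟨y, hy⟩ := by
  have : ∀ z (hz : z < W), ∑ a : Fin W, (if z = (a : ℕ) then (1 : R) else 0) * v a = v ⟨z, hz⟩ := by
    intro z hz
    rw [Finset.sum_eq_single ⟨z, hz⟩]
    · simp
    · intro b _ hb
      rw [if_neg, zero_mul]
      rintro rfl
      exact hb rfl
    · simp
  simp only [dotProduct, pairVec, Int.cast_add, Int.cast_ite, Int.cast_one, Int.cast_zero, add_mul,
    Finset.sum_add_distrib, this _ hx, this _ hy]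

/-- The real matrix with the entries of an integer matrix. -/
def toReal {ι : Type*} (M : Matrix ι ι ℤ) : Matrix ι ι ℝ := M.map (Int.cast : ℤ → ℝ)

theorem toReal_apply {ι : Type*} (M : Matrix ι ι ℤ) (i j : ι) : toReal M i j = (M i j : ℝ) := rfl

section adj
variable {ι : Type*} [Fintype ι] [DecidableEq ι]

theorem det_toReal (M : Matrix ι ι ℤ) : (toReal M).det = (M.det : ℝ) :=
  (Int.cast_det M).symm

theorem inv_toReal {M : Matrix ι ι ℤ} :
    (toReal M)⁻¹ = ((M.det : ℝ))⁻¹ • toReal M.adjugate := by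
  rw [inv_def, det_toReal, Ring.inverse_eq_inv']
  congr 1
  exact ((Int.castRingHom ℝ).map_adjugate M).symm

theorem toReal_mulVec (M : Matrix ι ι ℤ) (u : ι → ℤ) (a : ι) :
    (toReal M *ᵥ fun a => (u a : ℝ)) a = ((M *ᵥ u) a : ℝ) := by
  simp [mulVec, dotProduct, toReal]

theorem det_pos_of_toReal {M : Matrix ι ι ℤ} (h : (toReal M).PosDef) : 0 < M.det := by
  have := h.det_pos
  rw [det_toReal] at this
  exact_mod_cast this

end adj

namespace EdgeSystem

variable (I : EdgeSystem)

/-- The vector of an edge. -/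
def U (e : ℕ) : Fin I.W → ℤ := pairVec I.W (I.X e) (I.Y e)

/-- The vector of an edge, with real entries. -/
def V (e : ℕ) : Fin I.W → ℝ := fun a => (I.U e a : ℝ)

/-- One plus the degree. -/
def d (a : Fin I.W) : ℤ := 1 + ∑ e ∈ Finset.range I.l, I.U e a

/-- One plus the degree, as a real number. -/
def D (a : Fin I.W) : ℝ := (I.d a : ℝ)

/-- The barrier matrix at time `s`, where `T` is the set of selected edges. -/
def B (s : ℕ) (T : Finset ℕ) : Matrix (Fin I.W) (Fin I.W) ℤ :=
  (((I.l : ℤ) - s) * (I.k + s)) • diagonal I.d -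
    (2 * I.h * I.l ^ 2 : ℤ) • ∑ e ∈ T, vecMulVec (I.U e) (I.U e) +
    (2 * I.h * I.l * s : ℤ) • ∑ e ∈ Finset.range I.l, vecMulVec (I.U e) (I.U e)

/-- The gain constant. -/
def g : ℤ := 2 * I.h * I.l ^ 2

theorem l_pos : 0 < I.l := by have := I.k_lt; omega
theorem W_pos : 0 < I.W := lt_of_le_of_lt (Nat.zero_le _) (I.X_lt 0 I.l_pos)
theorem k_pos : 0 < I.k := by
  have := I.le_k
  have := I.W_pos
  have := I.h_pos
  have : 0 < 512 * I.W * I.h ^ 2 := by positivity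
  omega

theorem d_pos (a : Fin I.W) : 0 < I.d a := by
  have : 0 ≤ ∑ e ∈ Finset.range I.l, I.U e a :=
    Finset.sum_nonneg fun e _ => pairVec_nonneg _ _ _ _
  unfold d; omega

theorem D_pos (a : Fin I.W) : 0 < I.D a := Int.cast_pos.2 (I.d_pos a)

theorem g_pos : 0 < I.g := by
  have := I.l_pos; have := I.h_pos; unfold g; positivity

theorem V_dotProduct {e : ℕ} (he : e < I.l) (v : Fin I.W → ℝ) :
    I.V e ⬝ᵥ v = v ⟨I.X e, I.X_lt e he⟩ + v ⟨I.Y e, I.Y_lt e he⟩ :=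
  pairVec_dotProduct _ _ v

theorem V_ne_zero {e : ℕ} (he : e < I.l) : I.V e ≠ 0 := by
  intro h
  have h1 := I.V_dotProduct he (fun _ => 1)
  rw [h, zero_dotProduct] at h1
  norm_num at h1

theorem toReal_B (s : ℕ) (T : Finset ℕ) : toReal (I.B s T) =
    (((I.l : ℝ) - s) * (I.k + s)) • diagonal I.D -
    (I.g : ℝ) • ∑ e ∈ T, vecMulVec (I.V e) (I.V e) +
    (2 * I.h * I.l * s : ℝ) • ∑ e ∈ Finset.range I.l, vecMulVec (I.V e) (I.V e) := by
  ext i j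
  rcases eq_or_ne i j with rfl | hij
  · simp only [toReal_apply, B, Matrix.add_apply, Matrix.sub_apply, Matrix.smul_apply, smul_eq_mul,
      Matrix.sum_apply, vecMulVec_apply, diagonal_apply_eq, V, D, g]
    push_cast
    rfl
  · simp only [toReal_apply, B, Matrix.add_apply, Matrix.sub_apply, Matrix.smul_apply, smul_eq_mul,
      Matrix.sum_apply, vecMulVec_apply, diagonal_apply_ne _ hij, V, g]
    push_cast
    rfl

/-- Testing `A` on `e_x - e_y` gives `2 A x y ≤ A x x + A y y`, so the form at an edge vector is at
most twice the sum of the diagonal entries at its ends. Summed over edges, each diagonal entry is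
counted at most as often as the degree. This is why the potential is weighted by degrees. -/
theorem sum_quad_le {R : Finset ℕ} (hR : R ⊆ Finset.range I.l) {A : Matrix (Fin I.W) (Fin I.W) ℝ}
    (hA : A.PosSemidef) :
    ∑ e ∈ R, I.V e ⬝ᵥ (A *ᵥ I.V e) ≤ 2 * ∑ a, I.D a * A a a := by
  obtain ⟨hs, hp⟩ := posSemidef_real_iff.1 hA
  have h1 : ∀ e ∈ R, I.V e ⬝ᵥ (A *ᵥ I.V e) ≤ 2 * ∑ a, I.V e a * A a a := by
    intro e he
    have hl := Finset.mem_range.1 (hR he)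
    set x : Fin I.W := ⟨I.X e, I.X_lt e hl⟩
    set y : Fin I.W := ⟨I.Y e, I.Y_lt e hl⟩
    have e0 : ∑ a, I.V e a * A a a = A x x + A y y := I.V_dotProduct hl fun a => A a a
    have e1 : ∀ z, (A *ᵥ I.V e) z = A z x + A z y := by
      intro z; rw [mulVec, dotProduct_comm, I.V_dotProduct hl]
    have e3 := hp (Pi.single x 1 - Pi.single y 1)
    simp only [mulVec_sub, sub_dotProduct, dotProduct_sub, single_dotProduct, mulVec_single_one,
      one_mul, Matrix.col_apply] at e3
    rw [I.V_dotProduct hl, e0, e1, e1]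
    linarith
  refine (Finset.sum_le_sum h1).trans ?_
  rw [← Finset.mul_sum, Finset.sum_comm]
  refine mul_le_mul_of_nonneg_left (Finset.sum_le_sum fun a _ => ?_) zero_le_two
  rw [← Finset.sum_mul]
  refine mul_le_mul_of_nonneg_right ?_ (hA.diag_nonneg)
  have : ∑ e ∈ R, I.V e a ≤ ∑ e ∈ Finset.range I.l, I.V e a :=
    Finset.sum_le_sum_of_subset_of_nonneg hR fun e _ _ => by
      exact Int.cast_nonneg (pairVec_nonneg I.W (I.X e) (I.Y e) a)
  refine this.trans ?_
  simp only [D, d, V]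
  push_cast
  linarith

/-- The invariant of the greedy selection. -/
def Inv (t : ℕ) (T : Finset ℕ) : Prop :=
  T ⊆ Finset.range I.l ∧ T.card = t ∧ (toReal (I.B t T)).PosDef ∧
    ((I.l : ℝ) - t) * pot I.D (toReal (I.B t T)) ≤ I.W / I.k

/-- The initial matrix is `l k N`, of potential `W / (l k)`; this is the source of the constant `W /
k` in the invariant. -/
theorem inv_zero : I.Inv 0 ∅ := by
  have hl : (0 : ℝ) < I.l := by exact_mod_cast I.l_pos
  have hk : (0 : ℝ) < I.k := by exact_mod_cast I.k_pos
  have e : toReal (I.B 0 ∅) = diagonal fun a => (I.l * I.k * I.D a : ℝ) := by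
    rw [toReal_B]
    simp [← diagonal_smul]
  have hpos : ∀ a, 0 < (I.l * I.k * I.D a : ℝ) := fun a => by
    have := I.D_pos a
    positivity
  refine ⟨by simp, rfl, ?_, ?_⟩
  · rw [e]; exact PosDef.diagonal hpos
  · have hinv : (toReal (I.B 0 ∅))⁻¹ = diagonal fun a => (I.l * I.k * I.D a : ℝ)⁻¹ := by
      rw [e]
      apply inv_eq_right_inv
      rw [diagonal_mul_diagonal, ← diagonal_one]
      congr 1
      ext a
      exact mul_inv_cancel₀ (hpos a).ne'
    rw [pot, hinv]
    have : ∀ a, I.D a * (diagonal fun a => (I.l * I.k * I.D a : ℝ)⁻¹) a a = 1 / (I.l * I.k) := by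
      intro a
      have := I.D_pos a
      rw [diagonal_apply_eq]
      field_simp
    simp only [this]
    rw [Finset.sum_const]
    simp only [Finset.card_univ, Fintype.card_fin, nsmul_eq_mul]
    refine le_of_eq ?_
    field_simp
    simp

/-- The scaled numerator of the increase of the potential when edge `e` is selected. -/
def num (M : Matrix (Fin I.W) (Fin I.W) ℤ) (e : ℕ) : ℤ :=
  ∑ a, I.d a * ((M.adjugate *ᵥ I.U e) a) ^ 2

/-- The scaled denominator of the increase of the potential when edge `e` is selected. -/
def den (M : Matrix (Fin I.W) (Fin I.W) ℤ) (e : ℕ) : ℤ :=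
  M.det - I.g * (I.U e ⬝ᵥ (M.adjugate *ᵥ I.U e))

/-- Since the inverse is the adjugate over the determinant, `num / den` is `det` times the quotient
`Q / (1 - g q)` of the barrier step. The factor is the same for all edges, so comparing increases is
an exact integer test. -/
theorem num_eq {M : Matrix (Fin I.W) (Fin I.W) ℤ} (hM : 0 < M.det) (e : ℕ) :
    (I.num M e : ℝ) = (M.det : ℝ) ^ 2 * ∑ a, I.D a * (((toReal M)⁻¹ *ᵥ I.V e) a) ^ 2 := by
  have h0 : (0 : ℝ) < M.det := by exact_mod_cast hM
  have : ∀ a, ((toReal M)⁻¹ *ᵥ I.V e) a = (M.det : ℝ)⁻¹ * ((M.adjugate *ᵥ I.U e) a : ℝ) := by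
    intro a
    rw [inv_toReal, smul_mulVec, Pi.smul_apply, smul_eq_mul]
    congr 1
    exact toReal_mulVec _ _ a
  simp only [this, num, Finset.mul_sum, D]
  rw [Int.cast_sum]
  refine Finset.sum_congr rfl fun a _ => ?_
  rw [Int.cast_mul, Int.cast_pow]
  field_simp

theorem den_eq {M : Matrix (Fin I.W) (Fin I.W) ℤ} (hM : 0 < M.det) (e : ℕ) :
    (I.den M e : ℝ) = (M.det : ℝ) * (1 - I.g * (I.V e ⬝ᵥ ((toReal M)⁻¹ *ᵥ I.V e))) := by
  have h0 : (0 : ℝ) < M.det := by exact_mod_cast hM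
  have : ∀ a, ((toReal M)⁻¹ *ᵥ I.V e) a = (M.det : ℝ)⁻¹ * ((M.adjugate *ᵥ I.U e) a : ℝ) := by
    intro a
    rw [inv_toReal, smul_mulVec, Pi.smul_apply, smul_eq_mul]
    congr 1
    exact toReal_mulVec _ _ a
  have h2 : I.V e ⬝ᵥ ((toReal M)⁻¹ *ᵥ I.V e) =
      (M.det : ℝ)⁻¹ * ((I.U e ⬝ᵥ (M.adjugate *ᵥ I.U e) : ℤ) : ℝ) := by
    simp only [dotProduct, this]
    push_cast
    rw [Finset.mul_sum]
    exact Finset.sum_congr rfl fun a _ => by rw [V]; ring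
  rw [h2, den, Int.cast_sub, Int.cast_mul]
  field_simp

section step

variable {I} {t : ℕ} {T : Finset ℕ}

/-- The form that `exists_barrier_step` asks for, with `τ = l - t` unselected edges. The weight `(l
- s) (k + s)` is chosen so that passing from `s` to `s + 1` beyond the factor `(τ - 1) / τ` adds
exactly `(τ - 1) N`, and the term with all edges supplies the average over the unselected ones. -/
theorem Inv.B_succ_eq (hI : I.Inv t T) (ht : t < I.k) :
    toReal (I.B (t + 1) T) = ((((I.l : ℝ) - t) - 1) / (I.l - t)) • toReal (I.B t T) +
      ((I.l - t : ℝ) - 1) • diagonal I.D +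
      ((I.g : ℝ) / (I.l - t)) • ∑ e ∈ Finset.range I.l \ T, vecMulVec (I.V e) (I.V e) := by
  have hge : (I.g : ℝ) = 2 * I.h * I.l ^ 2 := by simp [g]
  have e1 : ∑ e ∈ Finset.range I.l \ T, vecMulVec (I.V e) (I.V e) =
      ∑ e ∈ Finset.range I.l, vecMulVec (I.V e) (I.V e) - ∑ e ∈ T, vecMulVec (I.V e) (I.V e) := by
    rw [← Finset.sum_sdiff hI.1]; abel
  have htl : (t : ℝ) + 1 ≤ I.l := by
    have := I.k_lt
    have : t + 1 ≤ I.l := by omega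
    exact_mod_cast this
  have hne : (I.l : ℝ) - t ≠ 0 := by linarith
  rw [e1, toReal_B, toReal_B, hge]
  push_cast
  ext i j
  simp only [Matrix.add_apply, Matrix.sub_apply, Matrix.smul_apply, smul_eq_mul]
  field_simp
  ring

theorem Inv.posDef_succ (hI : I.Inv t T) (ht : t < I.k) : (toReal (I.B (t + 1) T)).PosDef := by
  have htl : (t : ℝ) + 1 < I.l := by
    have := I.k_lt
    have : t + 1 < I.l := by omega
    exact_mod_cast this
  have hg : (0 : ℝ) < I.g := by exact_mod_cast I.g_pos
  have h1 : 0 < (I.l : ℝ) - t := by linarith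
  have h2 : 0 < ((I.l : ℝ) - t) - 1 := by linarith
  rw [hI.B_succ_eq ht]
  refine ((hI.2.2.1.smul (by positivity)).add ?_).add_posSemidef ?_
  · exact (PosDef.diagonal I.D_pos).smul h2
  · refine PosSemidef.smul (posSemidef_sum _ fun e _ => ?_) (by positivity)
    have := posSemidef_vecMulVec_self_star (I.V e)
    simpa using this

theorem B_insert (s : ℕ) {e : ℕ} (he : e ∉ T) : toReal (I.B s (insert e T)) =
    toReal (I.B s T) - (I.g : ℝ) • vecMulVec (I.V e) (I.V e) := by
  rw [toReal_B, toReal_B, Finset.sum_insert he]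
  module

/-- From `t < k` and `2k < l` one gets `τ (τ - 1) ≥ l² / 4`. With `g = 2 h l²` and `φ = W / k` the
two smallness conditions of the barrier step become `32 W h ≤ k` and `512 W h² ≤ k`, whence the
constant `512` in `le_k`. -/
theorem Inv.exists_good (hI : I.Inv t T) (ht : t < I.k) :
    ∃ e ∈ Finset.range I.l \ T, I.g * (I.V e ⬝ᵥ ((toReal (I.B (t + 1) T))⁻¹ *ᵥ I.V e)) < 1 ∧
      ((I.l : ℝ) - t - 1) * pot I.D (toReal (I.B (t + 1) T) - (I.g : ℝ) • vecMulVec (I.V e) (I.V e)) ≤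
        (I.l - t) * pot I.D (toReal (I.B t T)) := by
  have hl : (0 : ℝ) < I.l := by exact_mod_cast I.l_pos
  have hk : (2 : ℝ) * I.k + 1 ≤ I.l := by exact_mod_cast I.k_lt
  have hk0 : (0 : ℝ) < I.k := by exact_mod_cast I.k_pos
  have htk : (t : ℝ) + 1 ≤ I.k := by exact_mod_cast ht
  have ht0 : (0 : ℝ) ≤ t := by positivity
  have hh : (1 : ℝ) ≤ I.h := by exact_mod_cast I.h_pos
  have hW : (1 : ℝ) ≤ I.W := by exact_mod_cast I.W_pos
  have hle : 512 * (I.W : ℝ) * I.h ^ 2 ≤ I.k := by exact_mod_cast I.le_k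
  have hg : (0 : ℝ) < I.g := by exact_mod_cast I.g_pos
  have hge : (I.g : ℝ) = 2 * I.h * I.l ^ 2 := by simp [g]
  have hτ : (I.l : ℝ) ^ 2 / 4 ≤ ((I.l : ℝ) - t) * ((I.l : ℝ) - t - 1) := by nlinarith
  refine exists_barrier_step I.D_pos hI.2.2.1 (hI.posDef_succ ht) hg (τ := (I.l : ℝ) - t)
    (φ := I.W / I.k) (by linarith) (Finset.range I.l \ T) ?_ I.V ?_ ?_ ?_ hI.2.2.2 ?_ ?_
  · rw [Finset.card_sdiff_of_subset hI.1, Finset.card_range, hI.2.1, Nat.cast_sub]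
    have := I.k_lt; omega
  · intro e he
    exact I.V_ne_zero (Finset.mem_range.1 (Finset.mem_sdiff.1 he).1)
  · exact hI.B_succ_eq ht
  · intro A hA
    exact I.sum_quad_le Finset.sdiff_subset hA
  · rw [hge]
    refine le_trans ?_ hτ
    rw [mul_div_assoc', div_le_iff₀ hk0]
    have : 32 * (I.W : ℝ) * I.h ≤ I.k := by nlinarith [mul_pos (show (0 : ℝ) < I.W by linarith) (show (0 : ℝ) < I.h by linarith)]
    nlinarith [mul_le_mul_of_nonneg_right this (sq_nonneg (I.l : ℝ))]
  · have h4 : ((I.l : ℝ) ^ 2 / 4) ^ 2 ≤ (((I.l : ℝ) - t) * ((I.l : ℝ) - t - 1)) ^ 2 := by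
      gcongr
    refine le_trans ?_ h4
    rw [hge, mul_div_assoc', div_le_iff₀ hk0]
    have := mul_le_mul_of_nonneg_right hle (by positivity : (0 : ℝ) ≤ (I.l : ℝ) ^ 4)
    nlinarith

/-- Selecting an edge of minimal increase preserves the invariant. -/
theorem Inv.step (hI : I.Inv t T) (ht : t < I.k) {e : ℕ} (he : e < I.l) (heT : e ∉ T)
    (hden : 0 < I.den (I.B (t + 1) T) e)
    (hmin : ∀ f, f < I.l → f ∉ T → 0 < I.den (I.B (t + 1) T) f →
      I.num (I.B (t + 1) T) e * I.den (I.B (t + 1) T) f ≤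
        I.num (I.B (t + 1) T) f * I.den (I.B (t + 1) T) e) :
    I.Inv (t + 1) (insert e T) := by
  have hM := hI.posDef_succ ht
  have hdet := det_pos_of_toReal hM
  have hdet' : (0 : ℝ) < (I.B (t + 1) T).det := by exact_mod_cast hdet
  have hg : (0 : ℝ) < I.g := by exact_mod_cast I.g_pos
  have hlt : ∀ f, 0 < I.den (I.B (t + 1) T) f →
      I.g * (I.V f ⬝ᵥ ((toReal (I.B (t + 1) T))⁻¹ *ᵥ I.V f)) < 1 := by
    intro f hf
    have h1 : (0 : ℝ) < I.den (I.B (t + 1) T) f := by exact_mod_cast hf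
    rw [I.den_eq hdet] at h1
    have := pos_of_mul_pos_right h1 hdet'.le
    linarith
  refine ⟨?_, ?_, ?_, ?_⟩
  · exact Finset.insert_subset (Finset.mem_range.2 he) hI.1
  · rw [Finset.card_insert_of_notMem heT, hI.2.1]
  · rw [B_insert _ heT]
    exact PosDef.sub_rankOne hM hg _ (hlt e hden)
  -- The edge `f` from the averaging argument is one of the competitors, so the minimal edge `e`
  -- increases the potential no more than `f` does.
  · obtain ⟨f, hf, hf1, hf2⟩ := hI.exists_good ht
    obtain ⟨hfl, hfT⟩ := Finset.mem_sdiff.1 hf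
    have hfden : 0 < I.den (I.B (t + 1) T) f := by
      have : (0 : ℝ) < I.den (I.B (t + 1) T) f := by
        rw [I.den_eq hdet]
        exact mul_pos hdet' (by linarith)
      exact_mod_cast this
    have hcmp := hmin f (Finset.mem_range.1 hfl) hfT hfden
    have hcmp' : (I.num (I.B (t + 1) T) e * I.den (I.B (t + 1) T) f : ℝ) ≤
        I.num (I.B (t + 1) T) f * I.den (I.B (t + 1) T) e := by exact_mod_cast hcmp
    rw [B_insert _ heT]
    refine le_trans ?_ (hf2.trans hI.2.2.2)
    push_cast
    rw [← sub_sub]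
    have htl : (t : ℝ) + 1 ≤ I.l := by
      have := I.k_lt
      have : t + 1 ≤ I.l := by omega
      exact_mod_cast this
    refine mul_le_mul_of_nonneg_left ?_ (by linarith)
    rw [pot_sub_rankOne _ hM _ (hlt e hden), pot_sub_rankOne _ hM _ (hlt f hfden)]
    gcongr pot I.D (toReal (I.B (t + 1) T)) + ?_
    rw [I.num_eq hdet, I.num_eq hdet, I.den_eq hdet, I.den_eq hdet] at hcmp'
    have h1 := hlt e hden
    have h2 := hlt f hfden
    rw [div_le_div_iff₀ (by linarith) (by linarith)]
    -- Each cross product of a numerator and a denominator carries the common factor `det ^ 3`.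
    have h3 : (0 : ℝ) < (I.B (t + 1) T).det ^ 3 := by positivity
    refine le_of_mul_le_mul_left ?_ h3
    have := mul_le_mul_of_nonneg_left hcmp' hg.le
    linarith

/-- Ensures that the search for a minimal edge has a candidate in every round. -/
theorem Inv.exists_den_pos (hI : I.Inv t T) (ht : t < I.k) :
    ∃ f, f < I.l ∧ f ∉ T ∧ 0 < I.den (I.B (t + 1) T) f := by
  have hM := hI.posDef_succ ht
  have hdet := det_pos_of_toReal hM
  have hdet' : (0 : ℝ) < (I.B (t + 1) T).det := by exact_mod_cast hdet
  obtain ⟨f, hf, hf1, -⟩ := hI.exists_good ht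
  obtain ⟨hfl, hfT⟩ := Finset.mem_sdiff.1 hf
  refine ⟨f, Finset.mem_range.1 hfl, hfT, ?_⟩
  have : (0 : ℝ) < I.den (I.B (t + 1) T) f := by
    rw [I.den_eq hdet]
    exact mul_pos hdet' (by linarith)
  exact_mod_cast this

/-- The one-sided spectral bound for the selected edges. -/
theorem Inv.quad_le (hI : I.Inv I.k T) (z : Fin I.W → ℝ) :
    (I.l / I.k : ℝ) * ∑ e ∈ T, (I.V e ⬝ᵥ z) ^ 2 ≤
      ∑ e ∈ Finset.range I.l, (I.V e ⬝ᵥ z) ^ 2 + (1 / I.h : ℝ) * ∑ a, I.D a * z a ^ 2 := by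
  have hl : (0 : ℝ) < I.l := by exact_mod_cast I.l_pos
  have hk0 : (0 : ℝ) < I.k := by exact_mod_cast I.k_pos
  have hh : (0 : ℝ) < I.h := by exact_mod_cast I.h_pos
  have h1 := (posSemidef_real_iff.1 hI.2.2.1.posSemidef).2 z
  rw [toReal_B, add_mulVec, sub_mulVec, smul_mulVec, smul_mulVec, smul_mulVec, dotProduct_add,
    dotProduct_sub, dotProduct_smul, dotProduct_smul, dotProduct_smul, sum_mulVec, sum_mulVec,
    dotProduct_sum, dotProduct_sum] at h1
  simp only [dotProduct_vecMulVec_self, smul_eq_mul, g] at h1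
  have h2 : z ⬝ᵥ (diagonal I.D *ᵥ z) = ∑ a, I.D a * z a ^ 2 := by
    rw [dotProduct]
    refine Finset.sum_congr rfl fun a _ => ?_
    rw [mulVec_diagonal]; ring
  rw [h2] at h1
  have h3 : 0 ≤ ∑ a, I.D a * z a ^ 2 :=
    Finset.sum_nonneg fun a _ => mul_nonneg (I.D_pos a).le (sq_nonneg _)
  push_cast at h1
  set SA := ∑ e ∈ T, (I.V e ⬝ᵥ z) ^ 2
  set SS := ∑ e ∈ Finset.range I.l, (I.V e ⬝ᵥ z) ^ 2
  set SN := ∑ a, I.D a * z a ^ 2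
  -- At time `k` the weight of `N` is `2k (l - k)`. Dropping its negative part `-2k²` and dividing
  -- by `2 h l k` turns positivity of the barrier matrix into the bound with error `N / h`.
  have h4 : 0 ≤ 2 * I.h * I.l * I.k * (SS + (1 / I.h : ℝ) * SN - (I.l / I.k : ℝ) * SA) := by
    have : 2 * I.h * I.l * I.k * (SS + (1 / I.h : ℝ) * SN - (I.l / I.k : ℝ) * SA) =
        2 * I.h * I.l * I.k * SS + 2 * I.l * I.k * SN - 2 * I.h * I.l ^ 2 * SA := by
      field_simp
    rw [this]
    nlinarith [mul_nonneg (mul_nonneg hk0.le hk0.le) h3]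
  have := nonneg_of_mul_nonneg_right h4 (by positivity)
  linarith

end step

end EdgeSystem

end AdditiveSparsifier

/-! ### Edge lists and quadratic forms of graphs -/

namespace AdditiveSparsifier

open Matrix

variable {n : ℕ}

open Classical in
/-- The sum of `f i j` over all ordered pairs of adjacent vertices. -/
noncomputable def adjSum {R : Type*} [AddCommMonoid R] (H : SimpleGraph (Fin n))
    (f : Fin n → Fin n → R) : R :=
  ∑ i, ∑ j, if H.Adj i j then f i j else 0

/-- `X` and `Y` list the edges `{i, j}`, `i < j`, of `G`, as pairs `(i, n + j)`, without
repetition. -/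
structure IsEdgeList (G : SimpleGraph (Fin n)) (l : ℕ) (X Y : ℕ → ℕ) : Prop where
  edge : ∀ e < l, ∃ i j : Fin n, i < j ∧ G.Adj i j ∧ X e = i ∧ Y e = n + j
  inj : ∀ e < l, ∀ f < l, X e = X f → Y e = Y f → e = f
  surj : ∀ i j : Fin n, i < j → G.Adj i j → ∃ e < l, X e = i ∧ Y e = n + j

open Classical in
/-- The pairs `(i, j)` with `i < j` listed at the positions in `T`. -/
noncomputable def listedPairs (n : ℕ) (X Y : ℕ → ℕ) (T : Finset ℕ) : Finset (Fin n × Fin n) :=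
  Finset.univ.filter fun p => ∃ e ∈ T, X e = p.1 ∧ Y e = n + p.2

/-- The edges listed at the positions in `T`. -/
noncomputable def listedEdges (n : ℕ) (X Y : ℕ → ℕ) (T : Finset ℕ) : Finset (Sym2 (Fin n)) :=
  (listedPairs n X Y T).image fun p => s(p.1, p.2)

theorem mem_listedPairs {X Y : ℕ → ℕ} {T : Finset ℕ} {p : Fin n × Fin n} :
    p ∈ listedPairs n X Y T ↔ ∃ e ∈ T, X e = p.1 ∧ Y e = n + p.2 := by
  simp [listedPairs]

namespace IsEdgeList

variable {G : SimpleGraph (Fin n)} {l : ℕ} {X Y : ℕ → ℕ} (hE : IsEdgeList G l X Y)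
  {T : Finset ℕ} (hT : T ⊆ Finset.range l)
include hE hT

theorem lt_of_mem {p : Fin n × Fin n} (hp : p ∈ listedPairs n X Y T) :
    p.1 < p.2 ∧ G.Adj p.1 p.2 := by
  obtain ⟨e, he, h1, h2⟩ := mem_listedPairs.1 hp
  obtain ⟨i, j, hij, hG, h3, h4⟩ := hE.edge e (Finset.mem_range.1 (hT he))
  have : i = p.1 := Fin.ext (by omega)
  have : j = p.2 := Fin.ext (by omega)
  subst_vars
  exact ⟨hij, hG⟩

theorem sum_listedPairs {R : Type*} [AddCommMonoid R] (f : Fin n × Fin n → R) (f' : ℕ → R)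
    (hf : ∀ e ∈ T, ∀ i j : Fin n, X e = i → Y e = n + j → f' e = f (i, j)) :
    ∑ e ∈ T, f' e = ∑ p ∈ listedPairs n X Y T, f p := by
  have hex : ∀ e ∈ T, ∃ p : Fin n × Fin n, X e = p.1 ∧ Y e = n + p.2 := by
    intro e he
    obtain ⟨i, j, -, -, h3, h4⟩ := hE.edge e (Finset.mem_range.1 (hT he))
    exact ⟨(i, j), h3, h4⟩
  choose P hP using hex
  refine Finset.sum_bij P ?_ ?_ ?_ ?_
  · intro e he
    exact mem_listedPairs.2 ⟨e, he, hP e he⟩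
  · intro e he f hf' h
    have h1 := hP e he
    have h2 := hP f hf'
    rw [h] at h1
    exact hE.inj e (Finset.mem_range.1 (hT he)) f (Finset.mem_range.1 (hT hf')) (by omega) (by omega)
  · intro p hp
    obtain ⟨e, he, h1, h2⟩ := mem_listedPairs.1 hp
    refine ⟨e, he, ?_⟩
    have := hP e he
    exact Prod.ext (Fin.ext (by omega)) (Fin.ext (by omega))
  · intro e he
    exact hf e he _ _ (hP e he).1 (hP e he).2

theorem card_listedEdges : (listedEdges n X Y T).card = T.card := by
  rw [listedEdges, Finset.card_image_of_injOn]
  · have := hE.sum_listedPairs hT (fun _ => 1) (fun _ => 1) (fun _ _ _ _ _ _ => rfl)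
    simpa using this.symm
  · intro p hp q hq h
    have h1 := (hE.lt_of_mem hT hp).1
    have h2 := (hE.lt_of_mem hT hq).1
    rcases Sym2.eq_iff.1 h with h | h
    · exact Prod.ext h.1 h.2
    · rw [h.1, h.2] at h1
      exact absurd h1 (lt_asymm h2)

theorem mem_listedEdges {i j : Fin n} :
    s(i, j) ∈ listedEdges n X Y T ↔ (i, j) ∈ listedPairs n X Y T ∨ (j, i) ∈ listedPairs n X Y T := by
  constructor
  · intro h
    obtain ⟨p, hp, h⟩ := Finset.mem_image.1 h
    rcases Sym2.eq_iff.1 h with ⟨h1, h2⟩ | ⟨h1, h2⟩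
    · left; rw [← h1, ← h2]; exact hp
    · right; rw [← h1, ← h2]; exact hp
  · rintro (h | h)
    · exact Finset.mem_image.2 ⟨_, h, rfl⟩
    · exact Finset.mem_image.2 ⟨_, h, Sym2.eq_swap⟩

theorem listedEdges_subset : (listedEdges n X Y T : Set (Sym2 (Fin n))) ⊆ G.edgeSet := by
  intro z hz
  obtain ⟨p, hp, rfl⟩ := Finset.mem_image.1 (Finset.mem_coe.1 hz)
  exact (hE.lt_of_mem hT hp).2

theorem adj_listed {i j : Fin n} :
    (SimpleGraph.fromEdgeSet (listedEdges n X Y T : Set (Sym2 (Fin n)))).Adj i j ↔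
      (i, j) ∈ listedPairs n X Y T ∨ (j, i) ∈ listedPairs n X Y T := by
  rw [SimpleGraph.fromEdgeSet_adj, Finset.mem_coe, hE.mem_listedEdges hT, and_iff_left_iff_imp]
  rintro (h | h)
  · exact (hE.lt_of_mem hT h).1.ne
  · exact (hE.lt_of_mem hT h).1.ne'

/-- `adjSum` runs over ordered pairs while a list position stands for one unordered edge, so each
position collects both orders. -/
theorem sum_adj {R : Type*} [AddCommMonoid R] (f : Fin n → Fin n → R) (f' : ℕ → R)
    (hf : ∀ e ∈ T, ∀ i j : Fin n, X e = i → Y e = n + j → f' e = f i j + f j i) :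
    adjSum (SimpleGraph.fromEdgeSet (listedEdges n X Y T : Set (Sym2 (Fin n)))) f =
      ∑ e ∈ T, f' e := by
  classical
  rw [adjSum, hE.sum_listedPairs hT (fun p => f p.1 p.2 + f p.2 p.1) f' hf, Finset.sum_add_distrib]
  have h1 : ∀ i j, (@ite _ ((SimpleGraph.fromEdgeSet
      (listedEdges n X Y T : Set (Sym2 (Fin n)))).Adj i j) (Classical.propDecidable _) (f i j) 0) =
      (if (i, j) ∈ listedPairs n X Y T then f i j else 0) +
        (if (j, i) ∈ listedPairs n X Y T then f i j else 0) := by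
    intro i j
    by_cases h1 : (i, j) ∈ listedPairs n X Y T
    · have h2 : (j, i) ∉ listedPairs n X Y T := fun h2 =>
        lt_asymm (hE.lt_of_mem hT h1).1 (hE.lt_of_mem hT h2).1
      rw [if_pos ((hE.adj_listed hT).2 (Or.inl h1)), if_pos h1, if_neg h2, add_zero]
    · by_cases h2 : (j, i) ∈ listedPairs n X Y T
      · rw [if_pos ((hE.adj_listed hT).2 (Or.inr h2)), if_neg h1, if_pos h2, zero_add]
      · rw [if_neg (fun h => ((hE.adj_listed hT).1 h).elim h1 h2), if_neg h1, if_neg h2, add_zero]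
  simp only [h1, Finset.sum_add_distrib]
  congr 1
  · rw [← Fintype.sum_prod_type' (fun i j => if (i, j) ∈ listedPairs n X Y T then f i j else 0)]
    simp
  · rw [Finset.sum_comm,
      ← Fintype.sum_prod_type' (fun j i => if (j, i) ∈ listedPairs n X Y T then f i j else 0)]
    simp

omit hT in
theorem listedEdges_range : (listedEdges n X Y (Finset.range l) : Set (Sym2 (Fin n))) = G.edgeSet := by
  refine Set.Subset.antisymm (hE.listedEdges_subset subset_rfl) fun z => ?_
  induction z with
  | _ i j =>
    intro h
    rw [Finset.mem_coe, hE.mem_listedEdges subset_rfl]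
    have hG : G.Adj i j := h
    rcases lt_or_gt_of_ne hG.ne with hij | hij
    · obtain ⟨e, he, h1⟩ := hE.surj i j hij hG
      exact Or.inl (mem_listedPairs.2 ⟨e, Finset.mem_range.2 he, h1⟩)
    · obtain ⟨e, he, h1⟩ := hE.surj j i hij hG.symm
      exact Or.inr (mem_listedPairs.2 ⟨e, Finset.mem_range.2 he, h1⟩)

omit hT in
theorem ncard_edgeSet : G.edgeSet.ncard = l := by
  rw [← hE.listedEdges_range, Set.ncard_coe_finset, hE.card_listedEdges subset_rfl,
    Finset.card_range]

omit hT in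
theorem fromEdgeSet_listedEdges_range :
    SimpleGraph.fromEdgeSet (listedEdges n X Y (Finset.range l) : Set (Sym2 (Fin n))) = G := by
  rw [hE.listedEdges_range, SimpleGraph.fromEdgeSet_edgeSet]

end IsEdgeList

theorem quad_degM (H : SimpleGraph (Fin n)) (x : Fin n → ℝ) :
    x ⬝ᵥ (degM H *ᵥ x) = adjSum H fun i _ => x i ^ 2 := by
  classical
  rw [degM, adjSum, SimpleGraph.dotProduct_mulVec_degMatrix]
  refine Finset.sum_congr rfl fun i _ => ?_
  rw [SimpleGraph.degree_eq_sum_if_adj, Finset.sum_mul, Finset.sum_mul]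
  refine Finset.sum_congr rfl fun j _ => ?_
  split_ifs <;> ring

theorem quad_lapM (H : SimpleGraph (Fin n)) (x : Fin n → ℝ) :
    x ⬝ᵥ (lapM H *ᵥ x) = adjSum H fun i j => x i ^ 2 - x i * x j := by
  classical
  have h1 := quad_degM H x
  rw [degM, adjSum] at h1
  rw [adjSum]
  rw [lapM, SimpleGraph.lapMatrix, sub_mulVec, dotProduct_sub, h1, dotProduct,
    ← Finset.sum_sub_distrib]
  refine Finset.sum_congr rfl fun i _ => ?_
  rw [mulVec, dotProduct, Finset.mul_sum, ← Finset.sum_sub_distrib]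
  refine Finset.sum_congr rfl fun j _ => ?_
  rw [SimpleGraph.adjMatrix_apply]
  split_ifs <;> ring

theorem transpose_degM (H : SimpleGraph (Fin n)) : (degM H)ᵀ = degM H := by
  classical
  exact SimpleGraph.isSymm_degMatrix ℝ H

theorem transpose_lapM (H : SimpleGraph (Fin n)) : (lapM H)ᵀ = lapM H := by
  classical
  exact SimpleGraph.isSymm_lapMatrix ℝ H

theorem quad_one (x : Fin n → ℝ) : x ⬝ᵥ ((1 : Matrix (Fin n) (Fin n) ℝ) *ᵥ x) = ∑ i, x i ^ 2 := by
  simp [dotProduct, sq]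

theorem loewner_of_quad {A B : Matrix (Fin n) (Fin n) ℝ} (hA : Aᵀ = A) (hB : Bᵀ = B)
    (h : ∀ x, x ⬝ᵥ (A *ᵥ x) ≤ x ⬝ᵥ (B *ᵥ x)) : Loewner A B := by
  refine posSemidef_real_iff.2 ⟨by rw [transpose_sub, hA, hB], fun x => ?_⟩
  rw [sub_mulVec, dotProduct_sub]
  linarith [h x]

theorem quad_deg_nonneg (H : SimpleGraph (Fin n)) (x : Fin n → ℝ) : 0 ≤ x ⬝ᵥ (degM H *ᵥ x) := by
  classical
  rw [quad_degM, adjSum]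
  refine Finset.sum_nonneg fun i _ => Finset.sum_nonneg fun j _ => ?_
  split_ifs <;> positivity

theorem avgDegree_nonneg (G : SimpleGraph (Fin n)) : 0 ≤ avgDegree G := by
  unfold avgDegree; positivity

/-- The one-sided bounds for the Laplacian and the signless Laplacian imply the spectral bounds. -/
theorem spectralBounds_of_quad {G : SimpleGraph (Fin n)} {ε : ℝ} {F : Finset (Sym2 (Fin n))}
    (h : ∀ x : Fin n → ℝ,
      ((G.edgeSet.ncard : ℝ) / F.card) *
        (x ⬝ᵥ (lapM (SimpleGraph.fromEdgeSet (F : Set (Sym2 (Fin n)))) *ᵥ x)) ≤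
      x ⬝ᵥ (lapM G *ᵥ x) + ε * (x ⬝ᵥ (degM G *ᵥ x)) + ε * avgDegree G * ∑ i, x i ^ 2)
    (h' : ∀ x : Fin n → ℝ,
      ((G.edgeSet.ncard : ℝ) / F.card) *
        (2 * (x ⬝ᵥ (degM (SimpleGraph.fromEdgeSet (F : Set (Sym2 (Fin n)))) *ᵥ x)) -
          x ⬝ᵥ (lapM (SimpleGraph.fromEdgeSet (F : Set (Sym2 (Fin n)))) *ᵥ x)) ≤
      2 * (x ⬝ᵥ (degM G *ᵥ x)) - x ⬝ᵥ (lapM G *ᵥ x) + ε * (x ⬝ᵥ (degM G *ᵥ x)) +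
        ε * avgDegree G * ∑ i, x i ^ 2) :
    SpectralBounds G ε F := by
  refine ⟨loewner_of_quad ?_ ?_ fun x => ?_, loewner_of_quad ?_ ?_ fun x => ?_⟩
  · simp [transpose_degM]
  · simp [transpose_lapM]
  · have := h' x
    simp only [sub_mulVec, smul_mulVec, dotProduct_sub, dotProduct_smul, smul_eq_mul, quad_one]
    linarith
  · simp [transpose_lapM]
  · simp [transpose_degM]
  · have := h x
    simp only [sub_mulVec, add_mulVec, smul_mulVec, dotProduct_sub, dotProduct_add, dotProduct_smul,
      smul_eq_mul, quad_one]
    linarith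

/-- Serves the case in which all edges are kept: then `c = 1` and the differences vanish. With no
edges `c` is `0 / 0 = 0`, which is harmless because all forms are zero. -/
theorem spectralBounds_all {G : SimpleGraph (Fin n)} {ε : ℝ} (hε : 0 ≤ ε)
    {F : Finset (Sym2 (Fin n))} (hF : (F : Set (Sym2 (Fin n))) = G.edgeSet) :
    SpectralBounds G ε F := by
  classical
  have hc : G.edgeSet.ncard = F.card := by rw [← hF, Set.ncard_coe_finset]
  have hG : SimpleGraph.fromEdgeSet (F : Set (Sym2 (Fin n))) = G := by
    rw [hF, SimpleGraph.fromEdgeSet_edgeSet]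
  have hquad : ∀ x : Fin n → ℝ, ((G.edgeSet.ncard : ℝ) / F.card) * (x ⬝ᵥ (lapM G *ᵥ x)) =
      x ⬝ᵥ (lapM G *ᵥ x) ∧ ((G.edgeSet.ncard : ℝ) / F.card) * (x ⬝ᵥ (degM G *ᵥ x)) =
      x ⬝ᵥ (degM G *ᵥ x) := by
    intro x
    rcases F.eq_empty_or_nonempty with h0 | h0
    · have : G = ⊥ := by
        rw [← SimpleGraph.edgeSet_eq_empty, ← hF, h0, Finset.coe_empty]
      have h1 : ∀ i j, ¬ G.Adj i j := fun i j h => by rw [this] at h; exact h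
      rw [quad_lapM, quad_degM]
      have h2 : ∀ f : Fin n → Fin n → ℝ, adjSum G f = 0 := fun f =>
        Finset.sum_eq_zero fun i _ => Finset.sum_eq_zero fun j _ => if_neg (h1 i j)
      rw [h2, h2, mul_zero]
      exact ⟨rfl, rfl⟩
    · have : (F.card : ℝ) ≠ 0 := Nat.cast_ne_zero.2 (Finset.card_pos.2 h0).ne'
      rw [hc, div_self this, one_mul, one_mul]
      exact ⟨rfl, rfl⟩
  have hnn : ∀ x : Fin n → ℝ, 0 ≤ ε * (x ⬝ᵥ (degM G *ᵥ x)) + ε * avgDegree G * ∑ i, x i ^ 2 := by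
    intro x
    have := quad_deg_nonneg G x
    have := avgDegree_nonneg G
    have : 0 ≤ ∑ i, x i ^ 2 := Finset.sum_nonneg fun i _ => sq_nonneg _
    positivity
  refine spectralBounds_of_quad (fun x => ?_) (fun x => ?_)
  · rw [hG, (hquad x).1]
    linarith [hnn x]
  · rw [hG, mul_sub, mul_left_comm, (hquad x).1, (hquad x).2]
    linarith [hnn x]

/-! ### Transfer from the double cover to the graph -/

namespace EdgeSystem

variable {I : EdgeSystem} {G : SimpleGraph (Fin n)}

/-- The vector on the bipartite double cover with values `x` and `s * x`. -/
def dbl (I : EdgeSystem) (s : ℝ) (x : Fin n → ℝ) (a : Fin I.W) : ℝ :=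
  if h : (a : ℕ) < n then x ⟨a, h⟩ else if h : (a : ℕ) - n < n then s * x ⟨a - n, h⟩ else 0

/-- The function `φ` allows the same computation for the values themselves and for their squares. -/
theorem V_dbl (s : ℝ) (x : Fin n → ℝ) {e : ℕ}
    (he : e < I.l) (φ : ℝ → ℝ) {i j : Fin n} (hi : I.X e = i) (hj : I.Y e = n + j) :
    (I.V e ⬝ᵥ fun a => φ (dbl I s x a)) = φ (x i) + φ (s * x j) := by
  rw [I.V_dotProduct he]
  congr 2
  · simp [dbl, hi]
  · simp [dbl, hj]

theorem sum_dbl_sq (hW : I.W = 2 * n) {s : ℝ} (hs : s ^ 2 = 1) (x : Fin n → ℝ) :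
    ∑ a, dbl I s x a ^ 2 = 2 * ∑ i, x i ^ 2 := by
  have h1 : ∑ a, dbl I s x a ^ 2 = ∑ a ∈ Finset.range I.W,
      (if h : a < n then x ⟨a, h⟩ else if h : a - n < n then s * x ⟨a - n, h⟩ else 0) ^ 2 :=
    Fin.sum_univ_eq_sum_range
      (fun a => (if h : a < n then x ⟨a, h⟩ else if h : a - n < n then s * x ⟨a - n, h⟩ else 0) ^ 2) _
  rw [h1, hW, two_mul, Finset.sum_range_add, two_mul]
  congr 1
  · rw [← Fin.sum_univ_eq_sum_range]
    exact Finset.sum_congr rfl fun i _ => by simp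
  · rw [← Fin.sum_univ_eq_sum_range
      (fun a => (if h : n + a < n then x ⟨n + a, h⟩ else
        if h : n + a - n < n then s * x ⟨n + a - n, h⟩ else 0) ^ 2)]
    refine Finset.sum_congr rfl fun i _ => ?_
    simp [mul_pow, hs]

/-- Separates the two error terms: the constant one in `D` leads to the multiple of the identity,
the degrees lead to `D_G`. -/
theorem sum_D_mul (z : Fin I.W → ℝ) :
    ∑ a, I.D a * z a = ∑ a, z a + ∑ e ∈ Finset.range I.l, I.V e ⬝ᵥ z := by
  simp only [dotProduct]
  rw [Finset.sum_comm, ← Finset.sum_add_distrib]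
  refine Finset.sum_congr rfl fun a _ => ?_
  rw [← Finset.sum_mul, D, d, Int.cast_add, Int.cast_sum]
  simp only [V]
  push_cast
  ring

/-- The selected edges form a sparsifier. -/
theorem Inv.spectralBounds {T : Finset ℕ} (hI : I.Inv I.k T) (hE : IsEdgeList G I.l I.X I.Y)
    (hW : I.W = 2 * n) {ε : ℝ} (hε : 1 / (I.h : ℝ) ≤ ε) :
    SpectralBounds G ε (listedEdges n I.X I.Y T) := by
  classical
  have hn : 0 < n := by have := I.W_pos; omega
  have hn' : (0 : ℝ) < n := by exact_mod_cast hn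
  have hh : (0 : ℝ) < 1 / I.h := by
    have : (0 : ℝ) < I.h := by exact_mod_cast I.h_pos
    positivity
  -- The constant one in `D` costs `∑ x i ^ 2` on each of the two copies of the vertex set. This is
  -- absorbed by `d ∑ x i ^ 2`, because `l > 2k` and the lower bound on `k` force `l ≥ n`, that is
  -- `d ≥ 2`.
  have hd : 2 ≤ avgDegree G := by
    rw [avgDegree, hE.ncard_edgeSet, Fintype.card_fin, le_div_iff₀ hn']
    have : n ≤ I.l := by
      have h1 := I.le_k
      have h2 := I.k_lt
      have h3 : 1 ≤ I.h ^ 2 := Nat.one_le_pow _ _ I.h_pos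
      rw [hW] at h1
      nlinarith
    have : (n : ℝ) ≤ I.l := by exact_mod_cast this
    linarith
  -- The sign `s = -1` gives the Laplacian and `s = 1` the signless Laplacian.
  have key : ∀ s : ℝ, s ^ 2 = 1 → ∀ x : Fin n → ℝ,
      (I.l / I.k : ℝ) * (adjSum (SimpleGraph.fromEdgeSet
        (listedEdges n I.X I.Y T : Set (Sym2 (Fin n)))) fun i j => x i ^ 2 + s * (x i * x j)) ≤
      (adjSum G fun i j => x i ^ 2 + s * (x i * x j)) +
        ε * (x ⬝ᵥ (degM G *ᵥ x)) + ε * avgDegree G * ∑ i, x i ^ 2 := by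
    intro s hs x
    have hsum : ∀ T' ⊆ Finset.range I.l, (adjSum (SimpleGraph.fromEdgeSet
        (listedEdges n I.X I.Y T' : Set (Sym2 (Fin n)))) fun i j => x i ^ 2 + s * (x i * x j)) =
        ∑ e ∈ T', (I.V e ⬝ᵥ dbl I s x) ^ 2 := by
      intro T' hT'
      refine hE.sum_adj hT' _ _ fun e he i j hi hj => ?_
      have := V_dbl s x (Finset.mem_range.1 (hT' he)) id hi hj
      simp only [id] at this
      rw [this]
      linear_combination x j ^ 2 * hs
    have hdeg : x ⬝ᵥ (degM G *ᵥ x) = ∑ e ∈ Finset.range I.l, I.V e ⬝ᵥ fun a => dbl I s x a ^ 2 := by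
      rw [quad_degM]
      have := hE.sum_adj (subset_refl _) (fun i _ => x i ^ 2)
        (fun e => I.V e ⬝ᵥ fun a => dbl I s x a ^ 2) (fun e he i j hi hj => by
          rw [V_dbl s x (Finset.mem_range.1 he) (fun y => y ^ 2) hi hj]
          linear_combination x j ^ 2 * hs)
      rw [← this, hE.fromEdgeSet_listedEdges_range]
    have hq := hI.quad_le (dbl I s x)
    rw [← hsum T hI.1, ← hsum _ subset_rfl, hE.fromEdgeSet_listedEdges_range, sum_D_mul, ← hdeg,
      sum_dbl_sq hW hs] at hq
    have h0 := quad_deg_nonneg G x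
    have hε0 : 0 ≤ ε := hh.le.trans hε
    have h1 : 0 ≤ ∑ i, x i ^ 2 := Finset.sum_nonneg fun i _ => sq_nonneg _
    have h2 : (1 / I.h : ℝ) * (2 * ∑ i, x i ^ 2 + x ⬝ᵥ (degM G *ᵥ x)) ≤
        ε * (avgDegree G * ∑ i, x i ^ 2 + x ⬝ᵥ (degM G *ᵥ x)) := by
      gcongr
    linarith
  have hcard : (listedEdges n I.X I.Y T).card = I.k := by
    rw [hE.card_listedEdges hI.1, hI.2.1]
  refine spectralBounds_of_quad (fun x => ?_) (fun x => ?_)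
  · have h1 := key (-1) (by norm_num) x
    rw [hE.ncard_edgeSet, hcard, quad_lapM, quad_lapM]
    simpa only [neg_one_mul, ← sub_eq_add_neg] using h1
  · have h1 := key 1 (by norm_num) x
    have h2 : ∀ H : SimpleGraph (Fin n), 2 * (x ⬝ᵥ (degM H *ᵥ x)) - x ⬝ᵥ (lapM H *ᵥ x) =
        adjSum H fun i j => x i ^ 2 + 1 * (x i * x j) := by
      intro H
      rw [quad_degM, quad_lapM, adjSum, adjSum, adjSum, Finset.mul_sum, ← Finset.sum_sub_distrib]
      refine Finset.sum_congr rfl fun i _ => ?_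
      rw [Finset.mul_sum, ← Finset.sum_sub_distrib]
      refine Finset.sum_congr rfl fun j _ => ?_
      split_ifs <;> ring
    rw [hE.ncard_edgeSet, hcard, h2, h2]
    exact h1

end EdgeSystem

end AdditiveSparsifier

/-! ### Rank one updates of determinants and adjugates over the integers -/

namespace AdditiveSparsifier

open Matrix

section rankOne

variable {ι : Type*} [Fintype ι] [DecidableEq ι]

/-- The matrix determinant lemma, for integer matrices. -/
theorem det_add_rankOne {M : Matrix ι ι ℤ} (hM : M.det ≠ 0) (β : ℤ) (u : ι → ℤ) :
    (M + β • vecMulVec u u).det = M.det + β * (u ⬝ᵥ (M.adjugate *ᵥ u)) := by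
  have hM' : ((M.det : ℤ) : ℝ) ≠ 0 := by exact_mod_cast hM
  have h1 := det_add_replicateCol_mul_replicateRow (ι := Unit) (A := toReal M)
    (by rw [det_toReal]; exact isUnit_iff_ne_zero.2 hM') (fun a => (β * u a : ℝ)) (fun a => (u a : ℝ))
  have h2 : toReal M + replicateCol Unit (fun a => (β * u a : ℝ)) *
      replicateRow Unit (fun a => (u a : ℝ)) = toReal (M + β • vecMulVec u u) := by
    ext i j
    simp only [toReal_apply, Matrix.add_apply, Matrix.mul_apply, Matrix.smul_apply, smul_eq_mul,
      vecMulVec_apply, replicateCol_apply, replicateRow_apply, Finset.univ_unique,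
      Finset.sum_singleton]
    push_cast
    ring
  rw [h2, det_toReal, det_toReal, det_unique (n := Unit), inv_toReal] at h1
  have h3 : (replicateRow Unit (fun a => (u a : ℝ)) * ((M.det : ℝ)⁻¹ • toReal M.adjugate) *
      replicateCol Unit (fun a => (β * u a : ℝ))) default default =
      (M.det : ℝ)⁻¹ * β * ((u ⬝ᵥ (M.adjugate *ᵥ u) : ℤ) : ℝ) := by
    rw [Matrix.mul_assoc, Matrix.mul_apply]
    simp only [Matrix.mul_apply, replicateRow_apply, replicateCol_apply, Matrix.smul_apply,
      smul_eq_mul, toReal_apply, dotProduct, mulVec]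
    push_cast
    rw [Finset.mul_sum]
    refine Finset.sum_congr rfl fun i _ => ?_
    rw [Finset.mul_sum, Finset.mul_sum, Finset.mul_sum]
    exact Finset.sum_congr rfl fun j _ => by ring
  rw [Matrix.add_apply, h3, one_apply_eq] at h1
  have h4 : ((M + β • vecMulVec u u).det : ℝ) =
      ((M.det + β * (u ⬝ᵥ (M.adjugate *ᵥ u)) : ℤ) : ℝ) := by
    rw [h1, Int.cast_add, Int.cast_mul]
    generalize ((u ⬝ᵥ (M.adjugate *ᵥ u) : ℤ) : ℝ) = z at *
    generalize ((M.det : ℤ) : ℝ) = D at *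
    field_simp
  exact Int.cast_injective h4

/-- The Sherman-Morrison formula for the adjugate of a symmetric integer matrix. -/
theorem adjugate_add_rankOne {M : Matrix ι ι ℤ} (hs : Mᵀ = M) (hM : M.det ≠ 0) (β : ℤ) (u : ι → ℤ)
    (hM' : (M + β • vecMulVec u u).det ≠ 0) :
    M.det • (M + β • vecMulVec u u).adjugate = (M + β • vecMulVec u u).det • M.adjugate -
      β • vecMulVec (M.adjugate *ᵥ u) (M.adjugate *ᵥ u) := by
  set M' := M + β • vecMulVec u u with hM'def
  have hdet := det_add_rankOne hM β u
  have hadj : (M.adjugate)ᵀ = M.adjugate := by rw [adjugate_transpose, hs]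
  -- Right multiplication by `M'` can be cancelled since its determinant is nonzero; after it both
  -- sides equal `det M * det M'` times the identity.
  have hcancel : ∀ A B : Matrix ι ι ℤ, A * M' = B * M' → A = B := by
    intro A B h
    have h1 := congrArg (· * M'.adjugate) h
    simp only [Matrix.mul_assoc, mul_adjugate, Matrix.mul_smul, Matrix.mul_one] at h1
    exact smul_right_injective _ hM' h1
  apply hcancel
  rw [Matrix.smul_mul, adjugate_mul, Matrix.sub_mul, Matrix.smul_mul]
  rw [← hM'def] at hdet
  have e1 : M.adjugate * M' = M.det • 1 + β • vecMulVec (M.adjugate *ᵥ u) u := by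
    rw [hM'def, Matrix.mul_add, adjugate_mul, Matrix.mul_smul, mul_vecMulVec]
  have e2 : (M.adjugate *ᵥ u) ᵥ* M' =
      M.det • u + (β * (u ⬝ᵥ (M.adjugate *ᵥ u))) • u := by
    rw [hM'def, vecMul_add, vecMul_smul, vecMul_vecMulVec, ← mulVec_transpose, hs, mulVec_mulVec,
      mul_adjugate, smul_mulVec, one_mulVec, smul_smul, dotProduct_comm]
  have e3 : vecMulVec (M.adjugate *ᵥ u) (M.adjugate *ᵥ u) * M' =
      M'.det • vecMulVec (M.adjugate *ᵥ u) u := by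
    rw [vecMulVec_mul, e2, ← add_smul, ← hdet, vecMulVec_smul]
  rw [e1, Matrix.smul_mul, e3]
  ext i j
  simp only [Matrix.smul_apply, Matrix.sub_apply, Matrix.add_apply, smul_eq_mul]
  ring

theorem abs_det_le {M : Matrix ι ι ℤ} {x : ℤ} (h : ∀ i j, |M i j| ≤ x) :
    |M.det| ≤ (Fintype.card ι).factorial * x ^ Fintype.card ι := by
  have := det_le (abv := AbsoluteValue.abs) (A := M) (x := x) h
  simpa using this

/-- An entry of the adjugate is the determinant of the matrix with one row replaced by a unit
vector; the entries stay bounded by `x` because `1 ≤ x`. -/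
theorem abs_adjugate_le {M : Matrix ι ι ℤ} {x : ℤ} (hx : 1 ≤ x) (h : ∀ i j, |M i j| ≤ x) (i j : ι) :
    |M.adjugate i j| ≤ (Fintype.card ι).factorial * x ^ Fintype.card ι := by
  rw [adjugate_apply]
  refine abs_det_le fun a b => ?_
  rw [updateRow_apply]
  split_ifs
  · rw [Pi.single_apply]
    split_ifs
    · simpa using hx
    · simp; omega
  · exact h a b

end rankOne

/-! ### The barrier matrix as a chain of updates of the identity -/

namespace EdgeSystem

variable (I : EdgeSystem)

/-- One plus the degree, on natural numbers. -/
def dN (a : ℕ) : ℤ :=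
  1 + ∑ e ∈ Finset.range I.l, ((if I.X e = a then 1 else 0) + (if I.Y e = a then 1 else 0))

theorem d_eq (a : Fin I.W) : I.d a = I.dN a := rfl

/-- First index of the vector of the `s`-th rank one update. -/
def ix (s : ℕ) : ℕ :=
  if s < I.W then s else if s < I.W + I.l then I.X (s - I.W) else I.X (s - I.W - I.l)

/-- Second index of the vector of the `s`-th rank one update. -/
def iy (s : ℕ) : ℕ :=
  if s < I.W then s else if s < I.W + I.l then I.Y (s - I.W) else I.Y (s - I.W - I.l)

/-- Coefficient of the second index in the vector of the `s`-th rank one update. -/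
def ig (s : ℕ) : ℤ := if s < I.W then 0 else 1

/-- Coefficient of the `s`-th rank one update. -/
def ib (t : ℕ) (T : Finset ℕ) (s : ℕ) : ℤ :=
  if s < I.W then ((I.l : ℤ) - t - 1) * (I.k + t + 1) * I.dN s - 1
  else if s < I.W + I.l then 2 * I.h * I.l * (t + 1)
  else -(2 * I.h * I.l * I.l) * (if s - I.W - I.l ∈ T then 1 else 0)

/-- Vector of the `s`-th rank one update. -/
def iv (s : ℕ) : Fin I.W → ℤ :=
  fun a => (if I.ix s = a then 1 else 0) + I.ig s * (if I.iy s = a then 1 else 0)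

/-- The matrix after `s` rank one updates of the identity. -/
def part (t : ℕ) (T : Finset ℕ) (s : ℕ) : Matrix (Fin I.W) (Fin I.W) ℤ :=
  1 + ∑ r ∈ Finset.range s, I.ib t T r • vecMulVec (I.iv r) (I.iv r)

theorem part_zero (t : ℕ) (T : Finset ℕ) : I.part t T 0 = 1 := by simp [part]

theorem part_succ (t : ℕ) (T : Finset ℕ) (s : ℕ) :
    I.part t T (s + 1) = I.part t T s + I.ib t T s • vecMulVec (I.iv s) (I.iv s) := by
  rw [part, Finset.sum_range_succ, ← add_assoc]; rfl

theorem transpose_part (t : ℕ) (T : Finset ℕ) (s : ℕ) : (I.part t T s)ᵀ = I.part t T s := by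
  simp only [part, transpose_add, transpose_one, transpose_sum, transpose_smul,
    transpose_vecMulVec_self]

/-- The first `W` updates change the identity into the multiple of `N` (hence the `- 1` in `ib`),
the next `l` add all edges, and the last `l` remove the selected ones, unselected edges having
coefficient zero. -/
theorem part_end (t : ℕ) {T : Finset ℕ} (hT : T ⊆ Finset.range I.l) :
    I.part t T (I.W + I.l + I.l) = I.B (t + 1) T := by
  rw [part, Finset.sum_range_add, Finset.sum_range_add]
  have h1 : ∑ s ∈ Finset.range I.W, I.ib t T s • vecMulVec (I.iv s) (I.iv s) =
      diagonal fun a => ((I.l : ℤ) - t - 1) * (I.k + t + 1) * I.d a - 1 := by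
    ext i j
    rw [Matrix.sum_apply, Finset.sum_eq_single (i : ℕ)]
    · simp only [Matrix.smul_apply, vecMulVec_apply, iv, ix, iy, ig, ib, if_pos i.2, d_eq,
        diagonal_apply, smul_eq_mul, Fin.ext_iff]
      split_ifs <;> simp
    · intro b hb hbi
      have hb' := Finset.mem_range.1 hb
      simp [vecMulVec_apply, iv, ix, iy, ig, if_pos hb', hbi]
    · intro h
      exact absurd (Finset.mem_range.2 i.2) h
  have h2 : ∑ s ∈ Finset.range I.l, I.ib t T (I.W + s) • vecMulVec (I.iv (I.W + s)) (I.iv (I.W + s)) =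
      (2 * I.h * I.l * ((t + 1 : ℕ) : ℤ) : ℤ) •
        ∑ e ∈ Finset.range I.l, vecMulVec (I.U e) (I.U e) := by
    rw [Finset.smul_sum]
    refine Finset.sum_congr rfl fun s hs => ?_
    have hs' := Finset.mem_range.1 hs
    have : I.iv (I.W + s) = I.U s := by
      ext a; simp [iv, ix, iy, ig, U, pairVec, hs']
    rw [this]
    simp [ib, hs']
  have h3 : ∑ s ∈ Finset.range I.l, I.ib t T (I.W + I.l + s) •
      vecMulVec (I.iv (I.W + I.l + s)) (I.iv (I.W + I.l + s)) =
      -((2 * I.h * I.l ^ 2 : ℤ) • ∑ e ∈ T, vecMulVec (I.U e) (I.U e)) := by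
    have hT' : ∑ e ∈ T, vecMulVec (I.U e) (I.U e) =
        ∑ e ∈ Finset.range I.l, if e ∈ T then vecMulVec (I.U e) (I.U e) else 0 := by
      rw [← Finset.sum_filter, Finset.filter_mem_eq_inter, Finset.inter_eq_right.2 hT]
    rw [hT', Finset.smul_sum, ← Finset.sum_neg_distrib]
    refine Finset.sum_congr rfl fun s _ => ?_
    have e1 : ¬ I.W + I.l + s < I.W := by omega
    have e2 : ¬ I.W + I.l + s < I.W + I.l := by omega
    have e3 : I.W + I.l + s - I.W - I.l = s := by omega
    have : I.iv (I.W + I.l + s) = I.U s := by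
      ext a
      simp only [iv, ix, iy, ig, U, pairVec, if_neg e1, if_neg e2, e3, one_mul]
    rw [this]
    simp only [ib, if_neg e1, if_neg e2, e3]
    split_ifs
    · rw [mul_one, neg_smul]; congr 2; ring
    · simp
  rw [h1, h2, h3, B]
  ext i j
  rcases eq_or_ne i j with rfl | hij
  · simp only [Matrix.add_apply, Matrix.sub_apply, Matrix.neg_apply, Matrix.smul_apply, one_apply_eq,
      diagonal_apply_eq, smul_eq_mul]
    push_cast
    ring
  · simp only [Matrix.add_apply, Matrix.sub_apply, Matrix.neg_apply, Matrix.smul_apply,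
      one_apply_ne hij, diagonal_apply_ne _ hij, smul_eq_mul]
    push_cast
    ring

variable {I} {t : ℕ} {T : Finset ℕ}

theorem one_le_dN (a : ℕ) : 1 ≤ I.dN a := by
  have : 0 ≤ ∑ e ∈ Finset.range I.l, ((if I.X e = a then (1 : ℤ) else 0) +
      (if I.Y e = a then 1 else 0)) := Finset.sum_nonneg fun e _ => by positivity
  unfold dN; omega

theorem dN_le (a : ℕ) : I.dN a ≤ 3 * I.l := by
  have : ∑ e ∈ Finset.range I.l, ((if I.X e = a then (1 : ℤ) else 0) +
      (if I.Y e = a then 1 else 0)) ≤ ∑ e ∈ Finset.range I.l, 2 :=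
    Finset.sum_le_sum fun e _ => by split_ifs <;> norm_num
  rw [Finset.sum_const, Finset.card_range, nsmul_eq_mul] at this
  have := I.l_pos
  unfold dN; omega

theorem ib_nonneg (ht : t < I.k) {s : ℕ} (hs : s < I.W + I.l) : 0 ≤ I.ib t T s := by
  unfold ib
  split_ifs
  · have h1 : (1 : ℤ) ≤ (I.l : ℤ) - t - 1 := by have := I.k_lt; omega
    have h2 : (1 : ℤ) ≤ (I.k : ℤ) + t + 1 := by omega
    have h3 := I.one_le_dN s
    have h4 : (1 : ℤ) ≤ ((I.l : ℤ) - t - 1) * (I.k + t + 1) := one_le_mul_of_one_le_of_one_le h1 h2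
    have := one_le_mul_of_one_le_of_one_le h4 h3
    omega
  · positivity

theorem ib_nonpos {s : ℕ} (hs : I.W + I.l ≤ s) : I.ib t T s ≤ 0 := by
  unfold ib
  rw [if_neg (by omega), if_neg (by omega), neg_mul]
  exact neg_nonpos.2 (by positivity)

theorem toReal_part_succ (s : ℕ) : toReal (I.part t T (s + 1)) = toReal (I.part t T s) +
    (I.ib t T s : ℝ) • vecMulVec (fun a => (I.iv s a : ℝ)) (fun a => (I.iv s a : ℝ)) := by
  rw [part_succ]
  ext i j
  simp only [toReal_apply, Matrix.add_apply, Matrix.smul_apply, smul_eq_mul, vecMulVec_apply]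
  push_cast
  rfl

theorem posSemidef_vecMulVec_real {ι : Type*} [Fintype ι] (u : ι → ℝ) :
    (vecMulVec u u).PosSemidef := by
  have := posSemidef_vecMulVec_self_star u
  simpa using this

/-- The order of the updates matters. As long as the coefficients are nonnegative, positivity
propagates upwards from the identity. Once they are nonpositive, each matrix dominates the final
one, which is positive definite by the invariant, so positivity propagates backwards. -/
theorem Inv.posDef_part (hI : I.Inv t T) (ht : t < I.k) {s : ℕ} (hs : s ≤ I.W + I.l + I.l) :
    (toReal (I.part t T s)).PosDef := by
  rcases le_total s (I.W + I.l) with h | h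
  · induction s with
    | zero =>
      rw [part_zero]
      have : toReal (1 : Matrix (Fin I.W) (Fin I.W) ℤ) = 1 := by
        ext i j
        rw [toReal_apply, one_apply, one_apply]
        split_ifs <;> simp
      rw [this]
      exact PosDef.one
    | succ s ih =>
      rw [toReal_part_succ]
      refine (ih (by omega) (by omega)).add_posSemidef ((posSemidef_vecMulVec_real _).smul ?_)
      exact_mod_cast ib_nonneg ht (by omega)
  · induction hs using Nat.decreasingInduction with
    | self =>
      rw [I.part_end t hI.1]
      exact hI.posDef_succ ht
    | of_succ s hs ih =>
      have h1 : toReal (I.part t T s) = toReal (I.part t T (s + 1)) + (-(I.ib t T s : ℝ)) •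
          vecMulVec (fun a => (I.iv s a : ℝ)) (fun a => (I.iv s a : ℝ)) := by
        rw [toReal_part_succ, neg_smul, add_neg_cancel_right]
      rw [h1]
      refine (ih (by omega)).add_posSemidef ((posSemidef_vecMulVec_real _).smul ?_)
      have := I.ib_nonpos (t := t) (T := T) h
      have : (I.ib t T s : ℝ) ≤ 0 := by exact_mod_cast this
      linarith

/-- A bound for the determinants and the adjugates of the matrices that are met. -/
def cap (I : EdgeSystem) : ℤ := (73 * (I.l : ℤ) ^ 5) ^ I.l

theorem W_le (I : EdgeSystem) : I.W ≤ I.k := by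
  have h1 := I.le_k
  have h3 : 1 ≤ I.h ^ 2 := Nat.one_le_pow _ _ I.h_pos
  nlinarith

theorem h_le (I : EdgeSystem) : I.h ≤ I.k := by
  have h1 := I.le_k
  have h3 := I.W_pos
  have h4 := I.h_pos
  nlinarith [Nat.mul_le_mul h3 (Nat.le_refl (I.h ^ 2))]

theorem abs_ib_le (ht : t < I.k) (s : ℕ) : |I.ib t T s| ≤ 6 * (I.l : ℤ) ^ 3 := by
  have hk := I.k_lt
  have hh := I.h_le
  have hl := I.l_pos
  have hh' : (I.h : ℤ) ≤ I.l := by omega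
  have ht' : (t : ℤ) + 1 ≤ I.l := by omega
  have hl' : (1 : ℤ) ≤ I.l := by omega
  have hnn : 0 ≤ (I.l : ℤ) ^ 3 := by positivity
  unfold ib
  split_ifs with h1 h2
  · have := ib_nonneg (T := T) ht (s := s) (by omega : s < I.W + I.l)
    rw [ib, if_pos h1] at this
    rw [abs_of_nonneg this]
    have h2 : ((I.l : ℤ) - t - 1) * (I.k + t + 1) * I.dN s ≤ I.l * (2 * I.l) * (3 * I.l) := by
      have := I.dN_le s
      have := I.one_le_dN s
      gcongr <;> omega
    nlinarith
  · rw [abs_of_nonneg (by positivity)]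
    have : (2 * I.h * I.l * (t + 1) : ℤ) ≤ 2 * I.l * I.l * I.l := by gcongr
    nlinarith
  · rw [mul_one, abs_neg, abs_of_nonneg (by positivity)]
    have : (2 * I.h * I.l * I.l : ℤ) ≤ 2 * I.l * I.l * I.l := by gcongr
    nlinarith
  · simp only [mul_zero, abs_zero]; positivity

/-- There are at most `3 l` updates, with coefficients at most `6 l³` and vector entries at most
`2`; thus `1 + 72 l⁴ ≤ 73 l⁴`. -/
theorem abs_part_le (ht : t < I.k) {s : ℕ} (hs : s ≤ I.W + I.l + I.l) (i j : Fin I.W) :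
    |I.part t T s i j| ≤ 73 * (I.l : ℤ) ^ 4 := by
  have hiv : ∀ r a, |I.iv r a| ≤ 2 := by
    intro r a
    unfold iv ig
    split_ifs <;> norm_num
  have hl := I.l_pos
  have hl' : (1 : ℤ) ≤ I.l := by omega
  have hW := I.W_le
  have hk := I.k_lt
  rw [part, Matrix.add_apply, Matrix.sum_apply]
  have h1 : |(1 : Matrix (Fin I.W) (Fin I.W) ℤ) i j| ≤ 1 := by
    rw [one_apply]; split_ifs <;> simp
  have h2 : |∑ r ∈ Finset.range s, (I.ib t T r • vecMulVec (I.iv r) (I.iv r)) i j| ≤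
      ∑ r ∈ Finset.range s, (6 * (I.l : ℤ) ^ 3) * (2 * 2) := by
    refine (Finset.abs_sum_le_sum_abs _ _).trans (Finset.sum_le_sum fun r _ => ?_)
    rw [Matrix.smul_apply, vecMulVec_apply, smul_eq_mul, abs_mul, abs_mul]
    have a1 := abs_ib_le (T := T) ht r
    have a2 := hiv r i
    have a3 := hiv r j
    gcongr
  rw [Finset.sum_const, Finset.card_range, nsmul_eq_mul] at h2
  have h3 : (s : ℤ) * (6 * (I.l : ℤ) ^ 3 * (2 * 2)) ≤ (3 * I.l) * (6 * (I.l : ℤ) ^ 3 * (2 * 2)) := by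
    gcongr
    omega
  have h4 : (1 : ℤ) ≤ (I.l : ℤ) ^ 4 := one_le_pow₀ hl'
  refine (abs_add_le _ _).trans ?_
  nlinarith

/-- The factorial is at most `l ^ W`, which raises the exponent of `l` in the base from `4` to `5`;
then `W ≤ l` allows the exponent `l`. -/
theorem factorial_mul_le : ((Fintype.card (Fin I.W)).factorial : ℤ) *
    (73 * (I.l : ℤ) ^ 4) ^ Fintype.card (Fin I.W) ≤ I.cap := by
  have hW := I.W_le
  have hk := I.k_lt
  have hl := I.l_pos
  have hl' : (1 : ℤ) ≤ I.l := by omega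
  rw [Fintype.card_fin, cap]
  have h1 : ((I.W.factorial : ℕ) : ℤ) ≤ (I.l : ℤ) ^ I.W := by
    have := Nat.factorial_le_pow I.W
    calc ((I.W.factorial : ℕ) : ℤ) ≤ ((I.W ^ I.W : ℕ) : ℤ) := by exact_mod_cast this
      _ = (I.W : ℤ) ^ I.W := by push_cast; rfl
      _ ≤ _ := pow_le_pow_left₀ (by positivity) (by omega) _
  calc _ ≤ (I.l : ℤ) ^ I.W * (73 * (I.l : ℤ) ^ 4) ^ I.W := by gcongr
    _ = (73 * (I.l : ℤ) ^ 5) ^ I.W := by rw [← mul_pow]; ring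
    _ ≤ _ := by
      refine pow_le_pow_right₀ ?_ (by omega)
      have : (1 : ℤ) ≤ (I.l : ℤ) ^ 5 := one_le_pow₀ hl'
      omega

theorem abs_det_part_le (ht : t < I.k) {s : ℕ} (hs : s ≤ I.W + I.l + I.l) :
    |(I.part t T s).det| ≤ I.cap :=
  (abs_det_le (abs_part_le ht hs)).trans factorial_mul_le

theorem abs_adjugate_part_le (ht : t < I.k) {s : ℕ} (hs : s ≤ I.W + I.l + I.l) (i j : Fin I.W) :
    |(I.part t T s).adjugate i j| ≤ I.cap := by
  refine (abs_adjugate_le ?_ (abs_part_le ht hs) i j).trans factorial_mul_le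
  have hl := I.l_pos
  have : (1 : ℤ) ≤ (I.l : ℤ) ^ 4 := one_le_pow₀ (by omega)
  omega

end EdgeSystem

end AdditiveSparsifier

namespace AdditiveSparsifier

/-! ### A program logic with time bounds -/

instance : Add Expr := ⟨Expr.add⟩
instance : Sub Expr := ⟨Expr.sub⟩
instance : Mul Expr := ⟨Expr.mul⟩
instance : Div Expr := ⟨Expr.div⟩
instance (k : ℕ) : OfNat Expr k := ⟨Expr.const k⟩

namespace Expr

@[simp] theorem eval_add (σ : Memory) (e f : Expr) : (e + f).eval σ = e.eval σ + f.eval σ := rfl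
@[simp] theorem eval_sub (σ : Memory) (e f : Expr) : (e - f).eval σ = e.eval σ - f.eval σ := rfl
@[simp] theorem eval_mul (σ : Memory) (e f : Expr) : (e * f).eval σ = e.eval σ * f.eval σ := rfl
@[simp] theorem eval_div (σ : Memory) (e f : Expr) : (e / f).eval σ = e.eval σ / f.eval σ := rfl
@[simp] theorem eval_reg (σ : Memory) (x : ℕ) : (reg x).eval σ = σ.reg x := rfl
@[simp] theorem eval_read (σ : Memory) (a : ℕ) (e : Expr) :
    (read a e).eval σ = σ.arr a (e.eval σ).toNat := rfl
@[simp] theorem eval_const (σ : Memory) (z : ℤ) : (const z).eval σ = z := rfl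
@[simp] theorem eval_zero (σ : Memory) : (0 : Expr).eval σ = 0 := rfl
@[simp] theorem eval_one (σ : Memory) : (1 : Expr).eval σ = 1 := rfl
@[simp] theorem eval_ofNat (σ : Memory) (k : ℕ) [k.AtLeastTwo] :
    (ofNat(k) : Expr).eval σ = (ofNat(k) : ℤ) := rfl

/-- In a memory of `b`-bit numbers the value of `e` has at most `e.deg * b` bits. -/
def deg : Expr → ℕ
  | const z => bits z
  | reg _ => 1
  | read _ _ => 1
  | add e f => e.deg + f.deg + 1
  | sub e f => e.deg + f.deg + 1
  | mul e f => e.deg + f.deg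
  | div e _ => e.deg

/-- In a memory of `b`-bit numbers the evaluation of `e` takes time at most `e.time * b`. -/
def time : Expr → ℕ
  | const z => (const z).deg + 2
  | reg x => (reg x).deg + 2
  | read a e => e.time + (read a e).deg + 2
  | add e f => e.time + f.time + ((add e f).deg + 2)
  | sub e f => e.time + f.time + ((sub e f).deg + 2)
  | mul e f => e.time + f.time + ((mul e f).deg + 2)
  | div e f => e.time + f.time + ((div e f).deg + 2)

end Expr

/-- All numbers in the memory have at most `b` bits. -/
structure Bounded (b : ℕ) (σ : Memory) : Prop where
  reg : ∀ x, |σ.reg x| ≤ 2 ^ b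
  arr : ∀ a i, |σ.arr a i| ≤ 2 ^ b

theorem bits_le {z : ℤ} {k : ℕ} (h : |z| ≤ 2 ^ k) : bits z ≤ k + 2 := by
  have h1 : z.natAbs ≤ 2 ^ k := by zify; exact h
  have h2 : Nat.size z.natAbs ≤ k + 1 :=
    Nat.size_le.2 (h1.trans_lt (Nat.pow_lt_pow_right (by norm_num) (Nat.lt_succ_self k)))
  unfold bits; omega

theorem abs_le_two_pow_bits (z : ℤ) : |z| ≤ 2 ^ bits z := by
  have h1 : z.natAbs < 2 ^ Nat.size z.natAbs := Nat.lt_size_self _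
  have h2 : z.natAbs ≤ 2 ^ bits z :=
    h1.le.trans (Nat.pow_le_pow_right (by norm_num) (by unfold bits; omega))
  rw [Int.abs_eq_natAbs]
  exact_mod_cast h2

/-- Sums need one more bit, whence the `+ 1` in `deg`; products add bit lengths; an integer quotient
is never larger in absolute value than its dividend. As a result only the stored numbers, not the
intermediate values, have to be bounded later. -/
theorem Expr.abs_eval_le {b : ℕ} (hb : 1 ≤ b) {σ : Memory} (hσ : Bounded b σ) (e : Expr) :
    |e.eval σ| ≤ 2 ^ (e.deg * b) := by
  have add_aux : ∀ (x y : ℤ) (p q : ℕ), |x| ≤ 2 ^ (p * b) → |y| ≤ 2 ^ (q * b) →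
      |x| + |y| ≤ 2 ^ ((p + q + 1) * b) := by
    intro x y p q hx hy
    have h1 : (2 : ℤ) ^ (p * b) ≤ 2 ^ ((p + q) * b) := pow_le_pow_right₀ (by norm_num) (by nlinarith)
    have h2 : (2 : ℤ) ^ (q * b) ≤ 2 ^ ((p + q) * b) := pow_le_pow_right₀ (by norm_num) (by nlinarith)
    have h3 : (2 : ℤ) ^ ((p + q) * b + 1) ≤ 2 ^ ((p + q + 1) * b) :=
      pow_le_pow_right₀ (by norm_num) (by nlinarith)
    rw [pow_succ] at h3
    linarith
  induction e with
  | const z =>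
    refine (abs_le_two_pow_bits z).trans (pow_le_pow_right₀ (by norm_num) ?_)
    exact Nat.le_mul_of_pos_right _ hb
  | reg x => simpa [Expr.eval, deg] using hσ.reg x
  | read a e _ => simpa [Expr.eval, deg] using hσ.arr a _
  | add e f he hf => exact (abs_add_le _ _).trans (add_aux _ _ _ _ he hf)
  | sub e f he hf => exact (abs_sub _ _).trans (add_aux _ _ _ _ he hf)
  | mul e f he hf =>
    simp only [Expr.eval, deg, abs_mul, add_mul, pow_add]
    exact mul_le_mul he hf (abs_nonneg _) (by positivity)
  | div e f he _ =>
    refine le_trans ?_ he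
    have := Int.natAbs_ediv_le_natAbs (e.eval σ) (f.eval σ)
    simp only [Expr.eval]
    zify at this
    exact this

theorem Expr.cost_le {b : ℕ} (hb : 1 ≤ b) {σ : Memory} (hσ : Bounded b σ) (e : Expr) :
    e.cost σ ≤ e.time * b := by
  have key : ∀ e : Expr, bits (e.eval σ) ≤ (e.deg + 2) * b := by
    intro e
    refine (bits_le (e.abs_eval_le hb hσ)).trans ?_
    nlinarith
  induction e with
  | const z => exact key (const z)
  | reg x => exact key (.reg x)
  | read a e he =>
    have := key (read a e)
    simp only [cost, time]
    linarith
  | add e f he hf =>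
    have := key (add e f)
    simp only [cost, time]
    linarith
  | sub e f he hf =>
    have := key (sub e f)
    simp only [cost, time]
    linarith
  | mul e f he hf =>
    have := key (mul e f)
    simp only [cost, time]
    linarith
  | div e f he hf =>
    have := key (div e f)
    simp only [cost, time]
    linarith

namespace Prog

/-- Whether a program may write register `x`. -/
def wr (x : ℕ) : Prog → Bool
  | skip => false
  | assign y _ => x == y
  | write _ _ _ => false
  | seq p q => p.wr x || q.wr x
  | ite _ p q => p.wr x || q.wr x
  | loop _ p => p.wr x

/-- Whether a program may write array `a`. -/
def wa (a : ℕ) : Prog → Bool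
  | skip => false
  | assign _ _ => false
  | write c _ _ => a == c
  | seq p q => p.wa a || q.wa a
  | ite _ p q => p.wa a || q.wa a
  | loop _ p => p.wa a

/-- With `b`-bit numbers and at most `m` iterations of every loop, the program takes time at most
`p.time m * b`. -/
def time (m : ℕ) : Prog → ℕ
  | skip => 1
  | assign _ e => 1 + e.time
  | write _ e f => 1 + e.time + f.time
  | seq p q => p.time m + q.time m
  | ite e p q => 1 + e.time + p.time m + q.time m
  | loop e p => (m + 1) * (1 + e.time) + m * p.time m

/-- The degree is at most the nesting depth of the loops, which is fixed by the program. -/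
theorem exists_polynomial_time (p : Prog) : ∃ f : Polynomial ℕ, ∀ m, f.eval m = p.time m := by
  induction p with
  | skip => exact ⟨1, fun m => by simp [time]⟩
  | assign x e => exact ⟨.C (1 + e.time), fun m => by rw [Polynomial.eval_C, time]⟩
  | write a e f => exact ⟨.C (1 + e.time + f.time), fun m => by rw [Polynomial.eval_C, time]⟩
  | seq p q hp hq =>
    obtain ⟨f, hf⟩ := hp
    obtain ⟨g, hg⟩ := hq
    exact ⟨f + g, fun m => by rw [Polynomial.eval_add, hf, hg, time]⟩
  | ite e p q hp hq =>
    obtain ⟨f, hf⟩ := hp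
    obtain ⟨g, hg⟩ := hq
    exact ⟨.C (1 + e.time) + f + g, fun m => by
      rw [Polynomial.eval_add, Polynomial.eval_add, Polynomial.eval_C, hf, hg, time]⟩
  | loop e p hp =>
    obtain ⟨f, hf⟩ := hp
    exact ⟨(.X + 1) * .C (1 + e.time) + .X * f, fun m => by
      simp only [Polynomial.eval_add, Polynomial.eval_mul, Polynomial.eval_C, Polynomial.eval_X,
        Polynomial.eval_one, hf, time]⟩

/-- Sequential composition of a list of programs. -/
def block : List Prog → Prog
  | [] => skip
  | p :: l => seq p (block l)

/-- `forLoop i e p` runs `p` for the values `0, 1, …` of register `i` below the value of `e`. -/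
def forLoop (i : ℕ) (e : Expr) (p : Prog) : Prog :=
  seq (assign i 0) (loop (e - .reg i) (seq p (assign i (.reg i + 1))))

end Prog

/-- `τ` differs from `σ` only in the registers and arrays that `p` may write. -/
structure Frame (p : Prog) (σ τ : Memory) : Prop where
  reg : ∀ x, p.wr x = false → τ.reg x = σ.reg x
  arr : ∀ a, p.wa a = false → τ.arr a = σ.arr a

theorem Frame.refl (p : Prog) (σ : Memory) : Frame p σ σ := ⟨fun _ _ => rfl, fun _ _ => rfl⟩

/-- Loop invariants thereby need to mention only what a loop changes. As `wr` and `wa` are Boolean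
functions of the program, the side conditions are settled by `rfl`. -/
theorem Exec.frame {p : Prog} {σ τ : Memory} {t : ℕ} (h : Exec p σ t τ) : Frame p σ τ := by
  induction h with
  | skip σ => exact .refl _ _
  | assign σ x e =>
    refine ⟨fun y hy => ?_, fun _ _ => rfl⟩
    exact Function.update_of_ne (by simpa [Prog.wr] using hy) _ _
  | write σ a e f =>
    refine ⟨fun _ _ => rfl, fun c hc => ?_⟩
    exact Function.update_of_ne (by simpa [Prog.wa] using hc) _ _
  | seq _ _ ihp ihq =>
    refine ⟨fun x hx => ?_, fun a ha => ?_⟩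
    · rw [Prog.wr, Bool.or_eq_false_iff] at hx
      rw [ihq.reg x hx.2, ihp.reg x hx.1]
    · rw [Prog.wa, Bool.or_eq_false_iff] at ha
      rw [ihq.arr a ha.2, ihp.arr a ha.1]
  | ite_true _ _ ih =>
    refine ⟨fun x hx => ?_, fun a ha => ?_⟩
    · rw [Prog.wr, Bool.or_eq_false_iff] at hx
      exact ih.reg x hx.1
    · rw [Prog.wa, Bool.or_eq_false_iff] at ha
      exact ih.arr a ha.1
  | ite_false _ _ ih =>
    refine ⟨fun x hx => ?_, fun a ha => ?_⟩
    · rw [Prog.wr, Bool.or_eq_false_iff] at hx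
      exact ih.reg x hx.2
    · rw [Prog.wa, Bool.or_eq_false_iff] at ha
      exact ih.arr a ha.2
  | loop_true _ _ _ ihp ihl =>
    refine ⟨fun x hx => ?_, fun a ha => ?_⟩
    · rw [ihl.reg x hx, ihp.reg x (by simpa [Prog.wr] using hx)]
    · rw [ihl.arr a ha, ihp.arr a (by simpa [Prog.wa] using ha)]
  | loop_false _ => exact .refl _ _

@[simp] theorem Memory.reg_setReg (σ : Memory) (x y : ℕ) (z : ℤ) :
    (σ.setReg x z).reg y = if y = x then z else σ.reg y := by
  simp [Memory.setReg, Function.update_apply]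

@[simp] theorem Memory.arr_setReg (σ : Memory) (x : ℕ) (z : ℤ) : (σ.setReg x z).arr = σ.arr := rfl

@[simp] theorem Memory.reg_setArr (σ : Memory) (a i : ℕ) (z : ℤ) : (σ.setArr a i z).reg = σ.reg := rfl

theorem Memory.arr_setArr (σ : Memory) (a i : ℕ) (z : ℤ) (c j : ℕ) :
    (σ.setArr a i z).arr c j = if c = a ∧ j = i then z else σ.arr c j := by
  by_cases h : c = a
  · subst h; simp [Memory.setArr, Function.update_apply]
  · simp [Memory.setArr, h]

theorem Bounded.setReg {b : ℕ} {σ : Memory} (h : Bounded b σ) (x : ℕ) {z : ℤ} (hz : |z| ≤ 2 ^ b) :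
    Bounded b (σ.setReg x z) := by
  refine ⟨fun y => ?_, h.arr⟩
  rw [Memory.reg_setReg]
  split_ifs
  exacts [hz, h.reg y]

theorem Bounded.setArr {b : ℕ} {σ : Memory} (h : Bounded b σ) (a i : ℕ) {z : ℤ} (hz : |z| ≤ 2 ^ b) :
    Bounded b (σ.setArr a i z) := by
  refine ⟨h.reg, fun c j => ?_⟩
  rw [Memory.arr_setArr]
  split_ifs
  exacts [hz, h.arr c j]

/-- From `σ` the program `p` reaches a memory of `b`-bit numbers with property `Q`, in time
`p.time m * b`. -/
def Runs (b m : ℕ) (p : Prog) (σ : Memory) (Q : Memory → Prop) : Prop :=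
  ∃ t τ, Exec p σ t τ ∧ t ≤ p.time m * b ∧ Bounded b τ ∧ Q τ

namespace Runs

variable {b m : ℕ} {σ : Memory} {Q R : Memory → Prop}

theorem consequence {p : Prog} (h : Runs b m p σ R)
    (hQ : ∀ τ, Bounded b τ → Frame p σ τ → R τ → Q τ) : Runs b m p σ Q := by
  obtain ⟨t, τ, h1, h2, h3, h4⟩ := h
  exact ⟨t, τ, h1, h2, h3, hQ τ h3 h1.frame h4⟩

theorem skip (hb : 1 ≤ b) (hσ : Bounded b σ) (h : Q σ) : Runs b m .skip σ Q :=
  ⟨1, σ, .skip σ, by simpa [Prog.time] using hb, hσ, h⟩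

theorem assign (hb : 1 ≤ b) (hσ : Bounded b σ) {x : ℕ} {e : Expr} {v : ℤ} (he : e.eval σ = v)
    (hv : |v| ≤ 2 ^ b) (h : Q (σ.setReg x v)) : Runs b m (.assign x e) σ Q := by
  subst he
  refine ⟨_, _, .assign σ x e, ?_, hσ.setReg x hv, h⟩
  have := e.cost_le hb hσ
  simp only [Prog.time]
  nlinarith

theorem write (hb : 1 ≤ b) (hσ : Bounded b σ) {a : ℕ} {e f : Expr} {i : ℕ} {v : ℤ}
    (he : e.eval σ = i) (hf : f.eval σ = v) (hv : |v| ≤ 2 ^ b) (h : Q (σ.setArr a i v)) :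
    Runs b m (.write a e f) σ Q := by
  subst hf
  have h1 : (e.eval σ).toNat = i := by rw [he]; rfl
  have h2 := Exec.write σ a e f
  rw [h1] at h2
  refine ⟨_, _, h2, ?_, hσ.setArr a i hv, h⟩
  have := e.cost_le hb hσ
  have := f.cost_le hb hσ
  simp only [Prog.time]
  nlinarith

theorem seq {p q : Prog} (hp : Runs b m p σ R)
    (hq : ∀ τ, Bounded b τ → Frame p σ τ → R τ → Runs b m q τ Q) : Runs b m (.seq p q) σ Q := by
  obtain ⟨s, τ, h1, h2, h3, h4⟩ := hp
  obtain ⟨t, ρ, h5, h6, h7, h8⟩ := hq τ h3 h1.frame h4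
  refine ⟨_, ρ, h1.seq h5, ?_, h7, h8⟩
  simp only [Prog.time]
  linarith

theorem assign_seq (hb : 1 ≤ b) (hσ : Bounded b σ) {x : ℕ} {e : Expr} {q : Prog} (v : ℤ)
    (he : e.eval σ = v) (hv : |v| ≤ 2 ^ b)
    (h : Bounded b (σ.setReg x v) → Runs b m q (σ.setReg x v) Q) :
    Runs b m (.seq (.assign x e) q) σ Q :=
  seq (R := fun τ => τ = σ.setReg x v) (assign hb hσ he hv rfl) fun τ hτ _ h' => by
    subst h'; exact h hτ

theorem write_seq (hb : 1 ≤ b) (hσ : Bounded b σ) {a : ℕ} {e f : Expr} {q : Prog} (i : ℕ) (v : ℤ)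
    (he : e.eval σ = i) (hf : f.eval σ = v) (hv : |v| ≤ 2 ^ b)
    (h : Bounded b (σ.setArr a i v) → Runs b m q (σ.setArr a i v) Q) :
    Runs b m (.seq (.write a e f) q) σ Q :=
  seq (R := fun τ => τ = σ.setArr a i v) (write hb hσ he hf hv rfl) fun τ hτ _ h' => by
    subst h'; exact h hτ

theorem ite (hb : 1 ≤ b) (hσ : Bounded b σ) {e : Expr} {p q : Prog}
    (hp : 0 < e.eval σ → Runs b m p σ Q) (hq : e.eval σ ≤ 0 → Runs b m q σ Q) :
    Runs b m (.ite e p q) σ Q := by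
  have := e.cost_le hb hσ
  by_cases he : 0 < e.eval σ
  · obtain ⟨t, τ, h1, h2, h3, h4⟩ := hp he
    refine ⟨_, τ, .ite_true he h1, ?_, h3, h4⟩
    simp only [Prog.time]
    nlinarith [Nat.zero_le (q.time m * b)]
  · obtain ⟨t, τ, h1, h2, h3, h4⟩ := hq (not_lt.1 he)
    refine ⟨_, τ, .ite_false he h1, ?_, h3, h4⟩
    simp only [Prog.time]
    nlinarith [Nat.zero_le (p.time m * b)]

/-- The rule for `for` loops, with a loop invariant. -/
theorem forLoop (hb : 1 ≤ b) (hσ : Bounded b σ) {i : ℕ} {e : Expr} {p : Prog} (cnt : ℕ)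
    (hm : cnt ≤ m) (hcb : (cnt : ℤ) ≤ 2 ^ b) (hi : p.wr i = false) (Inv : ℕ → Memory → Prop)
    (he : ∀ j τ, Frame (.forLoop i e p) σ τ → Inv j τ → e.eval τ = cnt)
    (h0 : Inv 0 (σ.setReg i 0))
    (hstep : ∀ j < cnt, ∀ τ, Bounded b τ → Frame (.forLoop i e p) σ τ → τ.reg i = j → Inv j τ →
      Runs b m p τ fun ρ => Inv (j + 1) (ρ.setReg i (j + 1 : ℕ)))
    (hQ : ∀ τ, Bounded b τ → Frame (.forLoop i e p) σ τ → Inv cnt τ → Q τ) :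
    Runs b m (.forLoop i e p) σ Q := by
  -- The frame of the whole loop survives one more run of the body followed by the increment of the
  -- counter.
  have fr : ∀ {τ ρ : Memory} {x : ℕ} {z : ℤ}, x = i → Frame (.forLoop i e p) σ τ → Frame p τ ρ →
      Frame (.forLoop i e p) σ (ρ.setReg x z) := by
    rintro τ ρ _ z rfl h1 h2
    refine ⟨fun x hx => ?_, fun a ha => ?_⟩
    · have h3 := hx
      simp only [Prog.forLoop, Prog.wr, Bool.or_eq_false_iff, beq_eq_false_iff_ne] at h3
      rw [Memory.reg_setReg, if_neg h3.1, h2.reg x h3.2.1, h1.reg x hx]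
    · have h3 := ha
      simp only [Prog.forLoop, Prog.wa, Bool.or_eq_false_iff] at h3
      rw [Memory.arr_setReg, h2.arr a h3.2.1, h1.arr a ha]
  -- Induction on the number `r` of iterations that remain, with `r + 1` tests and `r` bodies in the
  -- time bound.
  have main : ∀ r j τ, j + r = cnt → Bounded b τ → Frame (.forLoop i e p) σ τ → τ.reg i = j →
      Inv j τ → ∃ t ρ, Exec (.loop (e - .reg i) (.seq p (.assign i (.reg i + 1)))) τ t ρ ∧
        t ≤ ((r + 1) * (1 + (e - .reg i : Expr).time) +
          r * (Prog.seq p (.assign i (.reg i + 1))).time m) * b ∧ Bounded b ρ ∧ Q ρ := by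
    intro r
    induction r with
    | zero =>
      intro j τ hj hτ hF hji hI
      have h1 : ¬ 0 < (e - .reg i : Expr).eval τ := by
        rw [Expr.eval_sub, he j τ hF hI, Expr.eval_reg, hji]
        omega
      refine ⟨_, τ, .loop_false h1, ?_, hτ, ?_⟩
      · have := (e - .reg i : Expr).cost_le hb hτ
        nlinarith
      · have : j = cnt := by omega
        subst this
        exact hQ τ hτ hF hI
    | succ r ih =>
      intro j τ hj hτ hF hji hI
      have h1 : 0 < (e - .reg i : Expr).eval τ := by
        rw [Expr.eval_sub, he j τ hF hI, Expr.eval_reg, hji]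
        omega
      have hbody : Runs b m (.seq p (.assign i (.reg i + 1))) τ fun ρ =>
          Frame (.forLoop i e p) σ ρ ∧ ρ.reg i = (j + 1 : ℕ) ∧ Inv (j + 1) ρ := by
        refine seq (hstep j (by omega) τ hτ hF hji hI) fun ρ hρ hFρ hIρ => ?_
        have hv : ((j + 1 : ℕ) : ℤ) ≤ 2 ^ b := le_trans (by omega) hcb
        refine assign hb hρ (v := ((j + 1 : ℕ) : ℤ)) ?_ ?_ ⟨fr rfl hF hFρ, by simp, hIρ⟩
        · rw [Expr.eval_add, Expr.eval_reg, hFρ.reg i hi, hji]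
          simp
        · rw [abs_of_nonneg (by positivity)]
          exact hv
      obtain ⟨s, ρ, h2, h3, h4, h5, h6, h7⟩ := hbody
      obtain ⟨t, ω, h8, h9, h10, h11⟩ := ih (j + 1) ρ (by omega) h4 h5 h6 h7
      refine ⟨_, ω, .loop_true h1 h2 h8, ?_, h10, h11⟩
      have := (e - .reg i : Expr).cost_le hb hτ
      nlinarith
  have h0' := hσ.setReg i (z := 0) (by simp)
  obtain ⟨t, ρ, h1, h2, h3, h4⟩ := main cnt 0 (σ.setReg i 0) (by simp) h0'
    (fr rfl (.refl _ _) (.refl _ _)) (by simp) h0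
  refine ⟨_, ρ, .seq (.assign σ i 0) h1, ?_, h3, h4⟩
  have h5 := (0 : Expr).cost_le hb hσ
  refine (Nat.add_le_add_left h2 _).trans ?_
  simp only [Prog.forLoop, Prog.time]
  have h6 : ((cnt + 1) * (1 + (e - .reg i : Expr).time) +
          cnt * (Prog.seq p (.assign i (.reg i + 1))).time m) ≤
      ((m + 1) * (1 + (e - .reg i : Expr).time) +
          m * (Prog.seq p (.assign i (.reg i + 1))).time m) := by gcongr
  simp only [Prog.time] at h6 ⊢
  have h7 := Nat.mul_le_mul_right b h6
  nlinarith

/-- Filling the first `cnt` cells of an array. -/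
theorem fill (hb : 1 ≤ b) (hσ : Bounded b σ) {i a : ℕ} {e f : Expr} (cnt : ℕ)
    (hm : cnt ≤ m) (hcb : (cnt : ℤ) ≤ 2 ^ b) (v : ℕ → ℤ)
    (he : ∀ τ, Frame (.forLoop i e (.write a (.reg i) f)) σ τ → e.eval τ = cnt)
    (hv : ∀ j < cnt, |v j| ≤ 2 ^ b)
    (hf : ∀ j < cnt, ∀ τ, Frame (.forLoop i e (.write a (.reg i) f)) σ τ → τ.reg i = j →
      τ.arr a j = σ.arr a j → f.eval τ = v j) :
    Runs b m (.forLoop i e (.write a (.reg i) f)) σ fun τ =>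
      ∀ j, τ.arr a j = if j < cnt then v j else σ.arr a j := by
  refine forLoop hb hσ cnt hm hcb rfl
    (fun k τ => ∀ j, τ.arr a j = if j < k then v j else σ.arr a j) (fun _ τ hF _ => he τ hF)
    (by simp) ?_ (fun τ _ _ h => h)
  intro k hk τ hτ hF hi hI
  refine write hb hτ (i := k) (by simpa using hi) (hf k hk τ hF hi ?_) (hv k hk) ?_
  · simpa using hI k
  · intro j
    rw [Memory.arr_setReg, Memory.arr_setArr]
    rcases lt_trichotomy j k with h | h | h
    · rw [if_neg (by omega), hI, if_pos h, if_pos (by omega)]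
    · subst h; simp
    · rw [if_neg (by omega), hI, if_neg (by omega), if_neg (by omega)]

end Runs

end AdditiveSparsifier

namespace AdditiveSparsifier

open Matrix AdditiveSparsifier.Expr Prog

/-! ### Updating the adjugate -/

/-- Row by row listing of the entries of a matrix. -/
def flat {W : ℕ} (P : Matrix (Fin W) (Fin W) ℤ) (p : ℕ) : ℤ :=
  if h : p < W * W then
    P ⟨p / W, Nat.div_lt_of_lt_mul h⟩ ⟨p % W, Nat.mod_lt _ (Nat.pos_of_mul_pos_left (Nat.zero_lt_of_lt h))⟩
  else 0

theorem flat_index_lt {W : ℕ} (a b : Fin W) : (a : ℕ) * W + b < W * W := by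
  have h1 := a.2
  have h2 := b.2
  nlinarith

theorem flat_mul_add {W : ℕ} (P : Matrix (Fin W) (Fin W) ℤ) (a b : Fin W) :
    flat P (a * W + b) = P a b := by
  have hW : 0 < W := lt_of_le_of_lt (Nat.zero_le _) a.2
  rw [flat, dif_pos (flat_index_lt a b)]
  congr 1
  · congr 1
    rw [mul_comm, Nat.mul_add_div hW, Nat.div_eq_of_lt b.2, add_zero]
  · apply Fin.ext
    simp only
    rw [mul_comm, Nat.mul_add_mod, Nat.mod_eq_of_lt b.2]

theorem flat_eq {W : ℕ} (P : Matrix (Fin W) (Fin W) ℤ) {p : ℕ} (h : p < W * W) :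
    flat P p = P ⟨p / W, Nat.div_lt_of_lt_mul h⟩
      ⟨p % W, Nat.mod_lt _ (Nat.pos_of_mul_pos_left (Nat.zero_lt_of_lt h))⟩ := dif_pos h

/-- Array `6` lists the matrix `P` row by row. -/
def Lists {W : ℕ} (P : Matrix (Fin W) (Fin W) ℤ) (σ : Memory) : Prop :=
  ∀ p < W * W, σ.arr 6 p = flat P p

theorem Lists.apply {W : ℕ} {P : Matrix (Fin W) (Fin W) ℤ} {σ : Memory} (h : Lists P σ)
    (a b : Fin W) : σ.arr 6 (a * W + b) = P a b := by
  rw [h _ (flat_index_lt a b), flat_mul_add]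

theorem toNat_mul_add (a W b : ℕ) : ((a : ℤ) * W + b).toNat = a * W + b := by
  exact_mod_cast Int.toNat_natCast (a * W + b)

theorem toNat_div (a b : ℕ) : ((a : ℤ) / b).toNat = a / b := by
  exact_mod_cast Int.toNat_natCast (a / b)

theorem toNat_mod (a b : ℕ) : ((a : ℤ) - b * (a / b)).toNat = a % b := by
  have : ((a : ℤ) - b * (a / b)) = ((a % b : ℕ) : ℤ) := by
    rw [Int.natCast_mod, Int.emod_def]
  rw [this, Int.toNat_natCast]

/-- Replaces the adjugate in array `6` and the determinant in register `13` of a `reg 6`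
dimensional matrix by those of its sum with `reg 12` times the square of the vector
`e_{reg 9} + reg 11 e_{reg 10}`. -/
def updateAdj : Prog := block [
  forLoop 15 (reg 6) (write 7 (reg 15)
    (read 6 (reg 15 * reg 6 + reg 9) + reg 11 * read 6 (reg 15 * reg 6 + reg 10))),
  assign 14 (reg 13 + reg 12 * (read 7 (reg 9) + reg 11 * read 7 (reg 10))),
  forLoop 15 (reg 6 * reg 6) (write 6 (reg 15)
    ((reg 14 * read 6 (reg 15) -
      reg 12 * read 7 (reg 15 / reg 6) * read 7 (reg 15 - reg 6 * (reg 15 / reg 6))) / reg 13)),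
  assign 13 (reg 14)]

/-- Array `7` receives `A.adjugate *ᵥ u`, which gives the new determinant by `det_add_rankOne`. The
adjugate can then be overwritten in place: by `adjugate_add_rankOne` each new entry depends only on
the old entry in the same cell, on array `7` and on the two determinants. -/
theorem runs_updateAdj {b m : ℕ} (hb : 1 ≤ b) {σ : Memory} (hσ : Bounded b σ) {W : ℕ}
    (hW : W * W ≤ m) (hWb : (W * W : ℤ) ≤ 2 ^ b) {A : Matrix (Fin W) (Fin W) ℤ} (hA : Aᵀ = A)
    {x y : ℕ} (hx : x < W) (hy : y < W) {γ β : ℤ} {u : Fin W → ℤ}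
    (hu : ∀ a : Fin W, u a = (if x = a then 1 else 0) + γ * (if y = a then 1 else 0))
    (hdet : 0 < A.det) (hdet' : 0 < (A + β • vecMulVec u u).det)
    (hv : ∀ a, |(A.adjugate *ᵥ u) a| ≤ 2 ^ b) (hd : |(A + β • vecMulVec u u).det| ≤ 2 ^ b)
    (hP : ∀ i j, |(A + β • vecMulVec u u).adjugate i j| ≤ 2 ^ b)
    (h6 : σ.reg 6 = W) (h9 : σ.reg 9 = x) (h10 : σ.reg 10 = y) (h11 : σ.reg 11 = γ)
    (h12 : σ.reg 12 = β) (h13 : σ.reg 13 = A.det) (hL : Lists A.adjugate σ) :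
    Runs b m updateAdj σ fun τ => τ.reg 13 = (A + β • vecMulVec u u).det ∧
      Lists (A + β • vecMulVec u u).adjugate τ := by
  have hW0 : 0 < W := lt_of_le_of_lt (Nat.zero_le _) hx
  have hWW : W ≤ W * W := Nat.le_mul_of_pos_left _ hW0
  have dot : ∀ f : Fin W → ℤ, u ⬝ᵥ f = f ⟨x, hx⟩ + γ * f ⟨y, hy⟩ := by
    intro f
    have aux : ∀ z (hz : z < W), ∑ a : Fin W, (if z = (a : ℕ) then (1 : ℤ) else 0) * f a = f ⟨z, hz⟩ := by
      intro z hz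
      rw [Finset.sum_eq_single ⟨z, hz⟩]
      · simp
      · intro c _ hc
        rw [if_neg, zero_mul]
        rintro rfl
        exact hc rfl
      · simp
    simp only [dotProduct, hu, add_mul, Finset.sum_add_distrib, aux x hx, mul_assoc,
      ← Finset.mul_sum, aux y hy]
  have mv : ∀ a, (A.adjugate *ᵥ u) a = A.adjugate a ⟨x, hx⟩ + γ * A.adjugate a ⟨y, hy⟩ := by
    intro a
    rw [mulVec, dotProduct_comm, dot]
  set M := A + β • vecMulVec u u with hM
  set v : ℕ → ℤ := fun j => if h : j < W then (A.adjugate *ᵥ u) ⟨j, h⟩ else 0 with hvdef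
  have hvj : ∀ j (hj : j < W), v j = (A.adjugate *ᵥ u) ⟨j, hj⟩ := fun j hj => dif_pos hj
  refine Runs.seq (Runs.fill hb hσ W (hWW.trans hW) (le_trans (by exact_mod_cast hWW) hWb) v ?_ ?_ ?_)
    fun τ hτ hF hI => ?_
  · intro τ hF
    rw [eval_reg, hF.reg 6 rfl, h6]
  · intro j hj
    rw [hvj j hj]
    exact hv _
  · intro j hj τ hF hi _
    simp only [eval_add, eval_mul, eval_read, eval_reg, hi, hF.reg 6 rfl, hF.reg 9 rfl,
      hF.reg 10 rfl, hF.reg 11 rfl, hF.arr 6 rfl, h6, h9, h10, h11, toNat_mul_add]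
    rw [hvj j hj, mv, ← hL.apply, ← hL.apply]
  have g6 : τ.reg 6 = W := by rw [hF.reg 6 rfl, h6]
  have g13 : τ.reg 13 = A.det := by rw [hF.reg 13 rfl, h13]
  have g12 : τ.reg 12 = β := by rw [hF.reg 12 rfl, h12]
  have gv : ∀ j (hj : j < W), τ.arr 7 j = (A.adjugate *ᵥ u) ⟨j, hj⟩ := by
    intro j hj; rw [hI, if_pos hj, hvj j hj]
  refine Runs.assign_seq hb hτ M.det ?_ hd fun hτ' => ?_
  · simp only [eval_add, eval_mul, eval_read, eval_reg, hF.reg 9 rfl,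
      hF.reg 10 rfl, hF.reg 11 rfl, g12, g13, h9, h10, h11, Int.toNat_natCast]
    rw [gv x hx, gv y hy, hM, det_add_rankOne hdet.ne', dot]
  refine Runs.seq (Runs.fill hb hτ' (W * W) hW (by exact_mod_cast hWb) (flat M.adjugate) ?_ ?_ ?_)
    fun ρ hρ hF' hI' => ?_
  · intro ρ hF'
    simp [hF'.reg 6 rfl, g6]
  · intro j hj
    rw [flat_eq _ hj]
    exact hP _ _
  · intro p hp ρ hF' hi hpp
    have e13 : ρ.reg 13 = A.det := by rw [hF'.reg 13 rfl]; simpa using g13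
    have e14 : ρ.reg 14 = M.det := by rw [hF'.reg 14 rfl]; simp
    have e12 : ρ.reg 12 = β := by rw [hF'.reg 12 rfl]; simpa using g12
    have e6 : ρ.reg 6 = W := by rw [hF'.reg 6 rfl]; simpa using g6
    have e7 : ρ.arr 7 = τ.arr 7 := by rw [hF'.arr 7 rfl]; rfl
    have eP : ρ.arr 6 p = flat A.adjugate p := by
      rw [hpp, Memory.arr_setReg, hF.arr 6 rfl]; exact hL p hp
    simp only [eval_sub, eval_div, eval_mul, eval_read, eval_reg, hi, e6, e12, e13, e14, e7,
      Int.toNat_natCast, toNat_div, toNat_mod, eP]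
    rw [gv _ (Nat.div_lt_of_lt_mul hp), gv _ (Nat.mod_lt p hW0), flat_eq _ hp, flat_eq _ hp]
    -- The dividend is `A.det` times the new entry, so the integer division is exact.
    apply Int.ediv_eq_of_eq_mul_right hdet.ne'
    have h1 := congrFun (congrFun (adjugate_add_rankOne hA hdet.ne' β u hdet'.ne')
      ⟨p / W, Nat.div_lt_of_lt_mul hp⟩) ⟨p % W, Nat.mod_lt p hW0⟩
    simp only [Matrix.smul_apply, Matrix.sub_apply, smul_eq_mul, vecMulVec_apply, ← hM] at h1
    rw [h1]
    ring
  refine Runs.assign_seq hb hρ M.det ?_ hd fun hρ' => ?_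
  · rw [eval_reg, hF'.reg 14 rfl]; simp
  refine Runs.skip hb hρ' ⟨by simp, ?_⟩
  intro p hp
  rw [Memory.arr_setReg, hI', if_pos hp]

namespace EdgeSystem

variable {I : EdgeSystem}

/-- The memory holds the parameters of the edge system. -/
structure Stored (I : EdgeSystem) (σ : Memory) : Prop where
  h : σ.reg 3 = I.h
  k : σ.reg 4 = I.k
  l : σ.reg 5 = I.l
  W : σ.reg 6 = I.W
  X : ∀ e < I.l, σ.arr 2 e = I.X e
  Y : ∀ e < I.l, σ.arr 3 e = I.Y e
  D : ∀ a < I.W, σ.arr 4 a = I.dN a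

theorem Stored.congr {σ τ : Memory} (h : I.Stored σ) (h3 : τ.reg 3 = σ.reg 3)
    (h4 : τ.reg 4 = σ.reg 4) (h5 : τ.reg 5 = σ.reg 5) (h6 : τ.reg 6 = σ.reg 6)
    (a2 : τ.arr 2 = σ.arr 2) (a3 : τ.arr 3 = σ.arr 3) (a4 : τ.arr 4 = σ.arr 4) : I.Stored τ :=
  ⟨h3 ▸ h.h, h4 ▸ h.k, h5 ▸ h.l, h6 ▸ h.W, a2 ▸ h.X, a3 ▸ h.Y, a4 ▸ h.D⟩

/-- Array `5` is the indicator of the set `T` of edges. -/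
def Selected (I : EdgeSystem) (T : Finset ℕ) (σ : Memory) : Prop :=
  ∀ e < I.l, σ.arr 5 e = if e ∈ T then 1 else 0

/-- All numbers that occur in the greedy selection have at most `b` bits. -/
def Fits (I : EdgeSystem) (b : ℕ) : Prop := 100 * (I.l : ℤ) ^ 5 * I.cap ^ 2 ≤ 2 ^ b

theorem one_le_cap (I : EdgeSystem) : 1 ≤ I.cap := by
  have hl := I.l_pos
  have : (1 : ℤ) ≤ (I.l : ℤ) ^ 5 := one_le_pow₀ (by omega)
  exact one_le_pow₀ (by omega)

/-- All stored numbers have bounds of the shape `c l^i cap^j` within these ranges, so a single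
condition on `b` serves every assignment. -/
theorem Fits.le {b : ℕ} (hb : I.Fits b) {c : ℤ} {i j : ℕ} (hc : c ≤ 100) (hi : i ≤ 5)
    (hj : j ≤ 2) {z : ℤ} (hz : z ≤ c * (I.l : ℤ) ^ i * I.cap ^ j) : z ≤ 2 ^ b := by
  have hl := I.l_pos
  have h1 := I.one_le_cap
  have h2 : (1 : ℤ) ≤ I.l := by omega
  refine (hz.trans ?_).trans hb
  have h3 : (I.l : ℤ) ^ i ≤ (I.l : ℤ) ^ 5 := pow_le_pow_right₀ h2 hi
  have h4 : I.cap ^ j ≤ I.cap ^ 2 := pow_le_pow_right₀ h1 hj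
  have h5 : 0 ≤ I.cap ^ j := by positivity
  gcongr

end EdgeSystem

/-- Computes the vector and the coefficient of the rank one update with index `reg 8`, for time
`reg 7` of the greedy selection. -/
def prepareUpdate : Prog :=
  ite (reg 6 - reg 8)
    (block [assign 9 (reg 8), assign 10 (reg 8), assign 11 0,
      assign 12 ((reg 5 - reg 7 - 1) * (reg 4 + reg 7 + 1) * read 4 (reg 8) - 1)])
    (ite (reg 6 + reg 5 - reg 8)
      (block [assign 9 (read 2 (reg 8 - reg 6)), assign 10 (read 3 (reg 8 - reg 6)), assign 11 1,
        assign 12 (2 * reg 3 * reg 5 * (reg 7 + 1))])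
      (block [assign 9 (read 2 (reg 8 - reg 6 - reg 5)), assign 10 (read 3 (reg 8 - reg 6 - reg 5)),
        assign 11 1, assign 12 ((0 - 2 * reg 3 * reg 5 * reg 5) * read 5 (reg 8 - reg 6 - reg 5))]))

namespace EdgeSystem

variable {I : EdgeSystem} {b m t : ℕ} {T : Finset ℕ}

theorem ix_lt {s : ℕ} (hs : s < I.W + I.l + I.l) : I.ix s < I.W := by
  unfold ix
  split_ifs
  · assumption
  · exact I.X_lt _ (by omega)
  · exact I.X_lt _ (by omega)

theorem iy_lt {s : ℕ} (hs : s < I.W + I.l + I.l) : I.iy s < I.W := by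
  unfold iy
  split_ifs
  · assumption
  · exact I.Y_lt _ (by omega)
  · exact I.Y_lt _ (by omega)

theorem runs_prepareUpdate (hb : 1 ≤ b) (hfit : I.Fits b) (ht : t < I.k) {σ : Memory}
    (hσ : Bounded b σ) (hS : I.Stored σ) (hT : I.Selected T σ) (h7 : σ.reg 7 = t) {s : ℕ}
    (hs : s < I.W + I.l + I.l) (h8 : σ.reg 8 = s) :
    Runs b m prepareUpdate σ fun τ => τ.reg 9 = I.ix s ∧ τ.reg 10 = I.iy s ∧ τ.reg 11 = I.ig s ∧
      τ.reg 12 = I.ib t T s := by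
  have hW := I.W_le
  have hk := I.k_lt
  have hl : (1 : ℤ) ≤ I.l := by have := I.l_pos; omega
  have bW : ∀ x : ℕ, x < I.W → |(x : ℤ)| ≤ 2 ^ b := fun x hx => by
    rw [abs_of_nonneg (by positivity)]
    exact hfit.le (c := 1) (i := 1) (j := 0) (by norm_num) (by norm_num) (by norm_num)
      (by simp; omega)
  have b1 : |(1 : ℤ)| ≤ 2 ^ b := by
    rw [abs_one]; exact one_le_pow₀ (by norm_num)
  have bib : |I.ib t T s| ≤ 2 ^ b :=
    hfit.le (c := 6) (i := 3) (j := 0) (by norm_num) (by norm_num) (by norm_num)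
      (by simpa using I.abs_ib_le ht s)
  have bx := bW _ (I.ix_lt hs)
  have bY := bW _ (I.iy_lt hs)
  refine Runs.ite hb hσ (fun h1 => ?_) (fun h1 => ?_)
  · have h1' : s < I.W := by
      simp only [eval_sub, eval_reg, hS.W, h8] at h1; omega
    refine Runs.assign_seq hb hσ (I.ix s) (by simp [h8, ix, h1']) bx fun hσ1 => ?_
    refine Runs.assign_seq hb hσ1 (I.iy s) (by simp [h8, iy, h1']) bY fun hσ2 => ?_
    refine Runs.assign_seq hb hσ2 (I.ig s) (by simp [ig, h1']) (by simp [ig, h1']) fun hσ3 => ?_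
    refine Runs.assign_seq hb hσ3 (I.ib t T s) ?_ bib fun hσ4 => ?_
    · simp [h8, h7, hS.l, hS.k, ib, h1', hS.D s h1']
    · exact Runs.skip hb hσ4 (by simp)
  have h1' : ¬ s < I.W := by
    simp only [eval_sub, eval_reg, hS.W, h8] at h1; omega
  refine Runs.ite hb hσ (fun h2 => ?_) (fun h2 => ?_)
  · have h2' : s < I.W + I.l := by
      simp only [eval_sub, eval_add, eval_reg, hS.W, hS.l, h8] at h2; omega
    have e1 : ((s : ℤ) - I.W).toNat = s - I.W := by omega
    refine Runs.assign_seq hb hσ (I.ix s) ?_ bx fun hσ1 => ?_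
    · simp [h8, hS.W, ix, h1', h2', e1, hS.X _ (show s - I.W < I.l by omega)]
    refine Runs.assign_seq hb hσ1 (I.iy s) ?_ bY fun hσ2 => ?_
    · simp [h8, hS.W, iy, h1', h2', e1, hS.Y _ (show s - I.W < I.l by omega)]
    refine Runs.assign_seq hb hσ2 (I.ig s) (by simp [ig, h1']) (by simp only [ig, h1']; exact b1) fun hσ3 => ?_
    refine Runs.assign_seq hb hσ3 (I.ib t T s) ?_ bib fun hσ4 => ?_
    · simp [h7, hS.l, hS.h, ib, h1', h2']
    · exact Runs.skip hb hσ4 (by simp)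
  · have h2' : ¬ s < I.W + I.l := by
      simp only [eval_sub, eval_add, eval_reg, hS.W, hS.l, h8] at h2; omega
    have e1 : ((s : ℤ) - I.W - I.l).toNat = s - I.W - I.l := by omega
    have e2 : s - I.W - I.l < I.l := by omega
    refine Runs.assign_seq hb hσ (I.ix s) ?_ bx fun hσ1 => ?_
    · simp [h8, hS.W, hS.l, ix, h1', h2', e1, hS.X _ e2]
    refine Runs.assign_seq hb hσ1 (I.iy s) ?_ bY fun hσ2 => ?_
    · simp [h8, hS.W, hS.l, iy, h1', h2', e1, hS.Y _ e2]
    refine Runs.assign_seq hb hσ2 (I.ig s) (by simp [ig, h1']) (by simp only [ig, h1']; exact b1) fun hσ3 => ?_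
    refine Runs.assign_seq hb hσ3 (I.ib t T s) ?_ bib fun hσ4 => ?_
    · simp [h8, hS.l, hS.h, hS.W, ib, h1', h2', e1, hT _ e2]
    · exact Runs.skip hb hσ4 (by simp)

end EdgeSystem

/-- Computes the adjugate and the determinant of the matrix at time `reg 7` of the greedy
selection. -/
def buildAdj : Prog := block [
  assign 13 1,
  forLoop 15 (reg 6 * reg 6) (write 6 (reg 15)
    (1 - (reg 15 - (reg 6 + 1) * (reg 15 / (reg 6 + 1)) + reg 6) / (reg 6 + 1))),
  forLoop 8 (reg 6 + reg 5 + reg 5) (block [prepareUpdate, updateAdj])]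

/-- The position `a W + c` equals `a (W + 1) + (c - a)` with `|c - a| < W`, so it is divisible by `W
+ 1` exactly on the diagonal. For a remainder `r`, the quotient `(r + W) / (W + 1)` is `0` if `r =
0` and `1` otherwise. This avoids a branch in the program. -/
theorem flat_one {W p : ℕ} (hp : p < W * W) :
    (1 : ℤ) - ((p : ℤ) - (W + 1) * (p / (W + 1)) + W) / (W + 1) =
      flat (1 : Matrix (Fin W) (Fin W) ℤ) p := by
  have hW : 0 < W := Nat.pos_of_mul_pos_left (Nat.zero_lt_of_lt hp)
  obtain ⟨a, c, rfl⟩ : ∃ a c : Fin W, p = a * W + c :=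
    ⟨⟨p / W, Nat.div_lt_of_lt_mul hp⟩, ⟨p % W, Nat.mod_lt _ hW⟩, (Nat.div_add_mod' p W).symm⟩
  rw [flat_mul_add, one_apply]
  have ha := a.2
  have hc := c.2
  have hW' : (0 : ℤ) < W + 1 := by positivity
  have e0 : ((a * W + c : ℕ) : ℤ) - (W + 1) * (((a * W + c : ℕ) : ℤ) / (W + 1)) =
      ((a * W + c : ℕ) : ℤ) % (W + 1) := (Int.emod_def _ _).symm
  rw [e0]
  split_ifs with h
  · subst h
    have e1 : ((a * W + a : ℕ) : ℤ) % (W + 1) = 0 := by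
      rw [show ((a * W + a : ℕ) : ℤ) = (a : ℤ) * (W + 1) by push_cast; ring, Int.mul_emod_left]
    rw [e1, zero_add, Int.ediv_eq_zero_of_lt (by positivity) (by omega)]
    rfl
  · have h1 : (0 : ℤ) < ((a * W + c : ℕ) : ℤ) % (W + 1) := by
      refine lt_of_le_of_ne (Int.emod_nonneg _ hW'.ne') fun h0 => h ?_
      have h2 : ((W : ℤ) + 1) ∣ ((c : ℕ) : ℤ) - (a : ℕ) := by
        have h3 : ((W : ℤ) + 1) ∣ ((a * W + c : ℕ) : ℤ) := Int.dvd_of_emod_eq_zero h0.symm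
        have h4 := Int.dvd_sub h3 (Dvd.intro_left ((a : ℕ) : ℤ) rfl)
        rwa [show ((a * W + c : ℕ) : ℤ) - (a : ℕ) * (W + 1) = ((c : ℕ) : ℤ) - (a : ℕ) by
          push_cast; ring] at h4
      have h5 := Int.eq_zero_of_abs_lt_dvd h2 (by rw [abs_lt]; constructor <;> omega)
      exact Fin.ext (by omega)
    have h2 := Int.emod_lt_of_pos ((a * W + c : ℕ) : ℤ) hW'
    have : (((a * W + c : ℕ) : ℤ) % (W + 1) + W) / (W + 1) = 1 := by
      rw [Int.ediv_eq_iff_of_pos hW']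
      constructor <;> linarith
    rw [this]
    rfl

namespace EdgeSystem

variable {I : EdgeSystem} {b m t : ℕ} {T : Finset ℕ}

theorem runs_buildAdj (hb : 1 ≤ b) (hfit : I.Fits b) (hm : I.W * I.W ≤ m)
    (hm' : I.W + I.l + I.l ≤ m) (ht : t < I.k) (hI : I.Inv t T) {σ : Memory}
    (hσ : Bounded b σ) (hS : I.Stored σ) (hT : I.Selected T σ) (h7 : σ.reg 7 = t) :
    Runs b m buildAdj σ fun τ => τ.reg 13 = (I.B (t + 1) T).det ∧
      Lists (I.B (t + 1) T).adjugate τ := by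
  have hW := I.W_le
  have hk := I.k_lt
  have hl : (1 : ℤ) ≤ I.l := by have := I.l_pos; omega
  have hW0 := I.W_pos
  have hWb : (I.W * I.W : ℤ) ≤ 2 ^ b := by
    refine hfit.le (c := 1) (i := 2) (j := 0) (by norm_num) (by norm_num)
      (by norm_num) ?_
    have : (I.W : ℤ) ≤ I.l := by omega
    nlinarith
  have b1 : |(1 : ℤ)| ≤ 2 ^ b := by
    rw [abs_one]; exact one_le_pow₀ (by norm_num)
  refine Runs.assign_seq hb hσ 1 rfl b1 fun hσ1 => ?_
  refine Runs.seq (Runs.fill hb hσ1 (I.W * I.W) hm (by exact_mod_cast hWb)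
    (flat (1 : Matrix (Fin I.W) (Fin I.W) ℤ)) ?_ ?_ ?_) fun τ hτ hF hI1 => ?_
  · intro τ hF
    simp [hF.reg 6 rfl, hS.W]
  · intro p hp
    rw [flat_eq _ hp, one_apply]
    split_ifs
    · exact b1
    · simp
  · intro p hp τ hF hi _
    have e6 : τ.reg 6 = I.W := by rw [hF.reg 6 rfl]; simp [hS.W]
    simp only [eval_sub, eval_add, eval_mul, eval_div, eval_reg, eval_one, hi, e6]
    exact flat_one hp
  have hS1 : I.Stored τ := hS.congr (hF.reg 3 rfl) (hF.reg 4 rfl) (hF.reg 5 rfl) (hF.reg 6 rfl)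
    (hF.arr 2 rfl) (hF.arr 3 rfl) (hF.arr 4 rfl)
  have hT1 : I.Selected T τ := by
    intro e he; rw [hF.arr 5 rfl]; exact hT e he
  have g7 : τ.reg 7 = t := by rw [hF.reg 7 rfl]; simp [h7]
  have g13 : τ.reg 13 = 1 := by rw [hF.reg 13 rfl]; simp
  -- Positive determinants along the whole chain are what permits the division in every update.
  have key : ∀ s, s ≤ I.W + I.l + I.l → 0 < (I.part t T s).det := fun s hs =>
    det_pos_of_toReal (hI.posDef_part ht hs)
  refine Runs.seq (R := fun ρ => ρ.reg 13 = (I.B (t + 1) T).det ∧ Lists (I.B (t + 1) T).adjugate ρ)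
    (Runs.forLoop hb hτ (I.W + I.l + I.l) hm' ?_ rfl
      (fun s ρ => ρ.reg 13 = (I.part t T s).det ∧ Lists (I.part t T s).adjugate ρ) ?_ ?_ ?_ ?_)
    fun ρ hρ _ h => Runs.skip hb hρ h
  · refine hfit.le (c := 3) (i := 1) (j := 0) (by norm_num) (by norm_num)
      (by norm_num) ?_
    push_cast
    have : (I.W : ℤ) ≤ I.l := by omega
    linarith
  · intro s ρ hF' _
    simp [hF'.reg 6 rfl, hF'.reg 5 rfl, hS1.W, hS1.l]
  · rw [part_zero, det_one, adjugate_one]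
    refine ⟨by simp [g13], fun p hp => ?_⟩
    rw [Memory.arr_setReg, hI1, if_pos hp]
  · rintro s hs ρ hρ hF' hi ⟨hd, hL⟩
    have hS2 : I.Stored ρ := hS1.congr (hF'.reg 3 rfl) (hF'.reg 4 rfl) (hF'.reg 5 rfl)
      (hF'.reg 6 rfl) (hF'.arr 2 rfl) (hF'.arr 3 rfl) (hF'.arr 4 rfl)
    have hT2 : I.Selected T ρ := by
      intro e he; rw [hF'.arr 5 rfl]; exact hT1 e he
    refine Runs.seq (runs_prepareUpdate hb hfit ht hρ hS2 hT2 (by rw [hF'.reg 7 rfl, g7]) hs hi) ?_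
    rintro ω hω hG ⟨h9, h10, h11, h12⟩
    refine Runs.seq (runs_updateAdj hb hω hm hWb (I.transpose_part t T s) (I.ix_lt hs) (I.iy_lt hs)
      (u := I.iv s) (β := I.ib t T s) (γ := I.ig s) (fun _ => rfl) (key s hs.le) ?_ ?_ ?_ ?_
      (by rw [hG.reg 6 rfl, hS2.W]) h9 h10 h11 h12 (by rw [hG.reg 13 rfl, hd])
      (fun p hp => by rw [hG.arr 6 rfl]; exact hL p hp)) ?_
    · rw [← part_succ]; exact key _ hs
    · intro a
      have h1 : (I.part t T s).adjugate *ᵥ I.iv s = fun a =>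
          (I.part t T s).adjugate a ⟨I.ix s, I.ix_lt hs⟩ +
            I.ig s * (I.part t T s).adjugate a ⟨I.iy s, I.iy_lt hs⟩ := by
        ext a
        have aux : ∀ z (hz : z < I.W), ∑ c : Fin I.W, (I.part t T s).adjugate a c *
            (if z = (c : ℕ) then (1 : ℤ) else 0) = (I.part t T s).adjugate a ⟨z, hz⟩ := by
          intro z hz
          rw [Finset.sum_eq_single ⟨z, hz⟩]
          · simp
          · intro c _ hc
            rw [if_neg, mul_zero]
            rintro rfl
            exact hc rfl
          · simp
        simp only [mulVec, dotProduct, iv, mul_add, Finset.sum_add_distrib, aux _ (I.ix_lt hs)]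
        congr 1
        rw [← aux _ (I.iy_lt hs), Finset.mul_sum]
        exact Finset.sum_congr rfl fun c _ => by ring
      rw [h1]
      have h2 := I.abs_adjugate_part_le (T := T) ht hs.le a ⟨I.ix s, I.ix_lt hs⟩
      have h3 := I.abs_adjugate_part_le (T := T) ht hs.le a ⟨I.iy s, I.iy_lt hs⟩
      refine hfit.le (c := 2) (i := 0) (j := 1) (by norm_num) (by norm_num)
        (by norm_num) ?_
      refine (abs_add_le _ _).trans ?_
      have h4 : |I.ig s * (I.part t T s).adjugate a ⟨I.iy s, I.iy_lt hs⟩| ≤ I.cap := by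
        unfold ig
        split_ifs
        · simpa using (by have := I.one_le_cap; omega : (0 : ℤ) ≤ I.cap)
        · simpa using h3
      linarith
    · rw [← part_succ]
      exact hfit.le (c := 1) (i := 0) (j := 1) (by norm_num) (by norm_num)
        (by norm_num) (by simpa using I.abs_det_part_le (T := T) ht hs)
    · intro i j
      rw [← part_succ]
      exact hfit.le (c := 1) (i := 0) (j := 1) (by norm_num) (by norm_num)
        (by norm_num) (by simpa using I.abs_adjugate_part_le (T := T) ht hs i j)
    · rintro ξ hξ _ ⟨g1, g2⟩
      rw [← part_succ] at g1 g2
      exact Runs.skip hb hξ ⟨by simpa using g1, g2⟩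
  · intro ρ _ _ h
    rwa [I.part_end t hI.1] at h

end EdgeSystem

end AdditiveSparsifier

/-! ### The greedy selection as a program -/

namespace AdditiveSparsifier

open Matrix AdditiveSparsifier.Expr Prog

/-- Computes in registers `19` and `20` the numerator and the denominator of the increase of the
potential for edge `reg 21`. -/
def evalEdge : Prog := block [
  assign 9 (read 2 (reg 21)),
  assign 10 (read 3 (reg 21)),
  assign 19 0,
  forLoop 15 (reg 6) (assign 19 (reg 19 + read 4 (reg 15) *
    ((read 6 (reg 15 * reg 6 + reg 9) + read 6 (reg 15 * reg 6 + reg 10)) *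
      (read 6 (reg 15 * reg 6 + reg 9) + read 6 (reg 15 * reg 6 + reg 10))))),
  assign 20 (reg 13 - 2 * reg 3 * reg 5 * reg 5 *
    (read 6 (reg 9 * reg 6 + reg 9) + read 6 (reg 9 * reg 6 + reg 10) +
      (read 6 (reg 10 * reg 6 + reg 9) + read 6 (reg 10 * reg 6 + reg 10))))]

/-- Finds the best edge that is not selected yet, and stores it in register `16`. -/
def selectEdge : Prog := block [
  assign 17 1,
  assign 18 0,
  forLoop 21 (reg 5) (ite (read 5 (reg 21)) skip (block [
    evalEdge,
    ite (reg 20)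
      (ite (reg 17 * reg 20 - reg 19 * reg 18)
        (block [assign 16 (reg 21), assign 17 (reg 19), assign 18 (reg 20)]) skip)
      skip]))]

/-- The greedy selection. -/
def greedy : Prog := forLoop 7 (reg 4) (block [buildAdj, selectEdge, write 5 (reg 16) 1])

namespace EdgeSystem

variable {I : EdgeSystem} {b m t : ℕ} {T : Finset ℕ}

theorem U_dotProduct {e : ℕ} (he : e < I.l) (f : Fin I.W → ℤ) :
    I.U e ⬝ᵥ f = f ⟨I.X e, I.X_lt e he⟩ + f ⟨I.Y e, I.Y_lt e he⟩ :=
  pairVec_dotProduct (R := ℤ) (I.X_lt e he) (I.Y_lt e he) f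

theorem mulVec_U {e : ℕ} (he : e < I.l) (P : Matrix (Fin I.W) (Fin I.W) ℤ) (a : Fin I.W) :
    (P *ᵥ I.U e) a = P a ⟨I.X e, I.X_lt e he⟩ + P a ⟨I.Y e, I.Y_lt e he⟩ := by
  rw [mulVec, dotProduct_comm, U_dotProduct he]

theorem abs_mulVec_U_le (ht : t < I.k) (hI : I.Inv t T) {e : ℕ} (he : e < I.l) (a : Fin I.W) :
    |((I.B (t + 1) T).adjugate *ᵥ I.U e) a| ≤ 2 * I.cap := by
  have h1 := I.abs_adjugate_part_le (T := T) ht le_rfl a ⟨I.X e, I.X_lt e he⟩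
  have h2 := I.abs_adjugate_part_le (T := T) ht le_rfl a ⟨I.Y e, I.Y_lt e he⟩
  rw [I.part_end t hI.1] at h1 h2
  rw [mulVec_U he]
  refine (abs_add_le _ _).trans ?_
  linarith

theorem abs_den_le (ht : t < I.k) (hI : I.Inv t T) {e : ℕ} (he : e < I.l) :
    |I.den (I.B (t + 1) T) e| ≤ 9 * (I.l : ℤ) ^ 3 * I.cap := by
  have h0 := I.abs_det_part_le (T := T) ht le_rfl
  rw [I.part_end t hI.1] at h0
  have h1 := abs_mulVec_U_le ht hI he ⟨I.X e, I.X_lt e he⟩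
  have h2 := abs_mulVec_U_le ht hI he ⟨I.Y e, I.Y_lt e he⟩
  have hk := I.k_lt
  have hh := I.h_le
  have hl : (1 : ℤ) ≤ I.l := by have := I.l_pos; omega
  have hh' : (I.h : ℤ) ≤ I.l := by omega
  have hc := I.one_le_cap
  have hg : I.g ≤ 2 * (I.l : ℤ) ^ 3 := by
    have : 2 * (I.h : ℤ) * I.l ^ 2 ≤ 2 * I.l * I.l ^ 2 := by gcongr
    unfold g; linarith
  have hg0 := I.g_pos
  rw [den, U_dotProduct he]
  refine (abs_sub _ _).trans ?_
  rw [abs_mul, abs_of_pos hg0]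
  have h3 := (abs_add_le (((I.B (t + 1) T).adjugate *ᵥ I.U e) ⟨I.X e, I.X_lt e he⟩)
    (((I.B (t + 1) T).adjugate *ᵥ I.U e) ⟨I.Y e, I.Y_lt e he⟩)).trans (add_le_add h1 h2)
  have h4 := mul_le_mul hg h3 (abs_nonneg _) (by positivity)
  have h5 : I.cap ≤ (I.l : ℤ) ^ 3 * I.cap :=
    le_mul_of_one_le_left (by linarith) (one_le_pow₀ hl)
  linarith

theorem runs_evalEdge (hb : 1 ≤ b) (hfit : I.Fits b) (hm : I.W ≤ m) (ht : t < I.k)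
    (hI : I.Inv t T) {σ : Memory} (hσ : Bounded b σ) (hS : I.Stored σ)
    (hd : σ.reg 13 = (I.B (t + 1) T).det) (hL : Lists (I.B (t + 1) T).adjugate σ) {e : ℕ}
    (he : e < I.l) (h21 : σ.reg 21 = e) :
    Runs b m evalEdge σ fun τ => τ.reg 19 = I.num (I.B (t + 1) T) e ∧
      τ.reg 20 = I.den (I.B (t + 1) T) e := by
  have hW := I.W_le
  have hk := I.k_lt
  have hl : (1 : ℤ) ≤ I.l := by have := I.l_pos; omega
  have bW : ∀ x : ℕ, x ≤ I.W → (x : ℤ) ≤ 2 ^ b := fun x hx =>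
    hfit.le (c := 1) (i := 1) (j := 0) (by norm_num) (by norm_num) (by norm_num) (by simp; omega)
  have bX : |((I.X e : ℕ) : ℤ)| ≤ 2 ^ b := by
    rw [abs_of_nonneg (by positivity)]; exact bW _ (I.X_lt e he).le
  have bY : |((I.Y e : ℕ) : ℤ)| ≤ 2 ^ b := by
    rw [abs_of_nonneg (by positivity)]; exact bW _ (I.Y_lt e he).le
  set P := (I.B (t + 1) T).adjugate with hP
  set w : ℕ → ℤ := fun a => if h : a < I.W then I.dN a * ((P *ᵥ I.U e) ⟨a, h⟩) ^ 2 else 0 with hw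
  have hw0 : ∀ a, 0 ≤ w a := by
    intro a
    simp only [hw]
    split_ifs with h
    · have := I.one_le_dN a
      positivity
    · rfl
  have hwle : ∀ a, w a ≤ 3 * I.l * (2 * I.cap) ^ 2 := by
    intro a
    simp only [hw]
    split_ifs with h
    · have h1 := I.dN_le a
      have h2 := abs_mulVec_U_le ht hI he ⟨a, h⟩
      have h3 : ((P *ᵥ I.U e) ⟨a, h⟩) ^ 2 ≤ (2 * I.cap) ^ 2 := by
        rw [← sq_abs]
        exact pow_le_pow_left₀ (abs_nonneg _) h2 2
      have := I.one_le_dN a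
      gcongr
    · positivity
  have hnum : I.num (I.B (t + 1) T) e = ∑ a ∈ Finset.range I.W, w a := by
    rw [num, ← Fin.sum_univ_eq_sum_range]
    exact Finset.sum_congr rfl fun a _ => by simp [hw, a.2, d_eq, P]
  -- The accumulator is stored after every iteration, so all partial sums need a bound, not only the
  -- final one.
  have hsum : ∀ j ≤ I.W, |∑ a ∈ Finset.range j, w a| ≤ 2 ^ b := by
    intro j hj
    rw [abs_of_nonneg (Finset.sum_nonneg fun a _ => hw0 a)]
    refine hfit.le (c := 12) (i := 2) (j := 2) (by norm_num) (by norm_num) (by norm_num) ?_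
    refine (Finset.sum_le_sum fun a _ => hwle a).trans ?_
    rw [Finset.sum_const, Finset.card_range, nsmul_eq_mul]
    have : (j : ℤ) ≤ I.l := by omega
    calc (j : ℤ) * (3 * I.l * (2 * I.cap) ^ 2) ≤ I.l * (3 * I.l * (2 * I.cap) ^ 2) := by gcongr
      _ = _ := by ring
  refine Runs.assign_seq hb hσ (I.X e) (by simp [h21, hS.X e he]) bX fun hσ1 => ?_
  refine Runs.assign_seq hb hσ1 (I.Y e) (by simp [h21, hS.Y e he]) bY fun hσ2 => ?_
  refine Runs.assign_seq hb hσ2 0 rfl (by simp) fun hσ3 => ?_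
  refine Runs.seq (Runs.forLoop hb hσ3 I.W hm (bW _ le_rfl) rfl
    (fun j τ => τ.reg 19 = ∑ a ∈ Finset.range j, w a) ?_ (by simp) ?_ fun τ _ _ h => h)
    fun τ hτ hF h19 => ?_
  · intro j τ hF _
    simp [hF.reg 6 rfl, hS.W]
  · intro j hj τ hτ hF hi h19
    refine Runs.assign hb hτ (v := ∑ a ∈ Finset.range (j + 1), w a) ?_ (hsum _ hj) (by simp)
    have e6 : τ.reg 6 = I.W := by rw [hF.reg 6 rfl]; simp [hS.W]
    have e9 : τ.reg 9 = I.X e := by rw [hF.reg 9 rfl]; simp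
    have e10 : τ.reg 10 = I.Y e := by rw [hF.reg 10 rfl]; simp
    have a4 : τ.arr 4 = σ.arr 4 := by rw [hF.arr 4 rfl]; rfl
    have a6 : τ.arr 6 = σ.arr 6 := by rw [hF.arr 6 rfl]; rfl
    rw [Finset.sum_range_succ]
    simp only [eval_add, eval_mul, eval_read, eval_reg, h19, hi, e6, e9, e10, a4, a6, toNat_mul_add,
      Int.toNat_natCast, hS.D j hj, hw, dif_pos hj]
    rw [mulVec_U he, ← hL.apply, ← hL.apply]
    simp only
    ring
  · have e3 : τ.reg 3 = I.h := by rw [hF.reg 3 rfl]; simp [hS.h]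
    have e5 : τ.reg 5 = I.l := by rw [hF.reg 5 rfl]; simp [hS.l]
    have e6 : τ.reg 6 = I.W := by rw [hF.reg 6 rfl]; simp [hS.W]
    have e9 : τ.reg 9 = I.X e := by rw [hF.reg 9 rfl]; simp
    have e10 : τ.reg 10 = I.Y e := by rw [hF.reg 10 rfl]; simp
    have e13 : τ.reg 13 = (I.B (t + 1) T).det := by rw [hF.reg 13 rfl]; simp [hd]
    have a6 : τ.arr 6 = σ.arr 6 := by rw [hF.arr 6 rfl]; rfl
    refine Runs.assign_seq hb hτ (I.den (I.B (t + 1) T) e) ?_ ?_ fun hτ1 => ?_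
    · have x1 := hL.apply ⟨I.X e, I.X_lt e he⟩ ⟨I.X e, I.X_lt e he⟩
      have x2 := hL.apply ⟨I.X e, I.X_lt e he⟩ ⟨I.Y e, I.Y_lt e he⟩
      have x3 := hL.apply ⟨I.Y e, I.Y_lt e he⟩ ⟨I.X e, I.X_lt e he⟩
      have x4 := hL.apply ⟨I.Y e, I.Y_lt e he⟩ ⟨I.Y e, I.Y_lt e he⟩
      simp only at x1 x2 x3 x4
      simp only [eval_sub, eval_add, eval_mul, eval_read, eval_reg, eval_ofNat, e3, e5, e6, e9, e10,
        e13, a6, toNat_mul_add, x1, x2, x3, x4]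
      rw [den, U_dotProduct he, mulVec_U he, mulVec_U he, g]
      ring
    · exact hfit.le (c := 9) (i := 3) (j := 1) (by norm_num) (by norm_num) (by norm_num)
        (by simpa using abs_den_le ht hI he)
    · refine Runs.skip hb hτ1 ⟨?_, by simp⟩
      simp [h19, hnum]

theorem runs_selectEdge (hb : 1 ≤ b) (hfit : I.Fits b) (hm : I.l ≤ m) (ht : t < I.k)
    (hI : I.Inv t T) {σ : Memory} (hσ : Bounded b σ) (hS : I.Stored σ) (hT : I.Selected T σ)
    (hd : σ.reg 13 = (I.B (t + 1) T).det) (hL : Lists (I.B (t + 1) T).adjugate σ) :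
    Runs b m selectEdge σ fun τ => ∃ e, τ.reg 16 = (e : ℕ) ∧ e < I.l ∧ e ∉ T ∧
      I.Inv (t + 1) (insert e T) := by
  have hW := I.W_le
  have hk := I.k_lt
  have bl : ((I.l : ℕ) : ℤ) ≤ 2 ^ b :=
    hfit.le (c := 1) (i := 1) (j := 0) (by norm_num) (by norm_num) (by norm_num) (by simp)
  set num := I.num (I.B (t + 1) T) with hnum
  set den := I.den (I.B (t + 1) T) with hden
  -- The initial best value is the fraction `1 / 0`, playing the role of infinity: the first
  -- candidate with positive denominator always beats it.
  refine Runs.assign_seq hb hσ 1 rfl (by rw [abs_one]; exact one_le_pow₀ (by norm_num)) fun hσ1 => ?_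
  refine Runs.assign_seq hb hσ1 0 rfl (by simp) fun hσ2 => ?_
  refine Runs.seq (R := fun τ => ∃ e, τ.reg 16 = (e : ℕ) ∧ e < I.l ∧ e ∉ T ∧
      I.Inv (t + 1) (insert e T)) (Runs.forLoop hb hσ2 I.l hm bl rfl
    (fun j τ => (τ.reg 17 = 1 ∧ τ.reg 18 = 0 ∧ ∀ f < j, f ∉ T → ¬ 0 < den f) ∨
      ∃ e < j, e ∉ T ∧ τ.reg 16 = e ∧ τ.reg 17 = num e ∧ τ.reg 18 = den e ∧ 0 < den e ∧
        ∀ f < j, f ∉ T → 0 < den f → num e * den f ≤ num f * den e) ?_ ?_ ?_ ?_)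
    fun τ hτ _ h => Runs.skip hb hτ h
  · intro j τ hF _
    simp [hF.reg 5 rfl, hS.l]
  · left; simp
  · intro j hj τ hτ hF h21 hInv
    have hSτ : I.Stored τ := hS.congr (hF.reg 3 rfl) (hF.reg 4 rfl) (hF.reg 5 rfl)
      (hF.reg 6 rfl) (hF.arr 2 rfl) (hF.arr 3 rfl) (hF.arr 4 rfl)
    have hTτ : I.Selected T τ := by
      intro e he; rw [hF.arr 5 rfl]; exact hT e he
    refine Runs.ite hb hτ (fun h => ?_) (fun h => ?_)
    · have hjT : j ∈ T := by
        by_contra hjT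
        simp [h21, hTτ j hj, hjT] at h
      refine Runs.skip hb hτ ?_
      have aux : ∀ f < j + 1, f ∉ T → f < j := by
        intro f hf hfT
        rcases Nat.lt_succ_iff_lt_or_eq.1 hf with h | h
        · exact h
        · exact absurd (h ▸ hjT) hfT
      simp only [Memory.reg_setReg]
      rcases hInv with ⟨h1, h2, h3⟩ | ⟨e, h0, h1, h2, h3, h4, h5, h6⟩
      · exact Or.inl ⟨h1, h2, fun f hf hfT => h3 f (aux f hf hfT) hfT⟩
      · exact Or.inr ⟨e, by omega, h1, h2, h3, h4, h5, fun f hf hfT => h6 f (aux f hf hfT) hfT⟩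
    have hjT : j ∉ T := by
      intro hjT
      simp [h21, hTτ j hj, hjT] at h
    refine Runs.seq (runs_evalEdge hb hfit (by omega) ht hI hτ hSτ (by rw [hF.reg 13 rfl]; simp [hd])
      (fun p hp => by rw [hF.arr 6 rfl]; exact hL p hp) hj h21) ?_
    rintro ρ hρ hG ⟨h19, h20⟩
    change ρ.reg 19 = num j at h19
    change ρ.reg 20 = den j at h20
    rw [← hG.reg 16 rfl, ← hG.reg 17 rfl, ← hG.reg 18 rfl] at hInv
    have g21 : ρ.reg 21 = j := by rw [hG.reg 21 rfl, h21]
    have split : ∀ f < j + 1, f < j ∨ f = j := fun f hf => Nat.lt_succ_iff_lt_or_eq.1 hf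
    refine Runs.seq (R := fun τ =>
      (τ.reg 17 = 1 ∧ τ.reg 18 = 0 ∧ ∀ f < j + 1, f ∉ T → ¬ 0 < den f) ∨
      ∃ e < j + 1, e ∉ T ∧ τ.reg 16 = e ∧ τ.reg 17 = num e ∧ τ.reg 18 = den e ∧ 0 < den e ∧
        ∀ f < j + 1, f ∉ T → 0 < den f → num e * den f ≤ num f * den e) ?_
      fun ω hω _ h => Runs.skip hb hω (by simpa using h)
    refine Runs.ite hb hρ (fun h1 => ?_) (fun h1 => ?_)
    · rw [eval_reg, h20] at h1
      refine Runs.ite hb hρ (fun h2 => ?_) (fun h2 => ?_)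
      · simp only [eval_sub, eval_mul, eval_reg, h19, h20] at h2
        refine Runs.assign_seq hb hρ j (by simp [g21]) ?_ fun hρ1 => ?_
        · rw [abs_of_nonneg (by positivity)]
          have : (j : ℤ) ≤ I.l := by omega
          linarith
        refine Runs.assign_seq hb hρ1 (num j) (by simp [h19]) (by rw [← h19]; exact hρ.reg 19)
          fun hρ2 => ?_
        refine Runs.assign_seq hb hρ2 (den j) (by simp [h20]) (by rw [← h20]; exact hρ.reg 20)
          fun hρ3 => ?_
        refine Runs.skip hb hρ3 (Or.inr ⟨j, by omega, hjT, by simp, by simp, by simp, h1, ?_⟩)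
        intro f hf hfT hf0
        rcases split f hf with hf | rfl
        · rcases hInv with ⟨_, _, h3⟩ | ⟨e, h0, _, _, h17, h18, h5, h6⟩
          · exact absurd hf0 (h3 f hf hfT)
          · have h7 := h6 f hf hfT hf0
            rw [h17, h18] at h2
            -- Transitivity of the comparison of fractions `num j / den j`, `num e / den e`, `num f
            -- / den f`, with the positive factor `den e` to be cancelled.
            have h8 : den e * (num j * den f) ≤ den e * (num f * den j) := by
              have a1 := mul_le_mul_of_nonneg_right (sub_nonneg.1 h2.le) hf0.le
              have a2 := mul_le_mul_of_nonneg_right h7 h1.le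
              linarith
            exact le_of_mul_le_mul_left h8 h5
        · exact le_rfl
      · simp only [eval_sub, eval_mul, eval_reg, h19, h20] at h2
        refine Runs.skip hb hρ (Or.inr ?_)
        rcases hInv with ⟨h17, h18, _⟩ | ⟨e, h0, h3, h16, h17, h18, h5, h6⟩
        · rw [h17, h18] at h2
          change 1 * den j - _ * 0 ≤ 0 at h2
          change 0 < den j at h1
          omega
        · refine ⟨e, by omega, h3, h16, h17, h18, h5, fun f hf hfT hf0 => ?_⟩
          rcases split f hf with hf | rfl
          · exact h6 f hf hfT hf0
          · rw [h17, h18] at h2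
            exact sub_nonpos.1 h2
    · rw [eval_reg, h20] at h1
      refine Runs.skip hb hρ ?_
      have aux : ∀ f < j + 1, 0 < den f → f < j := by
        intro f hf hf0
        rcases split f hf with hf | rfl
        · exact hf
        · exact absurd hf0 (not_lt.2 h1)
      rcases hInv with ⟨h2, h3, h4⟩ | ⟨e, h0, h3, h16, h17, h18, h5, h6⟩
      · exact Or.inl ⟨h2, h3, fun f hf hfT hf0 => h4 f (aux f hf hf0) hfT hf0⟩
      · exact Or.inr ⟨e, by omega, h3, h16, h17, h18, h5, fun f hf hfT hf0 =>
          h6 f (aux f hf hf0) hfT hf0⟩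
  · rintro τ _ _ (⟨_, _, h3⟩ | ⟨e, h0, h3, h16, _, _, h5, h6⟩)
    · obtain ⟨f, h4, h5, h6⟩ := hI.exists_den_pos ht
      exact absurd h6 (h3 f h4 h5)
    · exact ⟨e, h16, h0, h3, hI.step ht h0 h3 h5 h6⟩

/-- The adjugate is rebuilt from the identity in every round, so the loop invariant only concerns
the selected set. -/
theorem runs_greedy (hb : 1 ≤ b) (hfit : I.Fits b) (hm : I.W * I.W ≤ m)
    (hm' : I.W + I.l + I.l ≤ m) {σ : Memory} (hσ : Bounded b σ) (hS : I.Stored σ)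
    (hT : I.Selected ∅ σ) :
    Runs b m greedy σ fun τ => ∃ T, I.Inv I.k T ∧ I.Selected T τ := by
  have hk := I.k_lt
  refine Runs.forLoop hb hσ I.k (by omega) ?_ rfl (fun t τ => ∃ T, I.Inv t T ∧ I.Selected T τ)
    ?_ ⟨∅, I.inv_zero, hT⟩ ?_ fun _ _ _ h => h
  · exact hfit.le (c := 1) (i := 1) (j := 0) (by norm_num) (by norm_num) (by norm_num)
      (by simp; omega)
  · intro t τ hF _
    rw [eval_reg, hF.reg 4 rfl]
    exact hS.k
  · rintro t ht τ hτ hF h7 ⟨T, hI, hTτ⟩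
    have hSτ : I.Stored τ := hS.congr (hF.reg 3 rfl) (hF.reg 4 rfl) (hF.reg 5 rfl)
      (hF.reg 6 rfl) (hF.arr 2 rfl) (hF.arr 3 rfl) (hF.arr 4 rfl)
    refine Runs.seq (runs_buildAdj hb hfit hm hm' ht hI hτ hSτ hTτ h7) ?_
    rintro ρ hρ hG ⟨h13, hL⟩
    have hSρ : I.Stored ρ := hSτ.congr (hG.reg 3 rfl) (hG.reg 4 rfl) (hG.reg 5 rfl)
      (hG.reg 6 rfl) (hG.arr 2 rfl) (hG.arr 3 rfl) (hG.arr 4 rfl)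
    have hTρ : I.Selected T ρ := by
      intro e he; rw [hG.arr 5 rfl]; exact hTτ e he
    refine Runs.seq (runs_selectEdge hb hfit (by omega) ht hI hρ hSρ hTρ h13 hL) ?_
    rintro ω hω hH ⟨e, h16, he, heT, hInv⟩
    refine Runs.write_seq hb hω e 1 (by simp [h16]) rfl
      (by rw [abs_one]; exact one_le_pow₀ (by norm_num)) fun hω1 => ?_
    refine Runs.skip hb hω1 ⟨insert e T, hInv, fun f hf => ?_⟩
    rw [Memory.arr_setReg, Memory.arr_setArr]
    by_cases hfe : f = e
    · simp [hfe]
    · rw [if_neg (by simp [hfe]), hH.arr 5 rfl, hTρ f hf]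
      simp [hfe]

end EdgeSystem

end AdditiveSparsifier

/-! ### Reading the graph, writing the output, and the complete program -/

namespace AdditiveSparsifier

open Matrix AdditiveSparsifier.Expr Prog

/-- Lists the edges of the graph in arrays `2` and `3`, counts them in register `5`, and increases
the cells of array `4` by the degrees. -/
def listEdges : Prog := forLoop 15 (reg 0 * reg 0) (block [
  assign 22 (reg 15 / reg 0),
  assign 23 (reg 15 - reg 0 * (reg 15 / reg 0)),
  ite (read 0 (reg 15) * (reg 23 - reg 22))
    (block [
      write 2 (reg 5) (reg 22),
      write 3 (reg 5) (reg 0 + reg 23),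
      write 4 (reg 22) (read 4 (reg 22) + 1),
      write 4 (reg 0 + reg 23) (read 4 (reg 0 + reg 23) + 1),
      assign 5 (reg 5 + 1)])
    skip])

/-- Writes the indicator of the selected edges to array `1`. -/
def writeOutput : Prog := forLoop 21 (reg 5) (ite (read 5 (reg 21))
  (block [
    assign 22 (read 2 (reg 21)),
    assign 23 (read 3 (reg 21) - reg 0),
    write 1 (reg 22 * reg 0 + reg 23) 1,
    write 1 (reg 23 * reg 0 + reg 22) 1])
  skip)

/-- One plus the degree of `a`, when the edges are `{X e, Y e}` for `e < l`. -/
def degSum (l : ℕ) (X Y : ℕ → ℕ) (a : ℕ) : ℤ :=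
  1 + ∑ e ∈ Finset.range l, ((if X e = a then 1 else 0) + (if Y e = a then 1 else 0))

theorem one_le_degSum (l : ℕ) (X Y : ℕ → ℕ) (a : ℕ) : 1 ≤ degSum l X Y a := by
  have : 0 ≤ ∑ e ∈ Finset.range l, ((if X e = a then (1 : ℤ) else 0) +
      (if Y e = a then 1 else 0)) := Finset.sum_nonneg fun e _ => by positivity
  unfold degSum; omega

theorem degSum_le (l : ℕ) (X Y : ℕ → ℕ) (a : ℕ) : degSum l X Y a ≤ 1 + 2 * l := by
  have : ∑ e ∈ Finset.range l, ((if X e = a then (1 : ℤ) else 0) +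
      (if Y e = a then 1 else 0)) ≤ ∑ e ∈ Finset.range l, 2 :=
    Finset.sum_le_sum fun e _ => by split_ifs <;> norm_num
  rw [Finset.sum_const, Finset.card_range, nsmul_eq_mul] at this
  unfold degSum; omega

variable {n : ℕ}

theorem index_inj {i j i' j' : Fin n} (h : (i : ℕ) * n + j = i' * n + j') : i = i' ∧ j = j' := by
  have hn : 0 < n := lt_of_le_of_lt (Nat.zero_le _) i.2
  have h1 := congrArg (· / n) h
  have h2 := congrArg (· % n) h
  simp only [mul_comm _ n, Nat.mul_add_div hn, Nat.mul_add_mod, Nat.div_eq_of_lt j.2,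
    Nat.div_eq_of_lt j'.2, Nat.mod_eq_of_lt j.2, Nat.mod_eq_of_lt j'.2, add_zero] at h1 h2
  exact ⟨Fin.ext h1, Fin.ext h2⟩

/-- The memory after the adjacency matrix has been scanned up to position `p`. -/
structure Scanned (G : SimpleGraph (Fin n)) (p l : ℕ) (X Y : ℕ → ℕ) (σ : Memory) : Prop where
  count : σ.reg 5 = l
  le : l ≤ p
  arrX : ∀ e < l, σ.arr 2 e = X e
  arrY : ∀ e < l, σ.arr 3 e = Y e
  deg : ∀ a < 2 * n, σ.arr 4 a = degSum l X Y a
  edge : ∀ e < l, ∃ i j : Fin n, i < j ∧ G.Adj i j ∧ X e = i ∧ Y e = n + j ∧ (i : ℕ) * n + j < p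
  inj : ∀ e < l, ∀ f < l, X e = X f → Y e = Y f → e = f
  surj : ∀ i j : Fin n, i < j → G.Adj i j → (i : ℕ) * n + j < p → ∃ e < l, X e = i ∧ Y e = n + j

theorem Scanned.isEdgeList {G : SimpleGraph (Fin n)} {l : ℕ} {X Y : ℕ → ℕ} {σ : Memory}
    (h : Scanned G (n * n) l X Y σ) : IsEdgeList G l X Y := by
  refine ⟨fun e he => ?_, h.inj, fun i j hij hG => h.surj i j hij hG (flat_index_lt i j)⟩
  obtain ⟨i, j, h1, h2, h3, h4, -⟩ := h.edge e he
  exact ⟨i, j, h1, h2, h3, h4⟩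

theorem degSum_update (l : ℕ) (X Y : ℕ → ℕ) (x y a : ℕ) :
    degSum (l + 1) (Function.update X l x) (Function.update Y l y) a =
      degSum l X Y a + ((if x = a then 1 else 0) + (if y = a then 1 else 0)) := by
  rw [degSum, Finset.sum_range_succ, degSum, Function.update_self, Function.update_self, ← add_assoc]
  congr 2
  refine Finset.sum_congr rfl fun e he => ?_
  have : e ≠ l := (Finset.mem_range.1 he).ne
  rw [Function.update_of_ne this, Function.update_of_ne this]

open Classical in
-- Scans the adjacency matrix by position `p = i n + j`. The invariant describes the edges at
-- positions below `p`, and the degree counts are kept up to date with each new edge.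
theorem runs_listEdges {b m : ℕ} (hb : 1 ≤ b) (hm : n * n ≤ m)
    (hnb : 4 * ((n : ℤ) * n) + 4 ≤ 2 ^ b) {G : SimpleGraph (Fin n)} {σ : Memory}
    (hσ : Bounded b σ) (h0 : σ.reg 0 = n) (h5 : σ.reg 5 = 0)
    (hA : ∀ i j : Fin n, σ.arr 0 (i * n + j) = if G.Adj i j then 1 else 0)
    (hD : ∀ a < 2 * n, σ.arr 4 a = 1) :
    Runs b m listEdges σ fun τ => ∃ l X Y, Scanned G (n * n) l X Y τ := by
  refine Runs.forLoop hb hσ (n * n) hm (by push_cast; nlinarith) rfl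
    (fun p τ => ∃ l X Y, Scanned G p l X Y τ) ?_ ?_ ?_ fun _ _ _ h => h
  · intro p τ hF _
    simp [hF.reg 0 rfl, h0]
  · refine ⟨0, fun _ => 0, fun _ => 0, ?_⟩
    constructor <;> simp [h5, degSum]
    exact hD
  · rintro p hp τ hτ hF hi ⟨l, X, Y, hS⟩
    have hn : 0 < n := Nat.pos_of_mul_pos_left (Nat.zero_lt_of_lt hp)
    obtain ⟨i, j, rfl⟩ : ∃ i j : Fin n, p = i * n + j :=
      ⟨⟨p / n, Nat.div_lt_of_lt_mul hp⟩, ⟨p % n, Nat.mod_lt _ hn⟩, (Nat.div_add_mod' p n).symm⟩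
    have e0 : τ.reg 0 = n := by rw [hF.reg 0 rfl, h0]
    have eA : τ.arr 0 (i * n + j) = if G.Adj i j then 1 else 0 := by rw [hF.arr 0 rfl, hA]
    have hi' : (i : ℤ) < n := by have := i.2; omega
    have hj' : (j : ℤ) < n := by have := j.2; omega
    have hnn : (n : ℤ) ≤ n * n := by
      have : (0 : ℤ) < n := by omega
      nlinarith
    have hpl : (l : ℤ) < n * n := by
      have := hS.le
      have : l < n * n := by omega
      exact_mod_cast this
    have ediv : ((i * n + j : ℕ) : ℤ) / n = i := by
      rw [← Int.natCast_div, mul_comm, Nat.mul_add_div hn, Nat.div_eq_of_lt j.2, add_zero]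
    have emod : ((i * n + j : ℕ) : ℤ) - n * i = j := by push_cast; ring
    refine Runs.assign_seq hb hτ i (by simp only [eval_div, eval_reg, hi, e0, ediv]) ?_ fun hτ1 => ?_
    · rw [abs_of_nonneg (by positivity)]; linarith
    refine Runs.assign_seq hb hτ1 j ?_ ?_ fun hτ2 => ?_
    · simp only [eval_sub, eval_mul, eval_div, eval_reg, Memory.reg_setReg,
        show ((15 : ℕ) = 22) = False by decide, show ((0 : ℕ) = 22) = False by decide,
        if_false, hi, e0, ediv, emod]
    · rw [abs_of_nonneg (by positivity)]; linarith
    set ρ := (τ.setReg 22 (i : ℕ)).setReg 23 (j : ℕ) with hρ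
    have r0 : ρ.reg 0 = n := by simp [hρ, e0]
    have r5 : ρ.reg 5 = l := by simp [hρ, hS.count]
    have r15 : ρ.reg 15 = ((i * n + j : ℕ) : ℤ) := by simp only [hρ, Memory.reg_setReg]; simpa using hi
    have r22 : ρ.reg 22 = (i : ℕ) := by simp [hρ]
    have r23 : ρ.reg 23 = (j : ℕ) := by simp [hρ]
    have rarr : ρ.arr = τ.arr := rfl
    -- This product is positive exactly if `i` and `j` are adjacent and `i < j`, so each edge is
    -- listed once although the matrix is symmetric.
    have htest : (Expr.read 0 (reg 15) * (reg 23 - reg 22)).eval ρ =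
        (if G.Adj i j then 1 else 0) * ((j : ℤ) - i) := by
      simp only [eval_mul, eval_read, eval_sub, eval_reg, r15, r22, r23, rarr, Int.toNat_natCast, eA]
    refine Runs.seq (R := fun τ => ∃ l X Y, Scanned G (i * n + j + 1) l X Y τ) ?_
      fun ω hω _ h => Runs.skip hb hω ?_
    swap
    · obtain ⟨l, X, Y, h⟩ := h
      exact ⟨l, X, Y, by simpa using h.count, h.le, h.arrX, h.arrY, h.deg, h.edge, h.inj, h.surj⟩
    refine Runs.ite hb hτ2 (fun ht => ?_) (fun ht => ?_)
    · rw [htest] at ht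
      obtain ⟨hadj, hij⟩ : G.Adj i j ∧ i < j := by
        by_cases h : G.Adj i j
        · rw [if_pos h, one_mul] at ht
          exact ⟨h, Fin.lt_def.2 (by omega)⟩
        · rw [if_neg h, zero_mul] at ht
          exact absurd ht (lt_irrefl _)
      have hd1 := one_le_degSum l X Y i
      have hd2 := degSum_le l X Y i
      have hd3 := one_le_degSum l X Y (n + j)
      have hd4 := degSum_le l X Y (n + j)
      have hin : (i : ℕ) < 2 * n := by have := i.2; omega
      have hjn : n + (j : ℕ) < 2 * n := by have := j.2; omega
      have hne : (i : ℕ) ≠ n + j := by have := i.2; omega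
      refine Runs.write_seq hb hτ2 l i (by simp [r5]) (by simp [r22]) ?_ fun hτ3 => ?_
      · rw [abs_of_nonneg (by positivity)]; linarith
      refine Runs.write_seq hb hτ3 l ((n + j : ℕ) : ℤ) (by simp [r5]) (by simp [r0, r23]) ?_
        fun hτ4 => ?_
      · rw [abs_of_nonneg (by positivity)]; push_cast; linarith
      refine Runs.write_seq hb hτ4 i (degSum l X Y i + 1) (by simp [r22]) ?_ ?_ fun hτ5 => ?_
      · simp [r22, Memory.arr_setArr, rarr, hS.deg _ hin]
      · rw [abs_of_nonneg (by linarith)]; linarith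
      refine Runs.write_seq hb hτ5 (n + j) (degSum l X Y (n + j) + 1) (by simp [r0, r23]) ?_ ?_
        fun hτ6 => ?_
      · have e1 : ((n : ℤ) + (j : ℕ)).toNat = n + j := by omega
        simp [r0, r23, e1, Memory.arr_setArr, rarr, hS.deg _ hjn, hne.symm]
      · rw [abs_of_nonneg (by linarith)]; linarith
      refine Runs.assign_seq hb hτ6 ((l + 1 : ℕ) : ℤ) (by simp [r5]) ?_ fun hτ7 => ?_
      · rw [abs_of_nonneg (by positivity)]; push_cast; linarith
      refine Runs.skip hb hτ7 ⟨l + 1, Function.update X l i, Function.update Y l (n + j), ?_⟩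
      constructor
      · simp
      · have := hS.le; omega
      · intro e he
        rcases Nat.lt_succ_iff_lt_or_eq.1 he with he | rfl
        · simp [Memory.arr_setArr, he.ne, rarr, hS.arrX e he]
        · simp [Memory.arr_setArr]
      · intro e he
        rcases Nat.lt_succ_iff_lt_or_eq.1 he with he | rfl
        · simp [Memory.arr_setArr, he.ne, rarr, hS.arrY e he]
        · simp [Memory.arr_setArr]
      · intro a ha
        rw [degSum_update]
        by_cases h1 : (i : ℕ) = a
        · subst h1
          simp [Memory.arr_setArr, hne, hne.symm]
        · by_cases h2 : n + (j : ℕ) = a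
          · subst h2
            simp [Memory.arr_setArr, hne]
          · simp [Memory.arr_setArr, h1, h2, Ne.symm h1, Ne.symm h2, rarr, hS.deg a ha]
      · intro e he
        rcases Nat.lt_succ_iff_lt_or_eq.1 he with he | rfl
        · obtain ⟨i', j', g1, g2, g3, g4, g5⟩ := hS.edge e he
          exact ⟨i', j', g1, g2, by simp [he.ne, g3], by simp [he.ne, g4], by omega⟩
        · exact ⟨i, j, hij, hadj, by simp, by simp, by omega⟩
      -- Edges listed earlier come from smaller matrix positions, so the new pair cannot repeat one
      -- of them.
      · have hnew : ∀ e < l, X e = i → Y e = n + j → False := by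
          intro e he g1 g2
          obtain ⟨i', j', _, _, g3, g4, g5⟩ := hS.edge e he
          have : (i' : ℕ) = i := by omega
          have : (j' : ℕ) = j := by omega
          simp_all
        intro e he f hf
        rcases Nat.lt_succ_iff_lt_or_eq.1 he with he | rfl <;>
          rcases Nat.lt_succ_iff_lt_or_eq.1 hf with hf | rfl
        · simpa [he.ne, hf.ne] using hS.inj e he f hf
        · intro g1 g2
          simp only [Function.update_of_ne he.ne, Function.update_self] at g1 g2
          exact (hnew e he g1 g2).elim
        · intro g1 g2
          simp only [Function.update_of_ne hf.ne, Function.update_self] at g1 g2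
          exact (hnew f hf g1.symm g2.symm).elim
        · intros; rfl
      · intro i' j' hij' hG' hlt
        by_cases h : (i' : ℕ) * n + j' = i * n + j
        · obtain ⟨rfl, rfl⟩ := index_inj h
          exact ⟨l, Nat.lt_succ_self l, by simp, by simp⟩
        · obtain ⟨e, he, g1, g2⟩ := hS.surj i' j' hij' hG' (by omega)
          exact ⟨e, by omega, by simp [he.ne, g1], by simp [he.ne, g2]⟩
    · rw [htest] at ht
      have hnot : ¬ (G.Adj i j ∧ i < j) := by
        rintro ⟨h1, h2⟩
        rw [if_pos h1, one_mul] at ht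
        have := Fin.lt_def.1 h2
        omega
      refine Runs.skip hb hτ2 ⟨l, X, Y, r5, ?_, hS.arrX, hS.arrY, hS.deg, ?_, hS.inj, ?_⟩
      · have := hS.le; omega
      · intro e he
        obtain ⟨i', j', g1, g2, g3, g4, g5⟩ := hS.edge e he
        exact ⟨i', j', g1, g2, g3, g4, by omega⟩
      · intro i' j' hij' hG' hlt
        by_cases h : (i' : ℕ) * n + j' = i * n + j
        · obtain ⟨rfl, rfl⟩ := index_inj h
          exact absurd ⟨hG', hij'⟩ hnot
        · exact hS.surj i' j' hij' hG' (by omega)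

theorem mem_listedEdges_insert {G : SimpleGraph (Fin n)} {l : ℕ} {X Y : ℕ → ℕ}
    (hE : IsEdgeList G l X Y) {T : Finset ℕ} (hT : T ⊆ Finset.range l) {e : ℕ} (he : e < l)
    {p q : Fin n} (hp : X e = p) (hq : Y e = n + q) (i j : Fin n) :
    s(i, j) ∈ listedEdges n X Y (insert e T) ↔
      (i = p ∧ j = q) ∨ (i = q ∧ j = p) ∨ s(i, j) ∈ listedEdges n X Y T := by
  have hpair : ∀ i j : Fin n, (i, j) ∈ listedPairs n X Y (insert e T) ↔
      (i = p ∧ j = q) ∨ (i, j) ∈ listedPairs n X Y T := by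
    intro i j
    rw [mem_listedPairs, mem_listedPairs]
    constructor
    · rintro ⟨f, hf, g1, g2⟩
      rcases Finset.mem_insert.1 hf with rfl | hf
      · exact Or.inl ⟨Fin.ext (by simp only at g1; omega), Fin.ext (by simp only at g2; omega)⟩
      · exact Or.inr ⟨f, hf, g1, g2⟩
    · rintro (⟨rfl, rfl⟩ | ⟨f, hf, g⟩)
      · exact ⟨e, Finset.mem_insert_self _ _, hp, hq⟩
      · exact ⟨f, Finset.mem_insert_of_mem hf, g⟩
  rw [hE.mem_listedEdges (Finset.insert_subset (Finset.mem_range.2 he) hT), hE.mem_listedEdges hT,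
    hpair, hpair]
  tauto

/-- Each selected edge is entered at both symmetric positions; the zeros of the output are those of
an array `1` that has not been touched before. -/
theorem runs_writeOutput {b m : ℕ} (hb : 1 ≤ b) {G : SimpleGraph (Fin n)} {l : ℕ} {X Y : ℕ → ℕ}
    (hE : IsEdgeList G l X Y) {T : Finset ℕ} (hT : T ⊆ Finset.range l) (hm : l ≤ m) {σ : Memory}
    (hσ : Bounded b σ) (h0 : σ.reg 0 = n) (h5 : σ.reg 5 = l)
    (hX : ∀ e < l, σ.arr 2 e = X e) (hY : ∀ e < l, σ.arr 3 e = Y e)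
    (hC : ∀ e < l, σ.arr 5 e = if e ∈ T then 1 else 0) (h1 : ∀ p, σ.arr 1 p = 0) :
    Runs b m writeOutput σ fun τ => IsOutput τ (listedEdges n X Y T) := by
  have hlb : (l : ℤ) ≤ 2 ^ b := by
    have := hσ.reg 5
    rw [h5] at this
    exact (le_abs_self _).trans this
  have hn : (n : ℤ) ≤ 2 ^ b := by
    have := hσ.reg 0
    rw [h0] at this
    exact (le_abs_self _).trans this
  have hone : |(1 : ℤ)| ≤ 2 ^ b := by rw [abs_one]; exact one_le_pow₀ (by norm_num)
  refine Runs.forLoop hb hσ l hm hlb rfl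
    (fun j τ => IsOutput τ (listedEdges n X Y (T.filter (· < j)))) ?_ ?_ ?_ ?_
  · intro j τ hF _
    rw [eval_reg, hF.reg 5 rfl, h5]
  · intro i j
    rw [Memory.arr_setReg, h1, if_neg]
    simp [listedEdges, mem_listedPairs]
  · intro e he τ hτ hF hi hI
    have eX : τ.arr 2 e = X e := by rw [hF.arr 2 rfl, hX e he]
    have eY : τ.arr 3 e = Y e := by rw [hF.arr 3 rfl, hY e he]
    have eC : τ.arr 5 e = if e ∈ T then 1 else 0 := by rw [hF.arr 5 rfl, hC e he]
    have e0 : τ.reg 0 = n := by rw [hF.reg 0 rfl, h0]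
    refine Runs.ite hb hτ (fun ht => ?_) (fun ht => ?_)
    · have heT : e ∈ T := by
        by_contra h
        simp [hi, eC, h] at ht
      obtain ⟨p, q, -, -, hp, hq⟩ := hE.edge e he
      have hfil : T.filter (· < e + 1) = insert e (T.filter (· < e)) := by
        ext f
        simp only [Finset.mem_filter, Finset.mem_insert]
        constructor
        · rintro ⟨h1, h2⟩
          rcases Nat.lt_succ_iff_lt_or_eq.1 h2 with h | h
          · exact Or.inr ⟨h1, h⟩
          · exact Or.inl h
        · rintro (rfl | ⟨h1, h2⟩)
          · exact ⟨heT, Nat.lt_succ_self _⟩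
          · exact ⟨h1, by omega⟩
      have hp' : (p : ℤ) < n := by have := p.2; omega
      have hq' : (q : ℤ) < n := by have := q.2; omega
      refine Runs.assign_seq hb hτ p (by simp [hi, eX, hp]) ?_ fun hτ1 => ?_
      · rw [abs_of_nonneg (by positivity)]; linarith
      refine Runs.assign_seq hb hτ1 q (by simp [hi, eY, hq, e0]) ?_ fun hτ2 => ?_
      · rw [abs_of_nonneg (by positivity)]; linarith
      refine Runs.write_seq hb hτ2 (p * n + q) 1 (by simp [e0]) rfl hone fun hτ3 => ?_
      refine Runs.write_seq hb hτ3 (q * n + p) 1 (by simp [e0]) rfl hone fun hτ4 => ?_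
      refine Runs.skip hb hτ4 fun i j => ?_
      rw [hfil]
      simp only [mem_listedEdges_insert hE ((Finset.filter_subset _ _).trans hT) he hp hq,
        Memory.arr_setReg, Memory.arr_setArr, true_and]
      by_cases g1 : (i : ℕ) * n + j = q * n + p
      · rw [if_pos g1, if_pos (Or.inr (Or.inl (index_inj g1)))]
      by_cases g2 : (i : ℕ) * n + j = p * n + q
      · rw [if_neg g1, if_pos g2, if_pos (Or.inl (index_inj g2))]
      have g3 : ¬ (i = p ∧ j = q) := by rintro ⟨rfl, rfl⟩; exact g2 rfl
      have g4 : ¬ (i = q ∧ j = p) := by rintro ⟨rfl, rfl⟩; exact g1 rfl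
      rw [if_neg g1, if_neg g2, hI i j]
      simp [g3, g4]
    · have heT : e ∉ T := by
        intro h
        simp [hi, eC, h] at ht
      have hfil : T.filter (· < e + 1) = T.filter (· < e) := by
        ext f
        simp only [Finset.mem_filter]
        refine and_congr_right fun h1 => ⟨fun h2 => ?_, fun h2 => by omega⟩
        rcases Nat.lt_succ_iff_lt_or_eq.1 h2 with h | h
        · exact h
        · exact absurd (h ▸ h1) heT
      refine Runs.skip hb hτ ?_
      rw [hfil]
      exact hI
  · intro τ _ _ h
    have hfil : T.filter (· < l) = T := Finset.filter_true_of_mem fun e he => Finset.mem_range.1 (hT he)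
    rwa [hfil] at h

/-- The program that computes the sparsifier. -/
def sparsify : Prog := block [
  assign 3 (reg 2 / reg 1 + 1),
  assign 4 (1024 * reg 0 * reg 3 * reg 3),
  assign 6 (2 * reg 0),
  forLoop 15 (reg 6) (write 4 (reg 15) 1),
  listEdges,
  ite (2 * reg 4 + 1 - reg 5) (forLoop 15 (reg 5) (write 5 (reg 15) 1)) greedy,
  writeOutput]

/-- The properties of the output. -/
def IsSparsifier (G : SimpleGraph (Fin n)) (ε : ℚ) (F : Finset (Sym2 (Fin n))) : Prop :=
  (F : Set (Sym2 (Fin n))) ⊆ G.edgeSet ∧ (G.edgeSet.Nonempty → F.Nonempty) ∧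
    (F.card : ℝ) ≤ 8192 * (n : ℝ) / (min 1 (ε : ℝ)) ^ 2 ∧ SpectralBounds G (ε : ℝ) F

/-- Here `h` is the floor of `1 / ε` plus one. Hence `1 / h ≤ ε`, while `(h - 1) ε ≤ 1` yields `h *
min 1 ε ≤ 2`. Squaring costs a factor `4`, and `8192 = 4 * 2048`. -/
theorem natCast_mul_sq_le {ε : ℚ} (hε : 0 < ε) {h : ℕ} (hh : (h : ℤ) = ε.den / ε.num + 1) (n : ℕ) :
    (2048 * n * h * h : ℝ) ≤ 8192 * (n : ℝ) / (min 1 (ε : ℝ)) ^ 2 ∧ 1 / (h : ℝ) ≤ ε ∧ 0 < h := by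
  have hnum : 0 < ε.num := Rat.num_pos.2 hε
  have hden : (0 : ℤ) < ε.den := by exact_mod_cast ε.den_pos
  have hεR : (0 : ℝ) < ε := by exact_mod_cast hε
  have hnumR : (0 : ℝ) < ε.num := by exact_mod_cast hnum
  have hdenR : (0 : ℝ) < ε.den := by exact_mod_cast ε.den_pos
  have heq : (ε : ℝ) = ε.num / ε.den := by
    conv_lhs => rw [← Rat.num_div_den ε]
    push_cast
    rfl
  have h0 : 0 < h := by
    have : 0 ≤ (ε.den : ℤ) / ε.num := Int.ediv_nonneg hden.le hnum.le
    omega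
  have h0R : (0 : ℝ) < h := by exact_mod_cast h0
  have h1 : (ε.den : ℝ) ≤ h * ε.num := by
    have : (ε.den : ℤ) < (ε.den / ε.num + 1) * ε.num := Int.lt_ediv_add_one_mul_self _ hnum
    rw [← hh] at this
    exact_mod_cast this.le
  have h2 : ((h : ℝ) - 1) * ε.num ≤ ε.den := by
    have h3 : (ε.den : ℤ) / ε.num * ε.num ≤ ε.den := Int.ediv_mul_le _ hnum.ne'
    have h4 : ((ε.den : ℤ) / ε.num) = (h : ℤ) - 1 := by omega
    rw [h4] at h3
    exact_mod_cast h3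
  have hmin : 0 < min 1 (ε : ℝ) := lt_min one_pos hεR
  have h3 : h * min 1 (ε : ℝ) ≤ 2 := by
    have h4 : ((h : ℝ) - 1) * ε ≤ 1 := by
      rw [heq, mul_div_assoc', div_le_one hdenR]
      exact h2
    have h5 : (1 : ℝ) ≤ h := by exact_mod_cast h0
    have h6 : ((h : ℝ) - 1) * min 1 (ε : ℝ) ≤ ((h : ℝ) - 1) * ε :=
      mul_le_mul_of_nonneg_left (min_le_right _ _) (by linarith)
    have h7 := min_le_left 1 (ε : ℝ)
    linarith
  refine ⟨?_, ?_, h0⟩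
  · rw [le_div_iff₀ (by positivity)]
    have h4 : (h * min 1 (ε : ℝ)) ^ 2 ≤ 2 ^ 2 := pow_le_pow_left₀ (by positivity) h3 2
    have h5 : (0 : ℝ) ≤ n := by positivity
    nlinarith
  · rw [div_le_iff₀ h0R, heq, div_mul_eq_mul_div, le_div_iff₀ hdenR]
    linarith

theorem bounded_inputMemory {b : ℕ} {G : SimpleGraph (Fin n)} {ε : ℚ} (hn : (n : ℤ) ≤ 2 ^ b)
    (hnum : |ε.num| ≤ 2 ^ b) (hden : (ε.den : ℤ) ≤ 2 ^ b) : Bounded b (inputMemory G ε) := by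
  constructor
  · intro x
    simp only [inputMemory]
    split_ifs
    · rwa [abs_of_nonneg (by positivity)]
    · exact hnum
    · rwa [abs_of_nonneg (by positivity)]
    · simp
  · intro a i
    simp only [inputMemory]
    split_ifs
    · rw [abs_one]; exact one_le_pow₀ (by norm_num)
    · simp

open Classical in
theorem inputMemory_arr_zero (G : SimpleGraph (Fin n)) (ε : ℚ) (i j : Fin n) :
    (inputMemory G ε).arr 0 (i * n + j) = if G.Adj i j then 1 else 0 := by
  simp only [inputMemory, true_and]
  refine if_congr ⟨?_, fun h => ⟨i, j, rfl, h⟩⟩ rfl rfl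
  rintro ⟨i', j', h, hG⟩
  obtain ⟨rfl, rfl⟩ := index_inj h
  exact hG

theorem runs_sparsify {b m : ℕ} (hb : 1 ≤ b) (G : SimpleGraph (Fin n)) {ε : ℚ} (hε : 0 < ε)
    (hnum : |ε.num| ≤ 2 ^ b) (hden : (ε.den : ℤ) ≤ 2 ^ b)
    (hk : 1024 * (n : ℤ) * (ε.den + 1) * (ε.den + 1) ≤ 2 ^ b)
    (hh : (ε.den : ℤ) + 1 ≤ 2 ^ b)
    (hnb : 4 * ((n : ℤ) * n) + 4 ≤ 2 ^ b) (hm : 4 * (n * n) ≤ m)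
    (hfit : ∀ l : ℕ, l ≤ n * n → 100 * (l : ℤ) ^ 5 * ((73 * (l : ℤ) ^ 5) ^ l) ^ 2 ≤ 2 ^ b) :
    Runs b m sparsify (inputMemory G ε) fun τ => ∃ F, IsOutput τ F ∧ IsSparsifier G ε F := by
  have hnn : n ≤ n * n := Nat.le_mul_self n
  have hnn' : (n : ℤ) ≤ n * n := by exact_mod_cast hnn
  have hσ : Bounded b (inputMemory G ε) := bounded_inputMemory (by linarith) hnum hden
  have r0 : (inputMemory G ε).reg 0 = n := rfl
  have r1 : (inputMemory G ε).reg 1 = ε.num := rfl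
  have r2 : (inputMemory G ε).reg 2 = ε.den := rfl
  have hnum0 : 0 < ε.num := Rat.num_pos.2 hε
  have hone : |(1 : ℤ)| ≤ 2 ^ b := by rw [abs_one]; exact one_le_pow₀ (by norm_num)
  obtain ⟨h, hhdef⟩ : ∃ h : ℕ, (h : ℤ) = ε.den / ε.num + 1 := by
    have : 0 ≤ (ε.den : ℤ) / ε.num := Int.ediv_nonneg (by positivity) hnum0.le
    exact ⟨((ε.den : ℤ) / ε.num + 1).toNat, Int.toNat_of_nonneg (by omega)⟩
  have hhle : (h : ℤ) ≤ ε.den + 1 := by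
    rw [hhdef]
    have := Int.ediv_le_self (a := (ε.den : ℤ)) ε.num (by positivity)
    omega
  obtain ⟨hsize, hhε, hh0⟩ := natCast_mul_sq_le hε hhdef n
  refine Runs.assign_seq hb hσ h (by simp [r1, r2, hhdef]) ?_ fun hσ1 => ?_
  · rw [abs_of_nonneg (by positivity)]; linarith
  refine Runs.assign_seq hb hσ1 ((1024 * n * h * h : ℕ) : ℤ) (by simp [r0]) ?_ fun hσ2 => ?_
  · rw [abs_of_nonneg (by positivity)]
    push_cast
    refine le_trans ?_ hk
    gcongr
  refine Runs.assign_seq hb hσ2 ((2 * n : ℕ) : ℤ) (by simp [r0]) ?_ fun hσ3 => ?_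
  · rw [abs_of_nonneg (by positivity)]; push_cast; linarith
  refine Runs.seq (Runs.fill hb hσ3 (2 * n) (by omega) (by push_cast; linarith) (fun _ => 1) ?_
    (fun _ _ => hone) fun _ _ _ _ _ _ => rfl) fun τ hτ hF hD => ?_
  · intro τ hF
    rw [eval_reg, hF.reg 6 rfl]
    simp
  have t0 : τ.reg 0 = n := by rw [hF.reg 0 rfl]; simp [r0]
  have t3 : τ.reg 3 = h := by rw [hF.reg 3 rfl]; simp
  have t4 : τ.reg 4 = ((1024 * n * h * h : ℕ) : ℤ) := by rw [hF.reg 4 rfl]; simp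
  have t5 : τ.reg 5 = 0 := by rw [hF.reg 5 rfl]; simp [inputMemory]
  have t6 : τ.reg 6 = ((2 * n : ℕ) : ℤ) := by rw [hF.reg 6 rfl]; simp
  refine Runs.seq (runs_listEdges (G := G) hb (by omega) hnb hτ t0 t5 ?_ ?_) ?_
  · intro i j
    rw [hF.arr 0 rfl]
    exact inputMemory_arr_zero G ε i j
  · intro a ha
    rw [hD, if_pos ha]
  rintro ρ hρ hG ⟨l, X, Y, hS⟩
  have u0 : ρ.reg 0 = n := by rw [hG.reg 0 rfl, t0]
  have u3 : ρ.reg 3 = h := by rw [hG.reg 3 rfl, t3]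
  have u4 : ρ.reg 4 = ((1024 * n * h * h : ℕ) : ℤ) := by rw [hG.reg 4 rfl, t4]
  have u6 : ρ.reg 6 = ((2 * n : ℕ) : ℤ) := by rw [hG.reg 6 rfl, t6]
  have uarr : ∀ a p, a = 1 ∨ a = 5 → ρ.arr a p = 0 := by
    rintro a p (rfl | rfl)
    · rw [hG.arr 1 rfl, hF.arr 1 rfl]; rfl
    · rw [hG.arr 5 rfl, hF.arr 5 rfl]; rfl
  have hE := hS.isEdgeList
  have hl : l ≤ n * n := hS.le
  have hlb : (l : ℤ) ≤ 2 ^ b := by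
    have : (l : ℤ) ≤ n * n := by exact_mod_cast hl
    nlinarith
  have hεR : (0 : ℝ) ≤ ε := by exact_mod_cast hε.le
  refine Runs.seq (R := fun ω => ∃ T ⊆ Finset.range l, (∀ e < l, ω.arr 5 e = if e ∈ T then 1 else 0) ∧
    IsSparsifier G ε (listedEdges n X Y T)) (Runs.ite hb hρ (fun htest => ?_) (fun htest => ?_)) ?_
  -- The test means `l ≤ 2k`. All edges are kept, and their number is within the bound since `2k =
  -- 2048 n h²`.
  · simp only [eval_sub, eval_add, eval_mul, eval_reg, eval_ofNat, eval_one, u4, hS.count] at htest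
    refine (Runs.fill hb hρ l (by omega) hlb (fun _ => 1) ?_ (fun _ _ => hone)
      fun _ _ _ _ _ _ => rfl).consequence fun ω _ _ hω => ?_
    · intro ω hH
      rw [eval_reg, hH.reg 5 rfl, hS.count]
    refine ⟨Finset.range l, subset_rfl, fun e he => ?_, hE.listedEdges_subset subset_rfl, ?_, ?_,
      spectralBounds_all hεR hE.listedEdges_range⟩
    · rw [hω, if_pos he, if_pos (Finset.mem_range.2 he)]
    · rw [← hE.listedEdges_range]
      exact fun h => Finset.coe_nonempty.1 h
    · rw [hE.card_listedEdges subset_rfl, Finset.card_range]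
      refine le_trans ?_ hsize
      have : l ≤ 2048 * n * h * h := by
        have : (l : ℤ) ≤ 2 * (1024 * n * h * h : ℕ) := by omega
        have : l ≤ 2 * (1024 * n * h * h) := by exact_mod_cast this
        linarith
      exact_mod_cast this
  · simp only [eval_sub, eval_add, eval_mul, eval_reg, eval_ofNat, eval_one, u4, hS.count] at htest
    have hklt : 2 * (1024 * n * h * h) < l := by
      have : 2 * ((1024 * n * h * h : ℕ) : ℤ) < l := by omega
      exact_mod_cast this
    -- With `W = 2n` the value `k = 1024 n h²` is exactly the least one allowed by `le_k`, and the
    -- failed test gives `2k < l`.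
    let I : EdgeSystem :=
      { W := 2 * n
        l := l
        k := 1024 * n * h * h
        h := h
        X := X
        Y := Y
        X_lt := fun e he => by
          obtain ⟨i, j, -, -, g1, -⟩ := hE.edge e he
          have := i.2; omega
        Y_lt := fun e he => by
          obtain ⟨i, j, -, -, -, g1⟩ := hE.edge e he
          have := j.2; omega
        h_pos := hh0
        k_lt := hklt
        le_k := by rw [sq, ← mul_assoc]; linarith }
    -- The degree counts match because `degSum` and `dN` unfold to the same sum.
    have hSt : I.Stored ρ := ⟨u3, u4, hS.count, u6, hS.arrX, hS.arrY, hS.deg⟩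
    have hsel : I.Selected ∅ ρ := fun e _ => by rw [uarr 5 e (Or.inr rfl)]; simp
    have hW2 : 2 * n + l + l ≤ m := by
      rcases Nat.eq_zero_or_pos n with rfl | hn
      · simp at hl; omega
      · nlinarith
    refine (EdgeSystem.runs_greedy hb (I := I) (hfit l hl) ?_ hW2 hρ hSt hsel).consequence ?_
    · change 2 * n * (2 * n) ≤ m
      linarith
    rintro ω _ _ ⟨T, hInv, hT⟩
    have hcard : (listedEdges n X Y T).card = 1024 * n * h * h := by
      rw [hE.card_listedEdges hInv.1, hInv.2.1]
    refine ⟨T, hInv.1, hT, hE.listedEdges_subset hInv.1, fun _ => ?_, ?_,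
      hInv.spectralBounds hE rfl hhε⟩
    · rw [← Finset.card_pos, hcard]
      exact I.k_pos
    · rw [hcard]
      refine le_trans ?_ hsize
      push_cast
      have : (0 : ℝ) ≤ n * h * h := by positivity
      linarith
  · rintro ω hω hH ⟨T, hT, hC, hsp⟩
    refine Runs.seq (runs_writeOutput hb hE hT (by omega) hω (by rw [hH.reg 0 rfl, u0])
      (by rw [hH.reg 5 rfl, hS.count]) (fun e he => by rw [hH.arr 2 rfl, hS.arrX e he])
      (fun e he => by rw [hH.arr 3 rfl, hS.arrY e he]) hC
      (fun p => by rw [hH.arr 1 rfl, uarr 1 p (Or.inl rfl)])) fun ξ hξ _ hout => ?_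
    exact Runs.skip hb hξ ⟨_, hout, hsp⟩

/-- The program computes a sparsifier in polynomial time. -/
theorem exists_polynomial_sparsify : ∃ p : Polynomial ℕ, ∀ (n : ℕ) (G : SimpleGraph (Fin n)) (ε : ℚ),
    0 < ε → ∃ (t : ℕ) (τ : Memory) (F : Finset (Sym2 (Fin n))),
      Exec sparsify (inputMemory G ε) t τ ∧ t ≤ p.eval (inputSize n ε) ∧ IsOutput τ F ∧
        IsSparsifier G ε F := by
  obtain ⟨f, hf⟩ := sparsify.exists_polynomial_time
  -- With `L` the input size, loops run at most `m = 4 L` times and stored numbers have at most `b =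
  -- 36 L²` bits, so the time bound is `time (4 L) * (36 L²)`.
  refine ⟨f.comp (4 * .X) * (36 * .X ^ 2), fun n G ε hε => ?_⟩
  set L := inputSize n ε with hL
  -- The adjacency matrix is part of the input, so `l ≤ n² ≤ L`. This keeps the bit length of `cap`,
  -- a power with exponent `l`, quadratic in `L`.
  have hn : n * n ≤ L := by rw [hL, inputSize, sq]; omega
  have hden : ε.den < 2 ^ L := Nat.size_le.1 (by rw [hL, inputSize]; omega)
  have hnum : ε.num.natAbs < 2 ^ L := Nat.size_le.1 (by rw [hL, inputSize]; omega)
  have hL1 : 1 ≤ L := by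
    have : 0 < Nat.size ε.den := Nat.size_pos.2 ε.den_pos
    rw [hL, inputSize]; omega
  have hLL : L ≤ L ^ 2 := by rw [sq]; exact Nat.le_mul_self L
  have hLpow : L < 2 ^ L := Nat.lt_two_pow_self
  have mono : ∀ {a : ℕ}, a ≤ 36 * L ^ 2 → (2 : ℤ) ^ a ≤ 2 ^ (36 * L ^ 2) := fun h =>
    pow_le_pow_right₀ (by norm_num) h
  have hdenZ : (ε.den : ℤ) + 1 ≤ 2 ^ L := by
    have : ε.den + 1 ≤ 2 ^ L := hden
    exact_mod_cast this
  have hLZ : (L : ℤ) + 1 ≤ 2 ^ L := by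
    have : L + 1 ≤ 2 ^ L := hLpow
    exact_mod_cast this
  have hnZ : (n : ℤ) * n ≤ L := by exact_mod_cast hn
  have hnZ' : (n : ℤ) ≤ 2 ^ L := by
    have : n ≤ n * n := Nat.le_mul_self n
    have : (n : ℤ) ≤ L := by exact_mod_cast this.trans hn
    linarith
  have hrun := runs_sparsify (b := 36 * L ^ 2) (m := 4 * L) (by nlinarith) G hε ?_ ?_ ?_ ?_ ?_
    (by linarith) ?_
  · obtain ⟨t, τ, h1, h2, -, F, h3, h4⟩ := hrun
    refine ⟨t, τ, F, h1, ?_, h3, h4⟩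
    have : (f.comp (4 * Polynomial.X) * (36 * Polynomial.X ^ 2)).eval L = sparsify.time (4 * L) * (36 * L ^ 2) := by
      simp [hf]
    rw [this]
    exact h2
  · refine le_trans ?_ (mono (a := L) (by linarith))
    rw [Int.abs_eq_natAbs]
    exact_mod_cast hnum.le
  · exact le_trans (by linarith) (mono (a := L) (by linarith))
  · refine le_trans ?_ (mono (a := 10 + L + L + L) (by linarith))
    rw [pow_add, pow_add, pow_add]
    norm_num only [show (2 : ℤ) ^ 10 = 1024 by norm_num]
    gcongr
  · exact hdenZ.trans (mono (by linarith))
  · refine le_trans ?_ (mono (a := 2 + L) (by linarith))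
    rw [pow_add]
    linarith
  · intro l hl
    have hlL : l ≤ L := hl.trans hn
    have hl2 : (l : ℤ) ≤ 2 ^ L := by
      have : (l : ℤ) ≤ L := by exact_mod_cast hlL
      linarith
    have h1 : (l : ℤ) ^ 5 ≤ 2 ^ (L * 5) := by
      rw [pow_mul]
      exact pow_le_pow_left₀ (by positivity) hl2 5
    have h2 : 73 * (l : ℤ) ^ 5 ≤ 2 ^ (7 + L * 5) := by
      rw [pow_add]
      linarith [show (0 : ℤ) ≤ 2 ^ (L * 5) by positivity]
    have h3 : 100 * (l : ℤ) ^ 5 ≤ 2 ^ (7 + L * 5) := by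
      rw [pow_add]
      linarith [show (0 : ℤ) ≤ 2 ^ (L * 5) by positivity]
    have h4 : (73 * (l : ℤ) ^ 5) ^ l ≤ 2 ^ ((7 + L * 5) * L) := by
      calc (73 * (l : ℤ) ^ 5) ^ l ≤ (2 ^ (7 + L * 5)) ^ l := pow_le_pow_left₀ (by positivity) h2 l
        _ ≤ (2 ^ (7 + L * 5)) ^ L := pow_le_pow_right₀ (one_le_pow₀ (by norm_num)) hlL
        _ = _ := (pow_mul _ _ _).symm
    have h5 : ((73 * (l : ℤ) ^ 5) ^ l) ^ 2 ≤ 2 ^ ((7 + L * 5) * L * 2) := by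
      rw [pow_mul _ _ 2]
      exact pow_le_pow_left₀ (by positivity) h4 2
    -- The exponent is `10 L² + 19 L + 7`, at most `36 L²` for `L ≥ 1`; this determines the constant
    -- `36`.
    refine le_trans ?_ (mono (a := 7 + L * 5 + (7 + L * 5) * L * 2) (by nlinarith))
    rw [pow_add _ (7 + L * 5)]
    exact mul_le_mul h3 h5 (by positivity) (by positivity)

end AdditiveSparsifier

theorem theorem1 :
    ∃ (C : ℝ) (alg : ∀ n : ℕ, SimpleGraph (Fin n) → ℚ → Finset (Sym2 (Fin n))),
      AdditiveSparsifier.PolyTimeComputable alg ∧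
      ∀ (n : ℕ) (G : SimpleGraph (Fin n)) (ε : ℚ), 0 < ε →
        (alg n G ε : Set (Sym2 (Fin n))) ⊆ G.edgeSet ∧
        (G.edgeSet.Nonempty → (alg n G ε).Nonempty) ∧
        ((alg n G ε).card : ℝ) ≤ C * (n : ℝ) / (min 1 (ε : ℝ)) ^ 2 ∧
        AdditiveSparsifier.SpectralBounds G (ε : ℝ) (alg n G ε) := by
  classical
  obtain ⟨p, hp⟩ := AdditiveSparsifier.exists_polynomial_sparsify
  -- The algorithm is defined as the set that the program writes, so computability and the
  -- sparsifier property refer to the same `F`. The value for `ε ≤ 0` plays no role.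
  choose t τ F h using hp
  refine ⟨8192, fun n G ε => if hε : 0 < ε then F n G ε hε else ∅,
    ⟨AdditiveSparsifier.sparsify, p, fun n G ε hε => ?_⟩, fun n G ε hε => ?_⟩
  · refine ⟨t n G ε hε, τ n G ε hε, (h n G ε hε).1, (h n G ε hε).2.1, ?_⟩
    beta_reduce
    rw [dif_pos hε]
    exact (h n G ε hε).2.2.1
  · beta_reduce
    rw [dif_pos hε]
    exact (h n G ε hε).2.2.2
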